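/- Let $p\ge 1$ be an integer and let $U_+,U_-\subset\mathbb Z$ be finite sets with $U_+\cap U_-=\varnothing$ and $N:=|U_+|+|U_-|\ge 1$, such that $U:=U_+\cup U_-$ is simply connected, i.e. no element of $\mathbb Z\setminus U$ lies between two elements of $U$. For $\epsilon>0$ let $L$ be the bounded operator on $l^2(\mathbb Z)\times l^2(\mathbb Z)$ $$L=\begin{bmatrix}-\epsilon\Delta+I-(1+p)V & -pV\\ pV & \epsilon\Delta-I+(1+p)V\end{bmatrix},\qquad (\Delta u)_n=u_{n+1}-2u_n+u_{n-1},\qquad (Vu)_n=\sum_{m\in U}\delta_{n,m}u_m,$$ so that $V$ is multiplication by $(\phi^{(0)})^{2p}$ for the compact limiting configuration $\phi^{(0)}=\sum_{n\in U_+}\delta_n-\sum_{n\in U_-}\delta_n$. Let $R_L(\Omega)=(L-\Omega)^{-1}$, let $B_\delta(0)\subset\mathbb C$ be the open disk of radius $\delta$ centred at $0$, and let $\sigma_c=[1,1+4\epsilon]\cup[-1-4\epsilon,-1]$. For $s\in\mathbb R$ let $l^q_s(\mathbb Z)$ be the space of complex sequences $u$ with $\{(1+n^2)^{s/2}u_n\}_{n\in\mathbb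 Z}\in l^q(\mathbb Z)$, with the corresponding norm. There exist $\epsilon_0>0$ and $\delta>0$, both of which can be taken arbitrarily small, such that for every $\epsilon\in(0,\epsilon_0)$: 1. for every $\Omega\in\mathbb C$ with $\Omega\notin B_\delta(0)\cup\sigma_c$, the operator $L-\Omega$ has a bounded inverse $R_L(\Omega)$ on $l^2(\mathbb Z)\times l^2(\mathbb Z)$; 2. in $B_\delta(0)$ the function $R_L$ has no singularities other than poles, and it has exactly $2N$ poles there counting multiplicities, the multiplicity of a pole $\Omega_0$ being the (finite) algebraic multiplicity $\dim\bigcup_k\ker(L-\Omega_0)^k$; 3. for every $\Omega\in\sigma_c$ the limits $R_L^\pm(\Omega)=\lim_{\mu\downarrow0}R_L(\Omega\pm i\mu)$ exist as bounded operators from $l^1_1\times l^1_1$ to $l^\infty\times l^\infty$, in the sense that $R_L(\Omega\pm i\mu)h\to R_L^\pm(\Omega)h$ in $l^2_{-\sigma}\times l^2_{-\sigma}$ for every $h\in l^1_1\times l^1_1$ and every $\sigma>\frac12$; for $\Omega$ in the interior of $\sigma_c$ (as a subset of $\mathbb R$) the limits also exist in the operator norm from $l^2_\sigma\times l^2_\sigma$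 to $l^2_{-\sigma}\times l^2_{-\sigma}$ for every $\sigma>\frac12$. Moreover $$\|R_L^\pm(\Omega)\|_{l^1_1\times l^1_1\to l^\infty\times l^\infty}\le C\epsilon^{-1}\qquad\text{for all }\Omega\in\sigma_c,$$ with a constant $C>0$ that depends on neither $\epsilon\in(0,\epsilon_0)$ nor $\Omega\in\sigma_c$. -/

import Mathlib

open Filter Topology
open scoped ENNReal

noncomputable section

namespace DNLS

/-! ### Weighted sequence spaces -/

/-- The weight `(1 + n²)^(s/2)`. -/
def weight (s : ℝ) (n : ℤ) : ℝ := (1 + (n : ℝ) ^ 2) ^ (s / 2)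

theorem weight_pos (s : ℝ) (n : ℤ) : 0 < weight s n :=
  Real.rpow_pos_of_pos (by positivity) _

theorem one_le_weight {s : ℝ} (hs : 0 ≤ s) (n : ℤ) : 1 ≤ weight s n :=
  Real.one_le_rpow (by nlinarith [sq_nonneg (n : ℝ)]) (by positivity)

theorem weight_le_one {s : ℝ} (hs : s ≤ 0) (n : ℤ) : weight s n ≤ 1 :=
  Real.rpow_le_one_of_one_le_of_nonpos (by nlinarith [sq_nonneg (n : ℝ)]) (by linarith)

/-- A copy of `ℂ`, carrying the norm `(1 + n²)^(s/2) |x|`. -/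
def Fiber (_s : ℝ) (_n : ℤ) : Type := ℂ

namespace Fiber

variable (s : ℝ) (n : ℤ)

instance : AddCommGroup (Fiber s n) := inferInstanceAs (AddCommGroup ℂ)
instance : Module ℂ (Fiber s n) := inferInstanceAs (Module ℂ ℂ)

/-- The identity map from the weighted copy of `ℂ` to `ℂ`. -/
def val : Fiber s n ≃ₗ[ℂ] ℂ := LinearEquiv.refl ℂ ℂ

/-- Multiplication by the weight. -/
def scale : Fiber s n →ₗ[ℂ] ℂ := (weight s n : ℂ) • (val s n).toLinearMap

theorem scale_injective : Function.Injective (scale s n) := by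
  intro x y h
  have hw : (weight s n : ℂ) ≠ 0 := by exact_mod_cast (weight_pos s n).ne'
  have h' : (weight s n : ℂ) * val s n x = (weight s n : ℂ) * val s n y := h
  exact (val s n).injective (mul_left_cancel₀ hw h')

instance : NormedAddCommGroup (Fiber s n) :=
  NormedAddCommGroup.induced (Fiber s n) ℂ (scale s n) (scale_injective s n)

instance : NormedSpace ℂ (Fiber s n) := NormedSpace.induced ℂ (Fiber s n) ℂ (scale s n)

theorem norm_def (x : Fiber s n) : ‖x‖ = weight s n * ‖val s n x‖ := by
  have h : ‖x‖ = ‖(weight s n : ℂ) * val s n x‖ := rfl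
  rw [h, norm_mul, Complex.norm_real, Real.norm_of_nonneg (weight_pos s n).le]

end Fiber

/-- The weighted space `l^q_s(ℤ)`: complex sequences `u` such that `(1 + n²)^(s/2) u_n` is
in `l^q(ℤ)`. -/
abbrev Wlp (q : ℝ≥0∞) (s : ℝ) : Type := lp (Fiber s) q

/-- The space `l^q(ℤ)`. -/
abbrev Slp (q : ℝ≥0∞) : Type := lp (fun _ : ℤ => ℂ) q

/-- `l^q_s(ℤ) × l^q_s(ℤ)` -/
abbrev PairW (q : ℝ≥0∞) (s : ℝ) : Type := Wlp q s × Wlp q s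

/-- `l^q(ℤ) × l^q(ℤ)` -/
abbrev Pair (q : ℝ≥0∞) : Type := Slp q × Slp q

/-- The `n`-th entry of a weighted sequence. -/
def Wlp.coord {q : ℝ≥0∞} {s : ℝ} (u : Wlp q s) (n : ℤ) : ℂ := Fiber.val s n (u n)

/-! ### Inclusions between the spaces -/

theorem norm_val_le {s : ℝ} (hs : 0 ≤ s) (n : ℤ) (x : Fiber s n) :
    ‖Fiber.val s n x‖ ≤ ‖x‖ := by
  rw [Fiber.norm_def]
  exact le_mul_of_one_le_left (norm_nonneg _) (one_le_weight hs n)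

theorem norm_val_symm_le {s : ℝ} (hs : s ≤ 0) (n : ℤ) (x : ℂ) :
    ‖(Fiber.val s n).symm x‖ ≤ ‖x‖ := by
  rw [Fiber.norm_def, LinearEquiv.apply_symm_apply]
  exact mul_le_of_le_one_left (norm_nonneg _) (weight_le_one hs n)

/-- The inclusion `l^q_s ⊂ l^q` for `s ≥ 0`. -/
def inclW (q : ℝ≥0∞) [Fact (1 ≤ q)] {s : ℝ} (hs : 0 ≤ s) : Wlp q s →L[ℂ] Slp q :=
  LinearMap.mkContinuous
    { toFun := fun u => ⟨fun n => Fiber.val s n (u n),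
        (lp.memℓp u).mono' fun n => norm_val_le hs n (u n)⟩
      map_add' := fun u v => by ext n; exact map_add (Fiber.val s n) (u n) (v n)
      map_smul' := fun c u => by ext n; exact map_smul (Fiber.val s n) c (u n) } 1
    (fun u => by
      rw [one_mul]
      exact lp.norm_mono (zero_lt_one.trans_le Fact.out).ne' fun n => norm_val_le hs n (u n))

/-- The inclusion `l^q ⊂ l^q_s` for `s ≤ 0`. -/
def inclS (q : ℝ≥0∞) [Fact (1 ≤ q)] {s : ℝ} (hs : s ≤ 0) : Slp q →L[ℂ] Wlp q s :=
  LinearMap.mkContinuous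
    { toFun := fun u => ⟨fun n => (Fiber.val s n).symm (u n),
        (lp.memℓp u).mono' fun n => norm_val_symm_le hs n (u n)⟩
      map_add' := fun u v => by ext n; exact map_add ((Fiber.val s n).symm) (u n) (v n)
      map_smul' := fun c u => by ext n; exact map_smul ((Fiber.val s n).symm) c (u n) } 1
    (fun u => by
      rw [one_mul]
      exact lp.norm_mono (zero_lt_one.trans_le Fact.out).ne' fun n => norm_val_symm_le hs n (u n))

/-- The inclusion `l¹_1 × l¹_1 ⊂ l² × l²`. -/
def inclOne : PairW 1 1 →ₗ[ℂ] Pair 2 :=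
  let j : Wlp 1 1 →ₗ[ℂ] Slp 2 :=
    (lp.linearMapOfLE (𝕜 := ℂ) (E := fun _ : ℤ => ℂ) (p := 1) (q := 2) (by norm_num)).comp
      (inclW 1 zero_le_one).toLinearMap
  j.prodMap j

/-- The inclusion `l²_σ × l²_σ ⊂ l² × l²` for `σ ≥ 0`. -/
def inclSigma {σ : ℝ} (hσ : 0 ≤ σ) : PairW 2 σ →L[ℂ] Pair 2 :=
  (inclW 2 hσ).prodMap (inclW 2 hσ)

/-- The inclusion `l² × l² ⊂ l²_{-σ} × l²_{-σ}` for `σ ≥ 0`. -/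
def inclNeg {σ : ℝ} (hσ : 0 ≤ σ) : Pair 2 →L[ℂ] PairW 2 (-σ) :=
  (inclS 2 (neg_nonpos.mpr hσ)).prodMap (inclS 2 (neg_nonpos.mpr hσ))

/-! ### The operator `L` and its resolvent -/

theorem memlp_shift (k : ℤ) (u : Slp 2) : Memℓp (fun n : ℤ => u (n + k)) 2 := by
  have h := (memℓp_gen_iff (p := 2) (by norm_num)).1 (lp.memℓp u)
  exact (memℓp_gen_iff (p := 2) (by norm_num)).2
    ((Equiv.addRight k).summable_iff.2 h)

/-- The translation `(S_k u)_n = u_{n+k}` on `l²(ℤ)`. -/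
def shift (k : ℤ) : Slp 2 →L[ℂ] Slp 2 :=
  LinearMap.mkContinuous
    { toFun := fun u => ⟨fun n => u (n + k), memlp_shift k u⟩
      map_add' := fun _ _ => by ext n; rfl
      map_smul' := fun _ _ => by ext n; rfl } 1
    (fun u => by
      rw [one_mul]
      refine lp.norm_le_of_tsum_le (by norm_num) (norm_nonneg u) ?_
      rw [lp.norm_rpow_eq_tsum (by norm_num) u]
      exact ((Equiv.addRight k).tsum_eq (fun n => ‖u n‖ ^ (2 : ℝ≥0∞).toReal)).le)

/-- The discrete Laplacian `(Δu)_n = u_{n+1} - 2 u_n + u_{n-1}`. -/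
def laplacian : Slp 2 →L[ℂ] Slp 2 :=
  shift 1 - (2 : ℂ) • ContinuousLinearMap.id ℂ (Slp 2) + shift (-1)

/-- The compact potential `(Vu)_n = ∑_{m ∈ U} δ_{n,m} u_m`. -/
def potential (U : Finset ℤ) : Slp 2 →L[ℂ] Slp 2 :=
  ∑ m ∈ U, (lp.singleContinuousLinearMap ℂ (fun _ : ℤ => ℂ) 2 m).comp
    (lp.evalCLM ℂ (fun _ : ℤ => ℂ) 2 m)

theorem laplacian_apply (u : Slp 2) (n : ℤ) :
    laplacian u n = u (n + 1) - 2 * u n + u (n - 1) := by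
  have h : laplacian u n = u (n + 1) - (2 : ℂ) * u n + u (n + -1) := rfl
  rw [h, sub_eq_add_neg n 1]

theorem potential_apply (U : Finset ℤ) (u : Slp 2) (n : ℤ) :
    potential U u n = if n ∈ U then u n else 0 := by
  have h : potential U u = ∑ m ∈ U, lp.single (E := fun _ : ℤ => ℂ) 2 m (u m) := by
    simp only [potential, sum_apply]
    rfl
  rw [h, lp.coeFn_sum, Finset.sum_apply]
  simp [lp.single_apply, Pi.single_apply]

/-- The entry `-ε Δ + I - (1 + p) V` of `L`. -/
def diagonalBlock (U : Finset ℤ) (p : ℕ) (ε : ℝ) : Slp 2 →L[ℂ] Slp 2 :=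
  -((ε : ℂ) • laplacian) + ContinuousLinearMap.id ℂ (Slp 2) - (1 + p : ℂ) • potential U

/-- The operator
`L (a, b) = ((-εΔ + I - (1+p)V) a - pV b, pV a + (εΔ - I + (1+p)V) b)` on `l² × l²`. -/
def opL (U : Finset ℤ) (p : ℕ) (ε : ℝ) : Pair 2 →L[ℂ] Pair 2 :=
  ((diagonalBlock U p ε).coprod (-((p : ℂ) • potential U))).prod
    (((p : ℂ) • potential U).coprod (-diagonalBlock U p ε))

/-- `Ω` is a regular point: `L - Ω` is boundedly invertible on `l² × l²`. -/
def IsRegular (L : Pair 2 →L[ℂ] Pair 2) (Ω : ℂ) : Prop :=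
  IsUnit (L - Ω • ContinuousLinearMap.id ℂ (Pair 2))

/-- The resolvent `R_L(Ω) = (L - Ω)⁻¹` (with the value `0` if `L - Ω` is not invertible). -/
def resolv (L : Pair 2 →L[ℂ] Pair 2) (Ω : ℂ) : Pair 2 →L[ℂ] Pair 2 :=
  Ring.inverse (L - Ω • ContinuousLinearMap.id ℂ (Pair 2))

/-- `Ω₀` is a pole of the operator-valued function `R_L`: an isolated singularity at which the
Laurent series of `R_L` has a nonzero and finite principal part. -/
def IsPole (L : Pair 2 →L[ℂ] Pair 2) (Ω₀ : ℂ) : Prop :=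
  (∀ᶠ Ω in 𝓝[≠] Ω₀, IsRegular L Ω) ∧ MeromorphicAt (resolv L) Ω₀ ∧
    meromorphicOrderAt (resolv L) Ω₀ < 0

/-- The generalized eigenspace `⋃ₖ ker (L - Ω₀)ᵏ`; at a pole of `R_L` it is the range of the
residue of `R_L`, and its dimension is the multiplicity of the pole. -/
def genEigenspace (L : Pair 2 →L[ℂ] Pair 2) (Ω₀ : ℂ) : Submodule ℂ (Pair 2) :=
  Module.End.maxGenEigenspace (L : Pair 2 →ₗ[ℂ] Pair 2) Ω₀

/-- Inside `D`, the resolvent `R_L` has no singularities other than poles, there are finitely many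
of these, all of finite multiplicity, and the sum of their multiplicities is `k`. -/
def HasExactlyPolesIn (L : Pair 2 →L[ℂ] Pair 2) (D : Set ℂ) (k : ℕ) : Prop :=
  (∀ Ω ∈ D, IsRegular L Ω ∨ IsPole L Ω) ∧
    ∃ S : Finset ℂ, (S : Set ℂ) = {Ω ∈ D | IsPole L Ω} ∧
      (∀ Ω ∈ S, FiniteDimensional ℂ (genEigenspace L Ω)) ∧
      ∑ Ω ∈ S, Module.finrank ℂ (genEigenspace L Ω) = k

/-- The real set `[1, 1 + 4ε] ∪ [-1 - 4ε, -1]`. -/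
def bands (ε : ℝ) : Set ℝ := Set.Icc 1 (1 + 4 * ε) ∪ Set.Icc (-1 - 4 * ε) (-1)

/-! ### Boundary values of the resolvent on the real axis -/

/-- `B : l¹_1 × l¹_1 → l^∞ × l^∞` is the limit of `R_L(Ω + iτμ)` as `μ ↓ 0` (with `τ = 1` for
`R_L⁺(Ω)` and `τ = -1` for `R_L⁻(Ω)`): for every `h`, the sequences `R_L(Ω + iτμ) h` converge to
`B h` in `l²_{-σ} × l²_{-σ}`, for each `σ > 1/2`. -/
def IsBoundaryValue (L : Pair 2 →L[ℂ] Pair 2) (τ Ω : ℝ) (B : PairW 1 1 →L[ℂ] Pair ∞) : Prop :=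
  ∀ (h : PairW 1 1) (σ : ℝ) (hσ : 1 / 2 < σ), ∃ u : PairW 2 (-σ),
    (∀ n, u.1.coord n = (B h).1 n ∧ u.2.coord n = (B h).2 n) ∧
    Tendsto (fun μ : ℝ => inclNeg (by linarith : 0 ≤ σ)
        (resolv L (Ω + Complex.I * (τ * μ)) (inclOne h)))
      (𝓝[>] 0) (𝓝 u)

/-- The limit of `R_L(Ω + iτμ)` as `μ ↓ 0` exists in the operator norm from `l²_σ × l²_σ` to
`l²_{-σ} × l²_{-σ}`, for each `σ > 1/2`. -/
def HasWeightedLimit (L : Pair 2 →L[ℂ] Pair 2) (τ Ω : ℝ) : Prop :=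
  ∀ (σ : ℝ) (hσ : 1 / 2 < σ), ∃ T : PairW 2 σ →L[ℂ] PairW 2 (-σ),
    Tendsto (fun μ : ℝ => (inclNeg (by linarith : 0 ≤ σ)).comp
        ((resolv L (Ω + Complex.I * (τ * μ))).comp (inclSigma (by linarith : 0 ≤ σ))))
      (𝓝[>] 0) (𝓝 T)

end DNLS

end

/-! The set U is an interval [u, v], and V is the projection onto the sequences supported there; the
signs of the limiting configuration play no role.

Away from the disk around 0, all sites outside [u, v] can be eliminated exactly. Choose z and w in
the unit disk with ε(z + 1/z - 2) = 1 - Ω and ε(w + 1/w - 2) = 1 + Ω. Then L - Ω is a product of a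
triangular factor 1 - z S (hops towards [u, v]), a scalar of size ε/|z| or ε/|w| outside [u, v], a
finite core operator, and a triangular factor with hops away from [u, v] (`opL_sub_eq`). At ε = 0
the core operator consists of N copies of the 2×2 matrix K - Ω with K² = 0, so it is invertible for
Ω ≠ 0. The correction is O(ε) uniformly for |z|, |w| ≤ 1, hence the core stays invertible for |Ω| ≥
δ and small ε (`isUnit_coreOp`). Off the bands the roots z and w exist, which gives claim 1.

At the bands z or w reaches the unit circle. The inverse triangular factors have matrix entries that
are polynomials in z or w, so every entry of the resolvent has a limit, even at the band edges. The
exterior part of an entry is z/ε or -w/ε times a sum bounded by the distance of the column index to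
[u, v]; the core part is bounded independently of ε. This explains both the weight in l¹_1 and the
factor 1/ε. Away from the edges z² ≠ 1 and w² ≠ 1, geometric sums bound the entries uniformly, and
the convergence holds in a weighted Hilbert–Schmidt norm (`kernelLimit_resolv`,
`exists_boundaryValue`, `exists_weighted_limit`).

Inside the disk the argument is a perturbation of invariant subspaces. At ε = 0 the operator L
preserves the 2N-dimensional space of pairs supported in [u, v], squares to zero there, and squares
to the identity on the complement. A fixed point of a Riccati equation continues this space to an
invariant subspace for small ε (`exists_invariant_graph`). The restriction of L to it has all its
eigenvalues in the disk, the complementary part is invertible there, and the poles are the roots of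
a characteristic polynomial of degree 2N (`hasExactlyPolesIn_of_invariant`). -/

noncomputable section

namespace DNLS

/-! ### Restrictions and shifts on `l²(ℤ)` -/

/-- Bounded operators on `l²(ℤ)`. -/
abbrev Op : Type := Slp 2 →L[ℂ] Slp 2

/-- Multiplication by the indicator function of `s`. -/
def restr (s : Set ℤ) : Op :=
  LinearMap.mkContinuous
    { toFun := fun f => ⟨s.indicator f, (lp.memℓp f).mono' fun n => norm_indicator_le_norm_self _ n⟩
      map_add' := fun f g => by ext n; exact congrFun (Set.indicator_add s f g) n
      map_smul' := fun c f => by ext n; exact congrFun (Set.indicator_const_smul s c f) n } 1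
    (fun f => by
      rw [one_mul]
      exact lp.norm_mono (by norm_num) fun n => norm_indicator_le_norm_self _ n)

theorem restr_apply (s : Set ℤ) (f : Slp 2) (n : ℤ) : restr s f n = s.indicator f n := rfl

theorem shift_apply (k : ℤ) (f : Slp 2) (n : ℤ) : shift k f n = f (n + k) := rfl

theorem norm_restr_le (s : Set ℤ) : ‖restr s‖ ≤ 1 := LinearMap.mkContinuous_norm_le _ zero_le_one _

theorem norm_shift_le (k : ℤ) : ‖shift k‖ ≤ 1 := LinearMap.mkContinuous_norm_le _ zero_le_one _

theorem op_add_apply (A B : Op) (f : Slp 2) (n : ℤ) : (A + B) f n = A f n + B f n := rfl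
theorem op_sub_apply (A B : Op) (f : Slp 2) (n : ℤ) : (A - B) f n = A f n - B f n := rfl
theorem op_mul_apply (A B : Op) (f : Slp 2) (n : ℤ) : (A * B) f n = A (B f) n := rfl
theorem op_one_apply (f : Slp 2) (n : ℤ) : (1 : Op) f n = f n := rfl
theorem op_zero_apply (f : Slp 2) (n : ℤ) : (0 : Op) f n = 0 := rfl

/-- The canonical basis of `l²(ℤ)`. -/
def basisVec (m : ℤ) : Slp 2 := lp.single (E := fun _ : ℤ => ℂ) 2 m (1 : ℂ)

theorem basisVec_apply (m n : ℤ) : basisVec m n = if n = m then 1 else 0 := by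
  simp [basisVec, Pi.single_apply]

theorem norm_basisVec (m : ℤ) : ‖basisVec m‖ = 1 := by
  rw [basisVec, lp.norm_single (by norm_num), norm_one]

/-! ### Hops relative to an interval: ℤ as a tree rooted in [u, v] -/

section Interval

variable (u v : ℤ)

/-- The neighbour of `n` in the direction of `[u, v]`. -/
def parent (n : ℤ) : ℤ := if v < n then n - 1 else if n < u then n + 1 else n

/-- The distance from `n` to `[u, v]`. -/
def depth (n : ℤ) : ℕ := (n - v).toNat + (u - n).toNat

/-- The translations away from `[u, v]`, on either side of this interval. -/
def outRight : Op := restr {n | v < n} * shift (-1)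
def outLeft : Op := restr {n | n < u} * shift 1

/-- The translations towards `[u, v]`, on either side of this interval. -/
def inRight : Op := shift 1 * restr {n | v < n}
def inLeft : Op := shift (-1) * restr {n | n < u}

def outward : Op := outRight v + outLeft u
def inward : Op := inRight v + inLeft u

/-- The projection onto the sequences supported in `[u, v]`. -/
def core : Op := restr (Set.Icc u v)

/-- The compression of `S_1 + S_{-1}` to `[u, v]`. -/
def coreHop : Op := core u v * (shift 1 + shift (-1)) * core u v

/-- `δ_u + δ_v`, as a multiplication operator. -/
def ends : Op := restr {u} + restr {v}

variable {u v}

theorem norm_outRight_le : ‖outRight v‖ ≤ 1 :=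
  (norm_mul_le _ _).trans (mul_le_one₀ (norm_restr_le _) (norm_nonneg _) (norm_shift_le _))
theorem norm_outLeft_le : ‖outLeft u‖ ≤ 1 :=
  (norm_mul_le _ _).trans (mul_le_one₀ (norm_restr_le _) (norm_nonneg _) (norm_shift_le _))
theorem norm_inRight_le : ‖inRight v‖ ≤ 1 :=
  (norm_mul_le _ _).trans (mul_le_one₀ (norm_shift_le _) (norm_nonneg _) (norm_restr_le _))
theorem norm_inLeft_le : ‖inLeft u‖ ≤ 1 :=
  (norm_mul_le _ _).trans (mul_le_one₀ (norm_shift_le _) (norm_nonneg _) (norm_restr_le _))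
theorem norm_core_le : ‖core u v‖ ≤ 1 := norm_restr_le _
theorem norm_ends_le : ‖ends u v‖ ≤ 2 :=
  (norm_add_le _ _).trans (by linarith [norm_restr_le {u}, norm_restr_le {v}])
theorem norm_coreHop_le : ‖coreHop u v‖ ≤ 2 := by
  have h1 : ‖shift 1 + shift (-1)‖ ≤ 2 :=
    (norm_add_le _ _).trans (by linarith [norm_shift_le 1, norm_shift_le (-1)])
  calc ‖coreHop u v‖ ≤ ‖core u v‖ * ‖shift 1 + shift (-1)‖ * ‖core u v‖ :=
        (norm_mul_le _ _).trans (by gcongr; exact norm_mul_le _ _)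
    _ ≤ 1 * 2 * 1 := by gcongr <;> exact norm_core_le
    _ = 2 := by norm_num

theorem core_eq_potential : core u v = potential (Finset.Icc u v) := by
  ext f n
  rw [potential_apply, core, restr_apply, Set.indicator_apply]
  simp

theorem core_apply (f : Slp 2) (n : ℤ) : core u v f n = if u ≤ n ∧ n ≤ v then f n else 0 := by
  rw [core, restr_apply, Set.indicator_apply]; simp

theorem outward_apply_of_mem {n : ℤ} (hn : n ∈ Set.Icc u v) (f : Slp 2) : outward u v f n = 0 := by
  obtain ⟨h1, h2⟩ := hn
  have hn1 : ¬ v < n := not_lt.mpr h2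
  have hn2 : ¬ n < u := not_lt.mpr h1
  simp [outward, outRight, outLeft, restr_apply, hn1, hn2]

theorem outward_apply_of_notMem (huv : u ≤ v) {n : ℤ} (hn : n ∉ Set.Icc u v) (f : Slp 2) :
    outward u v f n = f (parent u v n) := by
  have h : v < n ∨ n < u := by
    by_contra! h
    exact hn ⟨h.2, h.1⟩
  rcases h with h | h
  · have h2 : ¬ n < u := by omega
    simp [outward, outRight, outLeft, restr_apply, shift_apply, h, h2, parent, ← sub_eq_add_neg]
  · have h2 : ¬ v < n := by omega
    simp [outward, outRight, outLeft, restr_apply, shift_apply, h, h2, parent]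

theorem inward_basisVec_of_mem {m : ℤ} (hm : m ∈ Set.Icc u v) :
    inward u v (basisVec m) = 0 := by
  obtain ⟨h1, h2⟩ := hm
  ext n
  simp only [inward, inRight, inLeft, op_add_apply, op_mul_apply, restr_apply, Set.indicator_apply,
    shift_apply, basisVec_apply, Set.mem_ofPred_eq, lp.coeFn_zero, Pi.zero_apply]
  split_ifs <;> first | omega | simp

theorem inward_basisVec_of_notMem (huv : u ≤ v) {m : ℤ} (hm : m ∉ Set.Icc u v) :
    inward u v (basisVec m) = basisVec (parent u v m) := by
  have h : v < m ∨ m < u := by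
    by_contra! h
    exact hm ⟨h.2, h.1⟩
  ext n
  simp only [inward, inRight, inLeft, op_add_apply, op_mul_apply, restr_apply, Set.indicator_apply,
    shift_apply, basisVec_apply, Set.mem_ofPred_eq, parent]
  split_ifs <;> first | omega | simp

theorem depth_eq_zero_iff (n : ℤ) : depth u v n = 0 ↔ n ∈ Set.Icc u v := by
  rw [depth, Set.mem_Icc]; omega

theorem depth_parent (huv : u ≤ v) {n : ℤ} (hn : n ∉ Set.Icc u v) :
    depth u v n = depth u v (parent u v n) + 1 := by
  have h : v < n ∨ n < u := by
    by_contra! h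
    exact hn ⟨h.2, h.1⟩
  unfold depth parent
  split_ifs <;> omega

theorem parent_of_mem {n : ℤ} (hn : n ∈ Set.Icc u v) : parent u v n = n := by
  have h1 := hn.1
  have h2 := hn.2
  simp [parent, not_lt.mpr h1, not_lt.mpr h2]

/-! ### The factorization of the Laplacian -/

theorem core_mul_core : core u v * core u v = core u v := by
  ext f n
  simp only [op_mul_apply, core_apply]
  split_ifs <;> rfl

theorem core_mul_outward : core u v * outward u v = 0 := by
  ext f n
  rw [op_mul_apply, core_apply]
  split_ifs with h
  · exact outward_apply_of_mem h f
  · rfl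

theorem inward_mul_core : inward u v * core u v = 0 := by
  ext f n
  simp only [inward, inRight, inLeft, op_add_apply, op_mul_apply, restr_apply, Set.indicator_apply,
    shift_apply, core_apply, Set.mem_ofPred_eq, op_zero_apply]
  split_ifs <;> first | omega | simp

/-- The product counts the outer neighbours of a site: one for a site outside [u, v], one for each
of the two ends (so two if u = v), none for other sites of [u, v]. -/
theorem inward_mul_outward (huv : u ≤ v) :
    inward u v * outward u v = 1 - core u v + ends u v := by
  ext f n
  simp only [inward, inRight, inLeft, outward, outRight, outLeft, op_add_apply, op_mul_apply,
    restr_apply, Set.indicator_apply, op_sub_apply, op_one_apply, ends,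
    shift_apply, core_apply, Set.mem_ofPred_eq, Set.mem_singleton_iff]
  have e1 : n + 1 + -1 = n := by ring
  have e2 : n + -1 + 1 = n := by ring
  rw [e1, e2]
  split_ifs <;> first | omega | ring

/-- A hop between neighbours that does not stay inside [u, v] either approaches or leaves it. -/
theorem shift_add_shift (huv : u ≤ v) :
    shift 1 + shift (-1) = inward u v + outward u v + coreHop u v := by
  ext f n
  simp only [inward, inRight, inLeft, outward, outRight, outLeft, op_add_apply, op_mul_apply,
    restr_apply, Set.indicator_apply, coreHop,
    shift_apply, core_apply, Set.mem_ofPred_eq]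
  split_ifs <;> first | omega | ring

theorem core_mul_ends (huv : u ≤ v) : core u v * ends u v = ends u v := by
  ext f n
  simp only [op_mul_apply, ends, op_add_apply, restr_apply, Set.indicator_apply, core_apply,
    Set.mem_singleton_iff]
  split_ifs <;> first | omega | ring

theorem ends_mul_core (huv : u ≤ v) : ends u v * core u v = ends u v := by
  ext f n
  simp only [op_mul_apply, ends, op_add_apply, restr_apply, Set.indicator_apply, core_apply,
    Set.mem_singleton_iff]
  split_ifs <;> first | omega | ring

theorem core_mul_coreHop : core u v * coreHop u v = coreHop u v := by
  rw [coreHop, ← mul_assoc, ← mul_assoc, core_mul_core]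

theorem coreHop_mul_core : coreHop u v * core u v = coreHop u v := by
  rw [coreHop, mul_assoc, core_mul_core]

theorem outRight_mul_outLeft (huv : u ≤ v) : outRight v * outLeft u = 0 := by
  ext f n
  simp only [outRight, outLeft, op_mul_apply,
    restr_apply, Set.indicator_apply, shift_apply, Set.mem_ofPred_eq, op_zero_apply]
  split_ifs <;> first | omega | ring

theorem inRight_mul_inLeft (huv : u ≤ v) : inRight v * inLeft u = 0 := by
  ext f n
  simp only [inRight, inLeft, op_mul_apply,
    restr_apply, Set.indicator_apply, shift_apply, Set.mem_ofPred_eq, op_zero_apply]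
  split_ifs <;> first | omega | ring

theorem isUnit_one_sub_smul {R : Type*} [NormedRing R] [NormedAlgebra ℂ R] [CompleteSpace R]
    {z : ℂ} (hz : ‖z‖ < 1) {A : R} (hA : ‖A‖ ≤ 1) : IsUnit (1 - z • A) := by
  apply isUnit_one_sub_of_norm_lt_one
  calc ‖z • A‖ ≤ ‖z‖ * ‖A‖ := norm_smul_le _ _
    _ ≤ ‖z‖ * 1 := by gcongr
    _ < 1 := by linarith

/-- A Neumann series for the sum would not cover all |z| < 1, since `outward` has norm √2 when u =
v. The two half-lines do not interact in this order of multiplication, so the operator splits into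
two factors with contractions in them. -/
theorem isUnit_one_sub_outward (huv : u ≤ v) {z : ℂ} (hz : ‖z‖ < 1) :
    IsUnit (1 - z • outward u v) := by
  have h : 1 - z • outward u v = (1 - z • outRight v) * (1 - z • outLeft u) := by
    rw [outward, sub_mul, mul_sub, mul_sub, smul_mul_smul_comm, outRight_mul_outLeft huv,
      mul_one, one_mul, mul_one, smul_zero, smul_add]
    abel
  rw [h]
  exact (isUnit_one_sub_smul hz norm_outRight_le).mul (isUnit_one_sub_smul hz norm_outLeft_le)

theorem isUnit_one_sub_inward (huv : u ≤ v) {z : ℂ} (hz : ‖z‖ < 1) :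
    IsUnit (1 - z • inward u v) := by
  have h : 1 - z • inward u v = (1 - z • inRight v) * (1 - z • inLeft u) := by
    rw [inward, sub_mul, mul_sub, mul_sub, smul_mul_smul_comm, inRight_mul_inLeft huv,
      mul_one, one_mul, mul_one, smul_zero, smul_add]
    abel
  rw [h]
  exact (isUnit_one_sub_smul hz norm_inRight_le).mul (isUnit_one_sub_smul hz norm_inLeft_le)

end Interval

/-! ### Block operators on `l² × l²` -/

/-- Bounded operators on `l² × l²`. -/
abbrev PairOp : Type := Pair 2 →L[ℂ] Pair 2

/-- The operator with the given blocks. -/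
def blk (A B C D : Op) : PairOp := (A.coprod B).prod (C.coprod D)

theorem blk_apply (A B C D : Op) (h : Pair 2) :
    blk A B C D h = (A h.1 + B h.2, C h.1 + D h.2) := rfl

theorem blk_mul (A B C D A' B' C' D' : Op) : blk A B C D * blk A' B' C' D' =
    blk (A * A' + B * C') (A * B' + B * D') (C * A' + D * C') (C * B' + D * D') := by
  refine ContinuousLinearMap.ext fun h => ?_
  change blk A B C D (blk A' B' C' D' h) = _
  simp only [blk_apply, map_add]
  refine Prod.ext ?_ ?_
  · change _ = A (A' h.1) + B (C' h.1) + (A (B' h.2) + B (D' h.2))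
    simp only; abel
  · change _ = C (A' h.1) + D (C' h.1) + (C (B' h.2) + D (D' h.2))
    simp only; abel

theorem blk_add (A B C D A' B' C' D' : Op) : blk A B C D + blk A' B' C' D' =
    blk (A + A') (B + B') (C + C') (D + D') := by
  refine ContinuousLinearMap.ext fun h => ?_
  change blk A B C D h + blk A' B' C' D' h = _
  simp only [blk_apply]
  refine Prod.ext ?_ ?_
  · change _ = A h.1 + A' h.1 + (B h.2 + B' h.2)
    simp only [Prod.mk_add_mk]; abel
  · change _ = C h.1 + C' h.1 + (D h.2 + D' h.2)
    simp only [Prod.mk_add_mk]; abel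

theorem smul_blk (c : ℂ) (A B C D : Op) :
    c • blk A B C D = blk (c • A) (c • B) (c • C) (c • D) := by
  refine ContinuousLinearMap.ext fun h => ?_
  change c • blk A B C D h = _
  simp only [blk_apply]
  refine Prod.ext ?_ ?_
  · change c • (A h.1 + B h.2) = c • A h.1 + c • B h.2
    rw [smul_add]
  · change c • (C h.1 + D h.2) = c • C h.1 + c • D h.2
    rw [smul_add]

theorem blk_sub (A B C D A' B' C' D' : Op) : blk A B C D - blk A' B' C' D' =
    blk (A - A') (B - B') (C - C') (D - D') := by
  rw [sub_eq_add_neg, ← neg_one_smul ℂ (blk A' B' C' D'), smul_blk, blk_add]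
  simp only [neg_one_smul, sub_eq_add_neg]

theorem one_eq_blk : (1 : PairOp) = blk 1 0 0 1 := by
  refine ContinuousLinearMap.ext fun h => ?_
  rw [blk_apply]
  refine Prod.ext ?_ ?_
  · change h.1 = h.1 + 0
    rw [add_zero]
  · change h.2 = 0 + h.2
    rw [zero_add]

theorem norm_blk_le (A B C D : Op) : ‖blk A B C D‖ ≤ ‖A‖ + ‖B‖ + ‖C‖ + ‖D‖ := by
  refine ContinuousLinearMap.opNorm_le_bound _ (by positivity) fun h => ?_
  have h1 : ‖h.1‖ ≤ ‖h‖ := norm_fst_le h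
  have h2 : ‖h.2‖ ≤ ‖h‖ := norm_snd_le h
  have key : ∀ T S : Op, ‖T h.1 + S h.2‖ ≤ (‖T‖ + ‖S‖) * ‖h‖ := fun T S => by
    calc ‖T h.1 + S h.2‖ ≤ ‖T‖ * ‖h.1‖ + ‖S‖ * ‖h.2‖ :=
          (norm_add_le _ _).trans (add_le_add (T.le_opNorm _) (S.le_opNorm _))
      _ ≤ ‖T‖ * ‖h‖ + ‖S‖ * ‖h‖ := by gcongr
      _ = _ := by ring
  rw [blk_apply, Prod.norm_def]
  refine max_le ((key A B).trans ?_) ((key C D).trans ?_)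
  · exact mul_le_mul_of_nonneg_right (by linarith [norm_nonneg C, norm_nonneg D]) (norm_nonneg h)
  · exact mul_le_mul_of_nonneg_right (by linarith [norm_nonneg A, norm_nonneg B]) (norm_nonneg h)

/-- The blocks of an operator on `l² × l²`. -/
def ent11 (A : PairOp) : Op :=
  (ContinuousLinearMap.fst ℂ _ _).comp (A.comp (ContinuousLinearMap.inl ℂ (Slp 2) (Slp 2)))
def ent12 (A : PairOp) : Op :=
  (ContinuousLinearMap.fst ℂ _ _).comp (A.comp (ContinuousLinearMap.inr ℂ (Slp 2) (Slp 2)))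
def ent21 (A : PairOp) : Op :=
  (ContinuousLinearMap.snd ℂ _ _).comp (A.comp (ContinuousLinearMap.inl ℂ (Slp 2) (Slp 2)))
def ent22 (A : PairOp) : Op :=
  (ContinuousLinearMap.snd ℂ _ _).comp (A.comp (ContinuousLinearMap.inr ℂ (Slp 2) (Slp 2)))

theorem blk_ent (A : PairOp) : blk (ent11 A) (ent12 A) (ent21 A) (ent22 A) = A := by
  refine ContinuousLinearMap.ext fun h => ?_
  have : A h = A (h.1, 0) + A (0, h.2) := by rw [← map_add]; simp
  rw [this]
  rfl

theorem norm_ent_le (A : PairOp) :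
    ‖ent11 A‖ ≤ ‖A‖ ∧ ‖ent12 A‖ ≤ ‖A‖ ∧ ‖ent21 A‖ ≤ ‖A‖ ∧ ‖ent22 A‖ ≤ ‖A‖ := by
  have hl : ∀ f : Slp 2, ‖A (f, 0)‖ ≤ ‖A‖ * ‖f‖ := fun f => by
    simpa [Prod.norm_def] using A.le_opNorm (f, 0)
  have hr : ∀ f : Slp 2, ‖A (0, f)‖ ≤ ‖A‖ * ‖f‖ := fun f => by
    simpa [Prod.norm_def] using A.le_opNorm (0, f)
  refine ⟨?_, ?_, ?_, ?_⟩ <;>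
    refine ContinuousLinearMap.opNorm_le_bound _ (norm_nonneg A) fun f => ?_
  · exact (norm_fst_le _).trans (hl f)
  · exact (norm_fst_le _).trans (hr f)
  · exact (norm_snd_le _).trans (hl f)
  · exact (norm_snd_le _).trans (hr f)

theorem continuous_ent :
    Continuous ent11 ∧ Continuous ent12 ∧ Continuous ent21 ∧ Continuous ent22 := by
  refine ⟨?_, ?_, ?_, ?_⟩ <;>
    exact continuous_const.clm_comp (continuous_id.clm_comp continuous_const)

theorem opL_eq_blk (U : Finset ℤ) (p : ℕ) (ε : ℝ) : opL U p ε =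
    blk (diagonalBlock U p ε) (-((p : ℂ) • potential U)) ((p : ℂ) • potential U)
      (-diagonalBlock U p ε) := rfl

/-! ### Inverses of perturbations -/

/-- Write a + t = a (1 + b t), where b t has norm at most 1/2. -/
theorem isUnit_add_of_norm_le {R : Type*} [NormedRing R] [CompleteSpace R]
    {a b t : R} {C : ℝ} (hab : a * b = 1) (hba : b * a = 1) (hC : 0 < C) (hb : ‖b‖ ≤ C)
    (ht : ‖t‖ ≤ (2 * C)⁻¹) : IsUnit (a + t) ∧ ‖Ring.inverse (a + t)‖ ≤ 2 * C := by
  have ha : IsUnit a := ⟨⟨a, b, hab, hba⟩, rfl⟩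
  have hbt : ‖b * t‖ ≤ 1 / 2 := by
    calc ‖b * t‖ ≤ ‖b‖ * ‖t‖ := norm_mul_le _ _
      _ ≤ C * (2 * C)⁻¹ := by gcongr
      _ = 1 / 2 := by field_simp
  have h1 : IsUnit (1 - -(b * t)) := isUnit_one_sub_of_norm_lt_one (by rw [norm_neg]; linarith)
  have h2 : a + t = a * (1 - -(b * t)) := by
    rw [sub_neg_eq_add, mul_add, mul_one, ← mul_assoc, hab, one_mul]
  have hu : IsUnit (a + t) := h2 ▸ ha.mul h1
  refine ⟨hu, ?_⟩
  set N := Ring.inverse (a + t) with hN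
  have h3 : (a + t) * N = 1 := Ring.mul_inverse_cancel _ hu
  -- The resolvent identity; taking norms gives ‖N‖ ≤ C + ‖N‖/2, from which ‖N‖ can be absorbed.
  have h4 : N = b - b * t * N := by
    have : b * ((a + t) * N) = b := by rw [h3, mul_one]
    rw [← mul_assoc, mul_add, hba, add_mul, one_mul] at this
    exact eq_sub_of_add_eq this
  have h5 : ‖N‖ ≤ C + 1 / 2 * ‖N‖ := by
    calc ‖N‖ = ‖b - b * t * N‖ := by rw [← h4]
      _ ≤ ‖b‖ + ‖b * t‖ * ‖N‖ := (norm_sub_le _ _).trans (by gcongr; exact norm_mul_le _ _)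
      _ ≤ C + 1 / 2 * ‖N‖ := by gcongr
  linarith

section Factorization

variable {u v : ℤ}

/-! ### The factorization of `L - Ω` -/

/-- The coefficient of `ε` in the compression of `L` to `[u, v]` that results from the elimination
of the sites outside `[u, v]`. -/
def coreCorrection (u v : ℤ) (z : ℂ) : Op := (2 : ℂ) • core u v - z • ends u v - coreHop u v

theorem norm_coreCorrection_le {z : ℂ} (hz : ‖z‖ ≤ 1) : ‖coreCorrection u v z‖ ≤ 6 := by
  have h1 : ‖(2 : ℂ) • core u v‖ ≤ 2 * 1 := by
    refine (norm_smul_le (2 : ℂ) (core u v)).trans ?_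
    rw [Complex.norm_ofNat]
    gcongr
    exact norm_core_le
  have h2 : ‖z • ends u v‖ ≤ 1 * 2 := (norm_smul_le z (ends u v)).trans
    (mul_le_mul hz norm_ends_le (norm_nonneg _) zero_le_one)
  have h3 : ‖coreHop u v‖ ≤ 2 := norm_coreHop_le
  have h4 := norm_sub_le ((2 : ℂ) • core u v - z • ends u v) (coreHop u v)
  have h5 := norm_sub_le ((2 : ℂ) • core u v) (z • ends u v)
  unfold coreCorrection
  linarith

theorem core_mul_coreCorrection (huv : u ≤ v) (z : ℂ) :
    core u v * coreCorrection u v z = coreCorrection u v z := by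
  rw [coreCorrection, mul_sub, mul_sub, mul_smul_comm, mul_smul_comm, core_mul_core,
    core_mul_ends huv, core_mul_coreHop]

theorem coreCorrection_mul_core (huv : u ≤ v) (z : ℂ) :
    coreCorrection u v z * core u v = coreCorrection u v z := by
  rw [coreCorrection, sub_mul, sub_mul, smul_mul_assoc, smul_mul_assoc, core_mul_core,
    ends_mul_core huv, coreHop_mul_core]

/-- Inward hops start outside [u, v] and outward hops end outside it, so they annihilate an operator
that lives on [u, v]. The triangular factors therefore leave it unchanged. -/
theorem conj_eq_self_of_core {Y : Op} (h1 : core u v * Y = Y) (h2 : Y * core u v = Y) (z w : ℂ) :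
    (1 - z • inward u v) * Y * (1 - w • outward u v) = Y := by
  have h3 : inward u v * Y = 0 := by rw [← h1, ← mul_assoc, inward_mul_core, zero_mul]
  have h4 : Y * outward u v = 0 := by rw [← h2, mul_assoc, core_mul_outward, mul_zero]
  rw [sub_mul, one_mul, smul_mul_assoc, h3, smul_zero, sub_zero, mul_sub, mul_one, mul_smul_comm,
    h4, smul_zero, sub_zero]

/-- Expanding ε z⁻¹ (1 - z · inward)(1 - z · outward) produces the hops of -ε Δ outside [u, v] and
the constant ε (z + 1/z) there, plus an extra ε z at the two ends. The term -z · `ends` in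
`coreCorrection` cancels the latter, and its other terms restore the Laplacian inside [u, v]. -/
theorem laplacian_factorization (huv : u ≤ v) {z : ℂ} (hz : z ≠ 0) (ε c : ℂ) :
    (1 - z • inward u v) *
      ((ε * z⁻¹) • (1 - core u v) + c • core u v + ε • coreCorrection u v z) *
      (1 - z • outward u v) =
    -(ε • laplacian) + (ε * (z + z⁻¹ - 2)) • (1 : Op) +
      (c - ε * (z + z⁻¹ - 2)) • core u v := by
  set Y : Op := (c - ε * z⁻¹) • core u v + ε • coreCorrection u v z with hY
  have hX : (ε * z⁻¹) • (1 - core u v) + c • core u v + ε • coreCorrection u v z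
      = (ε * z⁻¹) • (1 : Op) + Y := by
    rw [hY]; module
  have h1 : core u v * Y = Y := by
    rw [hY, mul_add, mul_smul_comm, mul_smul_comm, core_mul_core, core_mul_coreCorrection huv]
  have h2 : Y * core u v = Y := by
    rw [hY, add_mul, smul_mul_assoc, smul_mul_assoc, core_mul_core, coreCorrection_mul_core huv]
  have h3 : laplacian = inward u v + outward u v + coreHop u v - (2 : ℂ) • (1 : Op) := by
    rw [← shift_add_shift huv, laplacian]
    change _ - (2 : ℂ) • (1 : Op) + _ = _
    abel
  rw [hX, mul_add, add_mul, conj_eq_self_of_core h1 h2, mul_smul_comm, smul_mul_assoc, mul_one,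
    sub_mul, one_mul, mul_sub, mul_one, smul_mul_smul_comm, inward_mul_outward huv, h3, hY,
    coreCorrection]
  match_scalars <;> field_simp <;> ring

/-- The block diagonal operators with the entries `1 - z S` and `1 - w S`, where `S` is the
translation away from or towards `[u, v]`. -/
def outFactor (u v : ℤ) (z w : ℂ) : PairOp := blk (1 - z • outward u v) 0 0 (1 - w • outward u v)
def inFactor (u v : ℤ) (z w : ℂ) : PairOp := blk (1 - z • inward u v) 0 0 (1 - w • inward u v)

/-- The projection onto the pairs of sequences supported in `[u, v]`. -/
def coreP (u v : ℤ) : PairOp := blk (core u v) 0 0 (core u v)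

/-- `diag (a, b)` outside `[u, v]`, and the identity on `[u, v]`. -/
def outerScale (u v : ℤ) (a b : ℂ) : PairOp :=
  blk (a • (1 - core u v) + core u v) 0 0 (b • (1 - core u v) + core u v)

/-- The effective operator on `[u, v]` of the limit `ε = 0`, extended by the identity. -/
def coreLimit (u v : ℤ) (p : ℕ) (Ω : ℂ) : PairOp :=
  blk (1 - core u v + (-p - Ω) • core u v) (-((p : ℂ) • core u v)) ((p : ℂ) • core u v)
    (1 - core u v + (p - Ω) • core u v)

/-- The effective operator on `[u, v]`, extended by the identity. -/
def coreOp (u v : ℤ) (p : ℕ) (ε : ℝ) (Ω z w : ℂ) : PairOp :=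
  coreLimit u v p Ω +
    (ε : ℂ) • blk (coreCorrection u v z) 0 0 (-coreCorrection u v w)

theorem outerScale_mul_coreOp (huv : u ≤ v) (p : ℕ) (ε : ℝ) (Ω z w a b : ℂ) :
    outerScale u v a b * coreOp u v p ε Ω z w =
      blk (a • (1 - core u v) + (-p - Ω) • core u v + (ε : ℂ) • coreCorrection u v z)
        (-((p : ℂ) • core u v)) ((p : ℂ) • core u v)
        (b • (1 - core u v) + (p - Ω) • core u v - (ε : ℂ) • coreCorrection u v w) := by
  have hV := core_mul_core (u := u) (v := v)
  have hz := core_mul_coreCorrection huv z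
  have hw := core_mul_coreCorrection huv w
  rw [outerScale, coreOp, coreLimit, smul_blk, blk_add, blk_mul]
  congr 1 <;>
  simp only [zero_mul, add_zero, smul_zero, mul_add, add_mul, smul_mul_assoc, sub_mul,
    mul_smul_comm, one_mul, mul_sub, mul_one, mul_neg, hV, hz, hw, smul_neg] <;>
  module

/-- Each diagonal block is, up to sign, an instance of `laplacian_factorization`, with c = -p - Ω
and c = -p + Ω. The off-diagonal blocks live on [u, v] and pass through the triangular factors even
though z and w differ. -/
theorem opL_sub_eq (huv : u ≤ v) (p : ℕ) (ε : ℝ) {Ω z w : ℂ} (hz : z ≠ 0) (hw : w ≠ 0)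
    (hΩz : ε * (z + z⁻¹ - 2) = 1 - Ω) (hΩw : ε * (w + w⁻¹ - 2) = 1 + Ω) :
    opL (Finset.Icc u v) p ε - Ω • ContinuousLinearMap.id ℂ (Pair 2) =
      inFactor u v z w * (outerScale u v (ε * z⁻¹) (-(ε * w⁻¹)) * coreOp u v p ε Ω z w) *
        outFactor u v z w := by
  have hone : ContinuousLinearMap.id ℂ (Pair 2) = blk 1 0 0 1 := one_eq_blk
  have hV := core_mul_core (u := u) (v := v)
  have hpV : ∀ z w c : ℂ, (1 - z • inward u v) * (c • core u v) * (1 - w • outward u v)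
      = c • core u v := fun z w c =>
    conj_eq_self_of_core (by rw [mul_smul_comm, hV]) (by rw [smul_mul_assoc, hV]) z w
  have hA := laplacian_factorization huv hz ε (-p - Ω)
  have hB := laplacian_factorization huv hw ε (-p + Ω)
  have hB' : -(ε * w⁻¹) • (1 - core u v) + (p - Ω) • core u v - (ε : ℂ) • coreCorrection u v w =
      -((ε * w⁻¹) • (1 - core u v) + (-p + Ω) • core u v + (ε : ℂ) • coreCorrection u v w) := by
    module
  rw [opL_eq_blk, hone, smul_blk, blk_sub, outerScale_mul_coreOp huv, inFactor, outFactor, blk_mul,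
    blk_mul, hB']
  simp only [zero_mul, mul_zero, add_zero, zero_add, smul_zero, sub_zero]
  rw [mul_neg, neg_mul, mul_neg, neg_mul, hA, hB, hpV, hpV, hΩz, hΩw, diagonalBlock,
    ← core_eq_potential]
  change blk (-((ε : ℂ) • laplacian) + (1 : Op) - (1 + p : ℂ) • core u v - Ω • (1 : Op)) _ _
    (-(-((ε : ℂ) • laplacian) + (1 : Op) - (1 + p : ℂ) • core u v) - Ω • (1 : Op)) = _
  congr 1 <;> module

/-- The inverse of `coreLimit`. -/
def coreLimitInv (u v : ℤ) (p : ℕ) (Ω : ℂ) : PairOp :=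
  blk (1 - core u v + (-Ω⁻¹ + p * Ω⁻¹ ^ 2) • core u v) ((p * Ω⁻¹ ^ 2) • core u v)
    (-(p * Ω⁻¹ ^ 2) • core u v) (1 - core u v + (-Ω⁻¹ - p * Ω⁻¹ ^ 2) • core u v)

/-- At each site of [u, v] the matrix is K - Ω with K = [[-p, -p], [p, p]] and K² = 0, so its
inverse is -1/Ω - K/Ω². -/
theorem coreLimit_mul_inv (p : ℕ) {Ω : ℂ} (hΩ : Ω ≠ 0) :
    coreLimit u v p Ω * coreLimitInv u v p Ω = 1 := by
  have hV := core_mul_core (u := u) (v := v)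
  rw [coreLimit, coreLimitInv, blk_mul, one_eq_blk]
  congr 1 <;>
  simp only [mul_add, add_mul, smul_mul_assoc, sub_mul, neg_mul,
    mul_smul_comm, one_mul, mul_sub, mul_one, hV] <;>
  match_scalars <;> field_simp <;> ring

theorem inv_mul_coreLimit (p : ℕ) {Ω : ℂ} (hΩ : Ω ≠ 0) :
    coreLimitInv u v p Ω * coreLimit u v p Ω = 1 := by
  have hV := core_mul_core (u := u) (v := v)
  rw [coreLimit, coreLimitInv, blk_mul, one_eq_blk]
  congr 1 <;>
  simp only [mul_add, add_mul, smul_mul_assoc, sub_mul, mul_neg,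
    mul_smul_comm, one_mul, mul_sub, mul_one, hV] <;>
  match_scalars <;> field_simp <;> ring

/-- A bound for the inverse of `coreLimit` for `|Ω| ≥ δ`. -/
def coreBound (p : ℕ) (δ : ℝ) : ℝ := 4 * (2 + δ⁻¹ + p * δ⁻¹ ^ 2)

theorem coreBound_pos (p : ℕ) {δ : ℝ} (hδ : 0 < δ) : 0 < coreBound p δ := by
  unfold coreBound; positivity

theorem norm_coreLimitInv_le (p : ℕ) {δ : ℝ} (hδ : 0 < δ) {Ω : ℂ} (hΩ : δ ≤ ‖Ω‖) :
    ‖coreLimitInv u v p Ω‖ ≤ coreBound p δ := by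
  have hinv : ‖Ω⁻¹‖ ≤ δ⁻¹ := by rw [norm_inv]; gcongr
  have h2 : ‖(p : ℂ) * Ω⁻¹ ^ 2‖ ≤ p * δ⁻¹ ^ 2 := by
    rw [norm_mul, norm_pow, Complex.norm_natCast]; gcongr
  have h0 : (0 : ℝ) ≤ δ⁻¹ := by positivity
  have hQ : ‖1 - core u v‖ ≤ 2 := by
    refine (norm_sub_le _ _).trans ?_
    have : ‖(1 : Op)‖ ≤ 1 := ContinuousLinearMap.norm_id_le
    linarith [norm_core_le (u := u) (v := v)]
  have hc : ∀ c : ℂ, ‖c‖ ≤ δ⁻¹ + p * δ⁻¹ ^ 2 → ‖c • core u v‖ ≤ δ⁻¹ + p * δ⁻¹ ^ 2 := fun c hc =>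
    (norm_smul_le c (core u v)).trans ((mul_le_of_le_one_right (norm_nonneg _) norm_core_le).trans hc)
  have hd : ∀ c : ℂ, ‖c‖ ≤ δ⁻¹ + p * δ⁻¹ ^ 2 →
      ‖1 - core u v + c • core u v‖ ≤ 2 + δ⁻¹ + p * δ⁻¹ ^ 2 := fun c h =>
    (norm_add_le _ _).trans (by linarith [hc c h])
  refine (norm_blk_le _ _ _ _).trans ?_
  have e1 := hd (-Ω⁻¹ + p * Ω⁻¹ ^ 2) ((norm_add_le _ _).trans (by rw [norm_neg]; linarith))
  have e2 := hc (p * Ω⁻¹ ^ 2) (by linarith)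
  have e3 := hc (-(p * Ω⁻¹ ^ 2)) (by rw [norm_neg]; linarith)
  have e4 := hd (-Ω⁻¹ - p * Ω⁻¹ ^ 2) ((norm_sub_le _ _).trans (by rw [norm_neg]; linarith))
  unfold coreBound
  linarith

/-- The two corrections have norm at most 6 each, so the perturbation is at most 12 ε ≤ 1 / (2 ·
`coreBound`). Allowing |z| = |w| = 1 is essential for the limits at the bands. -/
theorem isUnit_coreOp (p : ℕ) {δ ε : ℝ} (hδ : 0 < δ) (hε : 0 ≤ ε)
    (hεδ : ε ≤ (24 * coreBound p δ)⁻¹) {Ω z w : ℂ} (hΩ : δ ≤ ‖Ω‖) (hz : ‖z‖ ≤ 1) (hw : ‖w‖ ≤ 1) :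
    IsUnit (coreOp u v p ε Ω z w) ∧
      ‖Ring.inverse (coreOp u v p ε Ω z w)‖ ≤ 2 * coreBound p δ := by
  have hΩ0 : Ω ≠ 0 := norm_pos_iff.mp (hδ.trans_le hΩ)
  have hC := coreBound_pos p hδ
  refine isUnit_add_of_norm_le (coreLimit_mul_inv p hΩ0) (inv_mul_coreLimit p hΩ0) hC
    (norm_coreLimitInv_le p hδ hΩ) ?_
  have h1 : ‖blk (coreCorrection u v z) 0 0 (-coreCorrection u v w)‖ ≤ 12 := by
    refine (norm_blk_le _ _ _ _).trans ?_
    rw [norm_neg, norm_zero]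
    linarith [norm_coreCorrection_le (u := u) (v := v) hz,
      norm_coreCorrection_le (u := u) (v := v) hw]
  refine (norm_smul_le (ε : ℂ) (blk _ 0 0 _)).trans ?_
  rw [Complex.norm_real, Real.norm_of_nonneg hε]
  calc ε * _ ≤ (24 * coreBound p δ)⁻¹ * 12 := by gcongr
    _ = (2 * coreBound p δ)⁻¹ := by field_simp; norm_num

theorem blk_diag_mul_eq_one {A B A' B' : Op} (h1 : A * A' = 1) (h2 : B * B' = 1) :
    blk A 0 0 B * blk A' 0 0 B' = 1 := by
  rw [blk_mul, one_eq_blk]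
  simp [h1, h2]

theorem outerScale_mul_outerScale {a b a' b' : ℂ} (ha : a * a' = 1) (hb : b * b' = 1) :
    outerScale u v a b * outerScale u v a' b' = 1 := by
  have hV := core_mul_core (u := u) (v := v)
  refine blk_diag_mul_eq_one ?_ ?_ <;>
  simp only [mul_add, add_mul, smul_mul_assoc, sub_mul,
    mul_smul_comm, one_mul, mul_sub, mul_one, hV]
  · match_scalars <;> first | linear_combination ha | linear_combination -ha
  · match_scalars <;> first | linear_combination hb | linear_combination -hb

/-- The inverse of `L - Ω`. -/
theorem opL_sub_mul_inverse (huv : u ≤ v) (p : ℕ) {ε : ℝ} (hε : ε ≠ 0) {Ω z w : ℂ} (hz : z ≠ 0)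
    (hw : w ≠ 0) (hz1 : ‖z‖ < 1) (hw1 : ‖w‖ < 1)
    (hΩz : ε * (z + z⁻¹ - 2) = 1 - Ω) (hΩw : ε * (w + w⁻¹ - 2) = 1 + Ω)
    (hN : IsUnit (coreOp u v p ε Ω z w)) :
    IsRegular (opL (Finset.Icc u v) p ε) Ω ∧
      resolv (opL (Finset.Icc u v) p ε) Ω =
        blk (Ring.inverse (1 - z • outward u v)) 0 0 (Ring.inverse (1 - w • outward u v)) *
        (Ring.inverse (coreOp u v p ε Ω z w) * outerScale u v (z / ε) (-(w / ε))) *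
        blk (Ring.inverse (1 - z • inward u v)) 0 0 (Ring.inverse (1 - w • inward u v)) := by
  have hε' : (ε : ℂ) ≠ 0 := by exact_mod_cast hε
  have oz := isUnit_one_sub_outward huv hz1
  have ow := isUnit_one_sub_outward huv hw1
  have iz := isUnit_one_sub_inward huv hz1
  have iw := isUnit_one_sub_inward huv hw1
  have o1 := blk_diag_mul_eq_one (Ring.mul_inverse_cancel _ oz) (Ring.mul_inverse_cancel _ ow)
  have o2 := blk_diag_mul_eq_one (Ring.inverse_mul_cancel _ oz) (Ring.inverse_mul_cancel _ ow)
  have i1 := blk_diag_mul_eq_one (Ring.mul_inverse_cancel _ iz) (Ring.mul_inverse_cancel _ iw)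
  have i2 := blk_diag_mul_eq_one (Ring.inverse_mul_cancel _ iz) (Ring.inverse_mul_cancel _ iw)
  have s1 : outerScale u v (ε * z⁻¹) (-(ε * w⁻¹)) * outerScale u v (z / ε) (-(w / ε)) = 1 :=
    outerScale_mul_outerScale (by field_simp) (by field_simp)
  have s2 : outerScale u v (z / ε) (-(w / ε)) * outerScale u v (ε * z⁻¹) (-(ε * w⁻¹)) = 1 :=
    outerScale_mul_outerScale (by field_simp) (by field_simp)
  let eo : PairOpˣ := ⟨outFactor u v z w, _, o1, o2⟩
  let ei : PairOpˣ := ⟨inFactor u v z w, _, i1, i2⟩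
  let es : PairOpˣ := ⟨_, _, s1, s2⟩
  obtain ⟨eN, heN⟩ := hN
  have key : opL (Finset.Icc u v) p ε - Ω • ContinuousLinearMap.id ℂ (Pair 2) =
      ((ei * (es * eN) * eo : PairOpˣ) : PairOp) := by
    rw [opL_sub_eq huv p ε hz hw hΩz hΩw, ← heN]
    rfl
  refine ⟨by rw [IsRegular, key]; exact Units.isUnit _, ?_⟩
  rw [resolv, key, Ring.inverse_unit, mul_inv_rev, mul_inv_rev, ← heN, Ring.inverse_unit]
  rw [← mul_assoc, ← mul_assoc]
  rfl

end Factorization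

/-! ### The roots of `z + 1/z = 2 + l` -/

/-- The two roots have product 1, so one lies in the open disk unless both are on the unit circle.
In that case 1/z is the conjugate of z, and l = 2 Re z - 2 lies in [-4, 0]. -/
theorem exists_root_norm_lt_one {l : ℂ} (hl : ∀ x ∈ Set.Icc (-4 : ℝ) 0, l ≠ x) :
    ∃ z : ℂ, z ≠ 0 ∧ ‖z‖ < 1 ∧ z + z⁻¹ - 2 = l := by
  obtain ⟨s, hs⟩ := IsAlgClosed.exists_pow_nat_eq ((2 + l) ^ 2 - 4) (n := 2) two_pos
  set z : ℂ := (2 + l + s) / 2 with hz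
  have hzz : z * (2 + l - z) = 1 := by rw [hz]; linear_combination (-1 / 4 : ℂ) * hs
  have hz0 : z ≠ 0 := left_ne_zero_of_mul_eq_one hzz
  have hinv : z⁻¹ = 2 + l - z := (eq_inv_of_mul_eq_one_right hzz).symm
  have hsum : z + z⁻¹ - 2 = l := by rw [hinv]; ring
  rcases lt_trichotomy ‖z‖ 1 with h | h | h
  · exact ⟨z, hz0, h, hsum⟩
  · exfalso
    have hconj : z⁻¹ = (starRingEnd ℂ) z := Complex.inv_eq_conj h
    have hre : |z.re| ≤ 1 := h ▸ Complex.abs_re_le_norm z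
    rw [abs_le] at hre
    refine hl (2 * z.re - 2) ⟨by linarith, by linarith⟩ ?_
    rw [← hsum, hconj, Complex.add_conj]
    push_cast; ring
  · refine ⟨z⁻¹, inv_ne_zero hz0, ?_, ?_⟩
    · rw [norm_inv]; exact inv_lt_one_of_one_lt₀ h
    · rw [inv_inv, add_comm]; exact hsum

/-- The equation for z reads (z - z₀)(z - z₁) = -iτt z, and z₀ is the closer of the two limiting
roots. The square root rate also covers a double root, that is, a band edge. -/
theorem sq_norm_sub_le_of_root {l : ℝ} {z z₀ z₁ : ℂ} {τ t : ℝ} (hτ : |τ| = 1) (ht : 0 < t)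
    (hprod : z₀ * z₁ = 1) (hsum : z₀ + z₁ = 2 + l) (hz0 : z ≠ 0) (hz : ‖z‖ < 1)
    (h : z + z⁻¹ - 2 = l - Complex.I * (τ * t)) (hle : ‖z - z₀‖ ≤ ‖z - z₁‖) :
    ‖z - z₀‖ ^ 2 ≤ t := by
  have h1 : (z - z₀) * (z - z₁) = -(Complex.I * (τ * t)) * z := by
    field_simp at h
    linear_combination h - z * hsum + hprod
  have hI : ‖-(Complex.I * (τ * t : ℂ))‖ = t := by
    rw [norm_neg, norm_mul, Complex.norm_I, one_mul, norm_mul, Complex.norm_real, Complex.norm_real,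
      Real.norm_eq_abs, hτ, one_mul, Real.norm_of_nonneg ht.le]
  calc ‖z - z₀‖ ^ 2 = ‖z - z₀‖ * ‖z - z₀‖ := sq _
    _ ≤ ‖z - z₀‖ * ‖z - z₁‖ := by gcongr
    _ = t * ‖z‖ := by rw [← norm_mul, h1, norm_mul, hI]
    _ ≤ t * 1 := by gcongr
    _ = t := mul_one t

/-- It remains to identify which limiting root is closer. For l ≤ 0 the limiting roots are conjugate
on the unit circle, and the sign of τ decides; for l > 0 they are real, and it is the smaller one.
If z₀² = 1, the roots coincide, which forces l(l + 4) = 0. -/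
theorem exists_boundary_root {l τ : ℝ} (hl : -4 ≤ l) (hτ : |τ| = 1) :
    ∃ z₀ : ℂ, ‖z₀‖ ≤ 1 ∧ (l ≠ 0 → l ≠ -4 → z₀ ^ 2 ≠ 1) ∧
      ∀ t : ℝ, 0 < t → ∀ z : ℂ, z ≠ 0 → ‖z‖ < 1 → z + z⁻¹ - 2 = l - Complex.I * (τ * t) →
        ‖z - z₀‖ ^ 2 ≤ t := by
  suffices H : ∃ z₀ z₁ : ℂ, ‖z₀‖ ≤ 1 ∧ z₀ * z₁ = 1 ∧ z₀ + z₁ = 2 + l ∧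
      ∀ t : ℝ, 0 < t → ∀ z : ℂ, z ≠ 0 → ‖z‖ < 1 → z + z⁻¹ - 2 = l - Complex.I * (τ * t) →
        ‖z - z₀‖ ≤ ‖z - z₁‖ by
    obtain ⟨z₀, z₁, h1, h2, h3, h4⟩ := H
    refine ⟨z₀, h1, fun hl0 hl4 hsq => ?_, fun t ht z hz0 hz h =>
      sq_norm_sub_le_of_root hτ ht h2 h3 hz0 hz h (h4 t ht z hz0 hz h)⟩
    have hz : z₁ = z₀ := by
      have : z₀ * (z₁ - z₀) = 0 := by linear_combination h2 - hsq
      rcases mul_eq_zero.mp this with h | h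
      · rw [h, zero_mul] at h2; exact absurd h2 zero_ne_one
      · exact sub_eq_zero.mp h
    have h5 : (l : ℂ) * (l + 4) = 0 := by
      rw [hz] at h3
      linear_combination 4 * hsq - (2 * z₀ + 2 + l) * h3
    rcases mul_eq_zero.mp h5 with h | h
    · exact hl0 (by exact_mod_cast h)
    · refine hl4 ?_
      have : (l : ℂ) = -4 := eq_neg_of_add_eq_zero_left h
      exact_mod_cast this
  rcases le_or_gt l 0 with hl0 | hl0
  · set c : ℝ := 1 + l / 2 with hc
    set s : ℝ := τ * √(1 - c ^ 2) with hs
    have hc2 : 0 ≤ 1 - c ^ 2 := by nlinarith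
    have hτ2 : τ ^ 2 = 1 := by rw [← sq_abs, hτ, one_pow]
    have hs2 : s ^ 2 = 1 - c ^ 2 := by rw [hs, mul_pow, hτ2, Real.sq_sqrt hc2, one_mul]
    have hs2' : (s : ℂ) ^ 2 = 1 - (c : ℂ) ^ 2 := by exact_mod_cast hs2
    have hc' : (c : ℂ) = 1 + l / 2 := by rw [hc]; push_cast; ring
    refine ⟨c + s * Complex.I, c - s * Complex.I, ?_, ?_, ?_, ?_⟩
    · rw [← sq_le_one_iff₀ (norm_nonneg _), ← Complex.normSq_eq_norm_sq, Complex.normSq_add_mul_I]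
      linarith
    · linear_combination hs2' - (s : ℂ) ^ 2 * Complex.I_sq
    · linear_combination 2 * hc'
    · intro t ht z hz0 hz h
      have him := congrArg Complex.im h
      simp only [Complex.sub_im, Complex.add_im, Complex.inv_im, Complex.ofReal_im, Complex.mul_im,
        Complex.I_re, Complex.I_im, Complex.mul_re, Complex.ofReal_re] at him
      have him2 : (2 : ℂ).im = 0 := rfl
      rw [him2] at him
      have hn : 0 < Complex.normSq z := Complex.normSq_pos.mpr hz0
      have hn1 : Complex.normSq z < 1 := by
        rw [Complex.normSq_eq_norm_sq]; exact (sq_lt_one_iff₀ (norm_nonneg _)).mpr hz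
      -- The imaginary part of the equation shows that Im z has the sign of τ, because |z| < 1.
      have h6 : z.im * (1 - Complex.normSq z) = τ * t * Complex.normSq z := by
        field_simp at him
        linarith
      have h7 : 0 ≤ τ * z.im := by
        have : (τ * z.im) * (1 - Complex.normSq z) = t * Complex.normSq z := by
          linear_combination τ * h6 + t * Complex.normSq z * hτ2
        by_contra! hneg
        nlinarith [mul_pos ht hn]
      have h8 : 0 ≤ s * z.im := by
        rw [hs]
        have := mul_nonneg h7 (Real.sqrt_nonneg (1 - c ^ 2))
        linarith
      rw [← sq_le_sq₀ (norm_nonneg _) (norm_nonneg _), ← Complex.normSq_eq_norm_sq,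
        ← Complex.normSq_eq_norm_sq, Complex.normSq_apply, Complex.normSq_apply]
      simp
      nlinarith
  · set a : ℝ := √(l + l ^ 2 / 4) with ha
    have ha2 : a ^ 2 = l + l ^ 2 / 4 := Real.sq_sqrt (by positivity)
    have ha0 : 0 ≤ a := Real.sqrt_nonneg _
    have ha3 : l / 2 < a := by nlinarith
    have ha4 : a < 1 + l / 2 := by nlinarith
    have ha2' : (a : ℂ) ^ 2 = l + l ^ 2 / 4 := by exact_mod_cast ha2
    refine ⟨((1 + l / 2 - a : ℝ) : ℂ), ((1 + l / 2 + a : ℝ) : ℂ), ?_, ?_, ?_, ?_⟩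
    · rw [Complex.norm_real, Real.norm_of_nonneg (by linarith)]; linarith
    · push_cast; linear_combination -ha2'
    · push_cast; ring
    · intro t ht z hz0 hz h
      -- The midpoint of the two real roots is 1 + l/2 > 1, so z lies on the side of the smaller
      -- one.
      have hre : z.re < 1 := (Complex.re_le_norm z).trans_lt hz
      rw [← sq_le_sq₀ (norm_nonneg _) (norm_nonneg _), ← Complex.normSq_eq_norm_sq,
        ← Complex.normSq_eq_norm_sq, Complex.normSq_apply, Complex.normSq_apply]
      simp only [Complex.sub_re, Complex.sub_im, Complex.ofReal_re, Complex.ofReal_im]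
      nlinarith

section Kernels

variable {u v : ℤ}

/-! ### The kernel of the resolvent -/

/-- At a fixed site the Neumann series stops when the path towards [u, v] arrives there, after
`depth` steps. The entries are thus polynomials in z, which is what allows |z| → 1 later on. -/
theorem inverse_outward_apply (huv : u ≤ v) {z : ℂ} (hz : ‖z‖ < 1) (f : Slp 2) (n : ℤ) :
    Ring.inverse (1 - z • outward u v) f n =
      ∑ k ∈ Finset.range (depth u v n + 1), z ^ k * f ((parent u v)^[k] n) := by
  set g := Ring.inverse (1 - z • outward u v) f with hg
  have h1 : ∀ n, g n - z * outward u v g n = f n := fun n => by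
    have : ((1 - z • outward u v) * Ring.inverse (1 - z • outward u v)) f n = f n := by
      rw [Ring.mul_inverse_cancel _ (isUnit_one_sub_outward huv hz)]; rfl
    exact this
  generalize hd : depth u v n = d
  induction d generalizing n with
  | zero =>
    have := h1 n
    rw [outward_apply_of_mem ((depth_eq_zero_iff n).mp hd)] at this
    simpa using this
  | succ d ih =>
    have hn : n ∉ Set.Icc u v := fun h => by rw [(depth_eq_zero_iff n).mpr h] at hd; omega
    have h2 := h1 n
    rw [outward_apply_of_notMem huv hn, ih (parent u v n) (by
      have := depth_parent huv hn; omega), sub_eq_iff_eq_add'] at h2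
    rw [h2, Finset.sum_range_succ' _ (d + 1), Finset.mul_sum]
    simp only [Function.iterate_succ, Function.comp_apply, Function.iterate_zero, id_eq, pow_zero,
      one_mul]
    congr 1
    exact Finset.sum_congr rfl fun k _ => by ring

theorem inverse_inward_basisVec (huv : u ≤ v) {z : ℂ} (hz : ‖z‖ < 1) (m : ℤ) :
    Ring.inverse (1 - z • inward u v) (basisVec m) =
      ∑ k ∈ Finset.range (depth u v m + 1), z ^ k • basisVec ((parent u v)^[k] m) := by
  set R := Ring.inverse (1 - z • inward u v) with hR
  have h1 : ∀ m, R (basisVec m) - z • R (inward u v (basisVec m)) = basisVec m := fun m => by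
    have : (R * (1 - z • inward u v)) (basisVec m) = basisVec m := by
      rw [hR, Ring.inverse_mul_cancel _ (isUnit_one_sub_inward huv hz)]; rfl
    rw [mul_sub, mul_one, mul_smul_comm] at this
    exact this
  generalize hd : depth u v m = d
  induction d generalizing m with
  | zero =>
    have := h1 m
    rw [inward_basisVec_of_mem ((depth_eq_zero_iff m).mp hd), map_zero] at this
    simpa using this
  | succ d ih =>
    have hm : m ∉ Set.Icc u v := fun h => by rw [(depth_eq_zero_iff m).mpr h] at hd; omega
    have h2 := h1 m
    rw [inward_basisVec_of_notMem huv hm, ih (parent u v m) (by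
      have := depth_parent huv hm; omega), sub_eq_iff_eq_add'] at h2
    rw [h2, Finset.sum_range_succ' _ (d + 1), Finset.smul_sum]
    simp only [Function.iterate_succ, Function.comp_apply, Function.iterate_zero, id_eq, pow_zero,
      one_smul]
    congr 1
    exact Finset.sum_congr rfl fun k _ => by rw [smul_smul, pow_succ']

/-- The matrix entries of an operator. -/
def kernel (T : Op) (n m : ℤ) : ℂ := T (basisVec m) n

theorem norm_kernel_le (T : Op) (n m : ℤ) : ‖kernel T n m‖ ≤ ‖T‖ := by
  refine (lp.norm_apply_le_norm (by norm_num) _ n).trans ((T.le_opNorm _).trans ?_)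
  rw [norm_basisVec, mul_one]

theorem continuous_kernel (n m : ℤ) : Continuous fun T : Op => kernel T n m := by
  refine LipschitzWith.continuous (K := 1) (LipschitzWith.of_dist_le_mul fun T S => ?_)
  rw [NNReal.coe_one, one_mul, dist_eq_norm, dist_eq_norm]
  exact norm_kernel_le (T - S) n m

theorem kernel_factored (huv : u ≤ v) {z w : ℂ} (hz : ‖z‖ < 1) (hw : ‖w‖ < 1) (A : Op) (n m : ℤ) :
    kernel (Ring.inverse (1 - z • outward u v) * A * Ring.inverse (1 - w • inward u v)) n m =
      ∑ k ∈ Finset.range (depth u v n + 1), ∑ l ∈ Finset.range (depth u v m + 1),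
        z ^ k * (w ^ l * kernel A ((parent u v)^[k] n) ((parent u v)^[l] m)) := by
  rw [kernel, op_mul_apply, op_mul_apply, inverse_outward_apply huv hz]
  refine Finset.sum_congr rfl fun k _ => ?_
  rw [inverse_inward_basisVec huv hw, map_sum, lp.coeFn_sum, Finset.sum_apply, Finset.mul_sum]
  refine Finset.sum_congr rfl fun l _ => ?_
  rw [map_smul]
  rfl

theorem depth_iterate (huv : u ≤ v) (n : ℤ) (k : ℕ) :
    depth u v ((parent u v)^[k] n) = depth u v n - k := by
  induction k generalizing n with
  | zero => rfl
  | succ k ih =>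
    rw [Function.iterate_succ, Function.comp_apply, ih]
    by_cases hn : n ∈ Set.Icc u v
    · rw [parent_of_mem hn, (depth_eq_zero_iff n).mpr hn]; omega
    · have := depth_parent huv hn; omega

/-- The point of `[u, v]` closest to `n`. -/
def foot (u v n : ℤ) : ℤ := (parent u v)^[depth u v n] n

theorem iterate_notMem (huv : u ≤ v) {n : ℤ} {k : ℕ} (hk : k < depth u v n) :
    (parent u v)^[k] n ∉ Set.Icc u v := fun h => by
  have := depth_iterate huv n k
  rw [(depth_eq_zero_iff _).mpr h] at this
  omega

theorem foot_mem (huv : u ≤ v) (n : ℤ) : foot u v n ∈ Set.Icc u v := by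
  rw [← depth_eq_zero_iff, foot, depth_iterate huv, Nat.sub_self]

theorem core_basisVec (m : ℤ) :
    core u v (basisVec m) = if m ∈ Set.Icc u v then basisVec m else 0 := by
  ext n
  rw [core_apply, basisVec_apply]
  simp only [Set.mem_Icc]
  split_ifs <;> simp_all [basisVec_apply]
  grind

theorem kernel_core_conj (B : Op) (n m : ℤ) : kernel (core u v * B * core u v) n m =
    if n ∈ Set.Icc u v ∧ m ∈ Set.Icc u v then kernel B n m else 0 := by
  rw [kernel, op_mul_apply, core_basisVec]
  by_cases hm : m ∈ Set.Icc u v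
  · rw [if_pos hm, op_mul_apply, core_apply]
    by_cases hn : n ∈ Set.Icc u v
    · rw [if_pos (show u ≤ n ∧ n ≤ v from hn), if_pos ⟨hn, hm⟩]; rfl
    · rw [if_neg (show ¬(u ≤ n ∧ n ≤ v) from hn), if_neg fun h => hn h.1]
  · rw [if_neg hm, if_neg fun h => hm h.2, map_zero]; rfl

/-- Only the last point of each of the two paths lies in [u, v], so a single term of the double sum
survives. -/
theorem kernel_factored_core (huv : u ≤ v) {z w : ℂ} (hz : ‖z‖ < 1) (hw : ‖w‖ < 1) (B : Op)
    (n m : ℤ) :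
    kernel (Ring.inverse (1 - z • outward u v) * (core u v * B * core u v) *
      Ring.inverse (1 - w • inward u v)) n m =
      z ^ depth u v n * (w ^ depth u v m * kernel B (foot u v n) (foot u v m)) := by
  rw [kernel_factored huv hz hw, Finset.sum_range_succ, Finset.sum_eq_zero, zero_add,
    Finset.sum_range_succ, Finset.sum_eq_zero, zero_add, kernel_core_conj, if_pos]
  · rfl
  · exact ⟨foot_mem huv n, foot_mem huv m⟩
  · intro l hl
    rw [kernel_core_conj, if_neg fun h => iterate_notMem huv (Finset.mem_range.mp hl) h.2]
    simp
  · intro k hk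
    refine Finset.sum_eq_zero fun l _ => ?_
    rw [kernel_core_conj, if_neg fun h => iterate_notMem huv (Finset.mem_range.mp hk) h.1]
    simp

/-- The kernel of the inverse of the Dirichlet Laplacian outside `[u, v]`, up to a factor. -/
def green (u v : ℤ) (z : ℂ) (n m : ℤ) : ℂ :=
  ∑ k ∈ Finset.range (depth u v n), ∑ l ∈ Finset.range (depth u v m),
    if (parent u v)^[k] n = (parent u v)^[l] m then z ^ (k + l) else 0

theorem kernel_one_sub_core (n m : ℤ) : kernel (1 - core u v) n m =
    if n = m ∧ n ∉ Set.Icc u v then 1 else 0 := by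
  rw [kernel, op_sub_apply, core_apply, op_one_apply, basisVec_apply]
  simp only [Set.mem_Icc]
  split_ifs <;> simp_all
  grind

/-- Here the last point of each path drops out, and the sum runs over the common points of the two
paths outside [u, v]. -/
theorem kernel_factored_outer (huv : u ≤ v) {z : ℂ} (hz : ‖z‖ < 1) (n m : ℤ) :
    kernel (Ring.inverse (1 - z • outward u v) * (1 - core u v) *
      Ring.inverse (1 - z • inward u v)) n m = green u v z n m := by
  rw [kernel_factored huv hz hz, Finset.sum_range_succ, green]
  have h0 : ∀ l, kernel (1 - core u v) ((parent u v)^[depth u v n] n) l = 0 := fun l => by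
    rw [kernel_one_sub_core, if_neg fun h => h.2 (foot_mem huv n)]
  simp only [h0, mul_zero, Finset.sum_const_zero, add_zero]
  refine Finset.sum_congr rfl fun k _ => ?_
  rw [Finset.sum_range_succ, kernel_one_sub_core, if_neg, mul_zero, mul_zero, add_zero]
  · refine Finset.sum_congr rfl fun l hl => ?_
    rw [kernel_one_sub_core]
    by_cases h : (parent u v)^[k] n = (parent u v)^[l] m
    · rw [if_pos h, if_pos ⟨h, h ▸ iterate_notMem huv (Finset.mem_range.mp hl)⟩, mul_one, pow_add]
    · rw [if_neg h, if_neg fun h' => h h'.1, mul_zero, mul_zero]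
  · intro h
    exact h.2 (h.1 ▸ foot_mem huv m)

theorem continuous_green (n m : ℤ) : Continuous fun z => green u v z n m := by
  unfold green
  refine continuous_finsetSum _ fun k _ => continuous_finsetSum _ fun l _ => ?_
  split_ifs
  · fun_prop
  · fun_prop

theorem eq_of_iterate_eq (huv : u ≤ v) {n m : ℤ} {k l : ℕ} 
    (h : (parent u v)^[k] n = (parent u v)^[l] m) :
    depth u v n - k = depth u v m - l := by
  rw [← depth_iterate huv, ← depth_iterate huv, h]

/-- Depths determine the matching: for each point of the path of m there is at most one k for which
the path of n meets it. This bound survives at z² = 1, at the price of linear growth in m. -/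
theorem norm_green_le_depth (huv : u ≤ v) {z : ℂ} (hz : ‖z‖ ≤ 1) (n m : ℤ) :
    ‖green u v z n m‖ ≤ depth u v m := by
  rw [green, Finset.sum_comm]
  refine (norm_sum_le_of_le (f := fun l => ∑ k ∈ Finset.range (depth u v n),
    if (parent u v)^[k] n = (parent u v)^[l] m then z ^ (k + l) else 0)
    (Finset.range (depth u v m)) (n := fun _ => (1 : ℝ)) fun l hl => ?_).trans (by simp)
  have hl' := Finset.mem_range.mp hl
  refine (norm_sum_le_of_le _
    (n := fun k => if k = depth u v n - (depth u v m - l) then (1 : ℝ) else 0) fun k hk => ?_).trans ?_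
  · have hk' := Finset.mem_range.mp hk
    by_cases h : (parent u v)^[k] n = (parent u v)^[l] m
    · have := eq_of_iterate_eq huv h
      rw [if_pos h, if_pos (by omega), norm_pow]
      exact pow_le_one₀ (norm_nonneg _) hz
    · rw [if_neg h, norm_zero]
      split_ifs <;> norm_num
  · rw [Finset.sum_ite_eq']
    split_ifs <;> norm_num

theorem green_comm (z : ℂ) (n m : ℤ) : green u v z n m = green u v z m n := by
  rw [green, green, Finset.sum_comm]
  refine Finset.sum_congr rfl fun k _ => Finset.sum_congr rfl fun l _ => ?_
  simp only [eq_comm, add_comm]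

theorem green_self (huv : u ≤ v) (z : ℂ) (n : ℤ) :
    green u v z n n = ∑ k ∈ Finset.range (depth u v n), (z ^ 2) ^ k := by
  rw [green]
  refine Finset.sum_congr rfl fun k hk => ?_
  rw [Finset.sum_eq_single k]
  · rw [if_pos rfl, ← pow_mul, two_mul]
  · intro l hl hlk
    rw [if_neg]
    intro h
    have := eq_of_iterate_eq huv h
    have := Finset.mem_range.mp hk
    have := Finset.mem_range.mp hl
    omega
  · intro h; exact absurd hk h

/-- The starting point n cannot lie on the path of m: all later points of that path have smaller
depth than m, hence than n. -/
theorem green_parent (huv : u ≤ v) (z : ℂ) {n m : ℤ} (hnm : n ≠ m)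
    (hd : depth u v m ≤ depth u v n) (hn : n ∉ Set.Icc u v) :
    green u v z n m = z * green u v z (parent u v n) m := by
  rw [green, depth_parent huv hn, Finset.sum_range_succ', green, Finset.mul_sum]
  conv_rhs => rw [← add_zero (Finset.sum _ _)]
  congr 1
  · refine Finset.sum_congr rfl fun k _ => ?_
    rw [Finset.mul_sum]
    refine Finset.sum_congr rfl fun l _ => ?_
    rw [Function.iterate_succ, Function.comp_apply, mul_ite, mul_zero]
    congr 1
    ring
  · refine Finset.sum_eq_zero fun l hl => if_neg fun h => ?_
    have h0 : 0 < depth u v n := by have := depth_parent huv hn; omega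
    have hl' := Finset.mem_range.mp hl
    have := eq_of_iterate_eq huv h
    obtain rfl : l = 0 := by omega
    exact hnm h

/-- Moving the deeper of two distinct points to its parent costs a factor z. This ends on the
diagonal, where the sum is geometric in z², or at a point of [u, v], where it is empty. -/
theorem norm_green_le (huv : u ≤ v) {z : ℂ} (hz : ‖z‖ ≤ 1) (hz2 : z ^ 2 ≠ 1) (n m : ℤ) :
    ‖green u v z n m‖ ≤ 2 / ‖z ^ 2 - 1‖ := by
  have hpos : 0 < ‖z ^ 2 - 1‖ := norm_pos_iff.mpr (sub_ne_zero.mpr hz2)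
  generalize hs : depth u v n + depth u v m = s
  induction s using Nat.strong_induction_on generalizing n m with
  | _ s ih =>
    subst hs
    wlog hd : depth u v m ≤ depth u v n generalizing n m with H
    · rw [green_comm]
      exact H m n (fun s hs n' m' h => ih s (by omega) n' m' h) (by omega)
    by_cases hnm : n = m
    · subst hnm
      rw [green_self huv, geom_sum_eq hz2, norm_div]
      gcongr
      refine (norm_sub_le _ _).trans ?_
      rw [← pow_mul, norm_pow, norm_one]
      linarith [pow_le_one₀ (norm_nonneg z) hz (n := 2 * depth u v n)]
    by_cases hn : n ∈ Set.Icc u v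
    · rw [green, (depth_eq_zero_iff n).mpr hn]
      simp only [Finset.range_zero, Finset.sum_empty, norm_zero]
      positivity
    · rw [green_parent huv z hnm hd hn, norm_mul]
      have := ih _ (by have := depth_parent huv hn; omega) (parent u v n) m rfl
      exact (mul_le_of_le_one_left (norm_nonneg _) hz).trans this

end Kernels

section Limits

/-! ### Sums with weights -/

theorem hasSum_norm_sq {E : ℤ → Type*} [∀ n, NormedAddCommGroup (E n)] (x : lp E 2) :
    HasSum (fun n => ‖x n‖ ^ 2) (‖x‖ ^ 2) := by
  have h := lp.hasSum_norm (p := 2) (by norm_num) x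
  simpa using h

theorem memlp_two_of_summable {E : ℤ → Type*} [∀ n, NormedAddCommGroup (E n)] {x : ∀ n, E n}
    (h : Summable fun n => ‖x n‖ ^ 2) : Memℓp x 2 :=
  (memℓp_gen_iff (p := 2) (by norm_num)).2 (by simpa using h)

theorem summable_mul_and_sq_tsum_le {a b : ℤ → ℝ} (ha : ∀ n, 0 ≤ a n) (hb : ∀ n, 0 ≤ b n)
    (ha2 : Summable fun n => a n ^ 2) (hb2 : Summable fun n => b n ^ 2) :
    Summable (fun n => a n * b n) ∧
      (∑' n, a n * b n) ^ 2 ≤ (∑' n, a n ^ 2) * ∑' n, b n ^ 2 := by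
  have h := Real.summable_and_inner_le_Lp_mul_Lq_tsum_of_nonneg Real.HolderConjugate.two_two ha hb
    (by simpa using ha2) (by simpa using hb2)
  refine ⟨h.1, ?_⟩
  have h2 := h.2
  simp only [Real.rpow_two, ← Real.sqrt_eq_rpow] at h2
  rw [← Real.sqrt_mul (tsum_nonneg fun n => sq_nonneg _)] at h2
  rw [← Real.sq_sqrt (mul_nonneg (tsum_nonneg fun n => sq_nonneg (a n))
    (tsum_nonneg fun n => sq_nonneg (b n)))]
  gcongr
  exact tsum_nonneg fun n => mul_nonneg (ha n) (hb n)

theorem weight_sq (s : ℝ) (n : ℤ) : weight s n ^ 2 = (1 + (n : ℝ) ^ 2) ^ s := by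
  rw [weight, ← Real.rpow_natCast, ← Real.rpow_mul (by positivity)]
  norm_num

theorem weight_neg_mul_weight (s : ℝ) (n : ℤ) : weight (-s) n * weight s n = 1 := by
  rw [weight, weight, ← Real.rpow_add (by positivity), neg_div, neg_add_cancel, Real.rpow_zero]

theorem summable_weight_sq {σ : ℝ} (hσ : 1 / 2 < σ) : Summable fun n => weight (-σ) n ^ 2 := by
  have h := Real.summable_abs_int_rpow (b := 2 * σ) (by linarith)
  refine Summable.of_norm_bounded_eventually h ?_
  -- The site 0 is excluded, since there |n|^(-2σ) has the value 0 while the weight is 1.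
  refine (Set.finite_singleton (0 : ℤ)).subset fun n hn => ?_
  by_contra hn0
  have hn0' : (n : ℝ) ≠ 0 := by exact_mod_cast hn0
  refine hn ?_
  change ‖weight (-σ) n ^ 2‖ ≤ |(n : ℝ)| ^ (-(2 * σ))
  rw [Real.norm_of_nonneg (sq_nonneg _), weight_sq]
  have h1 : |(n : ℝ)| ^ (-(2 * σ)) = ((n : ℝ) ^ 2) ^ (-σ) := by
    rw [← sq_abs, ← Real.rpow_natCast, ← Real.rpow_mul (abs_nonneg _)]
    congr 1; push_cast; ring
  rw [h1]
  exact Real.rpow_le_rpow_of_nonpos (by positivity) (by linarith) (by linarith)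

theorem norm_coord {q : ℝ≥0∞} {s : ℝ} (x : Wlp q s) (n : ℤ) :
    ‖x n‖ = weight s n * ‖x.coord n‖ := Fiber.norm_def s n (x n)

/-- The weighted sequence with the given entries. -/
def ofBounded {σ : ℝ} (hσ : 1 / 2 < σ) (f : ℤ → ℂ) (K : ℝ) (hf : ∀ n, ‖f n‖ ≤ K) :
    Wlp 2 (-σ) :=
  ⟨fun n => (Fiber.val (-σ) n).symm (f n), memlp_two_of_summable (by
    refine Summable.of_nonneg_of_le (fun n => sq_nonneg _) (fun n => ?_)
      ((summable_weight_sq hσ).mul_right (K ^ 2))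
    rw [Fiber.norm_def, LinearEquiv.apply_symm_apply, mul_pow]
    gcongr
    exact hf n)⟩

/-- Constants are square summable against the weight (1 + n²)^(-σ/2) for σ > 1/2, so pointwise
bounded convergence suffices. -/
theorem tendsto_weighted_of_dominated {ι : Type*} {l : Filter ι} {σ : ℝ} (hσ : 1 / 2 < σ)
    {x : ι → Wlp 2 (-σ)} {y : Wlp 2 (-σ)} {K : ℝ}
    (hx : ∀ n, Tendsto (fun i => (x i).coord n) l (𝓝 (y.coord n)))
    (hK : ∀ᶠ i in l, ∀ n, ‖(x i).coord n - y.coord n‖ ≤ K) : Tendsto x l (𝓝 y) := by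
  rw [tendsto_iff_norm_sub_tendsto_zero]
  have key : Tendsto (fun i => ‖x i - y‖ ^ 2) l (𝓝 0) := by
    have h1 : ∀ i, ‖x i - y‖ ^ 2 =
        ∑' n, weight (-σ) n ^ 2 * ‖(x i).coord n - y.coord n‖ ^ 2 := fun i => by
      rw [← (hasSum_norm_sq (x i - y)).tsum_eq]
      refine tsum_congr fun n => ?_
      rw [norm_coord, mul_pow]
      rfl
    have h0 : (0 : ℝ) = ∑' n : ℤ, weight (-σ) n ^ 2 * ‖y.coord n - y.coord n‖ ^ 2 := by simp
    simp only [h1]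
    rw [h0]
    refine tendsto_tsum_of_dominated_convergence
      (bound := fun n => weight (-σ) n ^ 2 * K ^ 2) ((summable_weight_sq hσ).mul_right _) ?_ ?_
    · intro n
      exact (((hx n).sub_const _).norm.pow 2).const_mul _
    · filter_upwards [hK] with i hi n
      rw [Real.norm_of_nonneg (by positivity)]
      gcongr
      exact hi n
  have := key.sqrt
  simpa [Real.sqrt_sq (norm_nonneg _)] using this

/-! ### Limits of operators, in terms of their kernels -/

theorem hasSum_kernel (T : Op) (f : Slp 2) (n : ℤ) :
    HasSum (fun m => kernel T n m * f m) (T f n) := by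
  have h1 := (lp.hasSum_single (E := fun _ : ℤ => ℂ) (p := 2) (by norm_num) f).mapL
    ((lp.evalCLM ℂ (fun _ : ℤ => ℂ) 2 n).comp T)
  refine h1.congr_fun fun m => ?_
  have h2 : lp.single (E := fun _ : ℤ => ℂ) 2 m (f m) = f m • basisVec m := by
    rw [basisVec, ← lp.single_smul, smul_eq_mul, mul_one]
  rw [h2, map_smul, smul_eq_mul, mul_comm]
  rfl

/-- The inclusion `l¹_1 ⊂ l²`. -/
def inclOneScalar : Wlp 1 1 →ₗ[ℂ] Slp 2 :=
  (lp.linearMapOfLE (𝕜 := ℂ) (E := fun _ : ℤ => ℂ) (p := 1) (q := 2) (by norm_num)).comp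
    (inclW 1 zero_le_one).toLinearMap

theorem hasSum_norm_one (h : Wlp 1 1) : HasSum (fun n => weight 1 n * ‖h.coord n‖) ‖h‖ := by
  have := lp.hasSum_norm (p := 1) (by norm_num) h
  simpa [norm_coord] using this

/-- Dominated convergence is used twice: in the column index, where the growth of the kernel is
absorbed by the weight of l¹_1, and in the row index, where the entries of T h are uniformly
bounded. -/
theorem exists_boundaryValue {ι : Type*} {l : Filter ι} [l.NeBot] {T : ι → Op}
    {κ : ℤ → ℤ → ℂ} {C : ℝ} (hC : 0 ≤ C)
    (hb : ∀ᶠ i in l, ∀ n m, ‖kernel (T i) n m‖ ≤ C * weight 1 m)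
    (hκ : ∀ n m, Tendsto (fun i => kernel (T i) n m) l (𝓝 (κ n m))) :
    ∃ B : Wlp 1 1 →L[ℂ] Slp ∞, ‖B‖ ≤ C ∧ ∀ (h : Wlp 1 1) (σ : ℝ) (hσ : 1 / 2 < σ),
      ∃ u : Wlp 2 (-σ), (∀ n, u.coord n = B h n) ∧
        Tendsto (fun i => inclS 2 (neg_nonpos.mpr (by linarith : 0 ≤ σ))
          (T i (inclOneScalar h))) l (𝓝 u) := by
  have hκb : ∀ n m, ‖κ n m‖ ≤ C * weight 1 m := fun n m =>
    le_of_tendsto (hκ n m).norm (hb.mono fun i hi => hi n m)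
  have hdom : ∀ (κ' : ℤ → ℤ → ℂ), (∀ n m, ‖κ' n m‖ ≤ C * weight 1 m) → ∀ (h : Wlp 1 1) n,
      ∀ m, ‖κ' n m * h.coord m‖ ≤ C * (weight 1 m * ‖h.coord m‖) := fun κ' hκ' h n m => by
    rw [norm_mul, ← mul_assoc]
    gcongr
    exact hκ' n m
  have hsum : ∀ (h : Wlp 1 1) n, Summable fun m => κ n m * h.coord m := fun h n =>
    Summable.of_norm_bounded ((hasSum_norm_one h).summable.mul_left C) (hdom κ hκb h n)
  have hle : ∀ (κ' : ℤ → ℤ → ℂ), (∀ n m, ‖κ' n m‖ ≤ C * weight 1 m) → ∀ (h : Wlp 1 1) n,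
      ‖∑' m, κ' n m * h.coord m‖ ≤ C * ‖h‖ := fun κ' hκ' h n =>
    tsum_of_norm_bounded ((hasSum_norm_one h).mul_left C) (hdom κ' hκ' h n)
  let B : Wlp 1 1 →L[ℂ] Slp ∞ := LinearMap.mkContinuous
    { toFun := fun h => ⟨fun n => ∑' m, κ n m * h.coord m,
        memℓp_infty ⟨C * ‖h‖, by rintro _ ⟨n, rfl⟩; exact hle κ hκb h n⟩⟩
      map_add' := fun f g => by
        ext n
        change ∑' m, κ n m * (f + g : Wlp 1 1).coord m =
          ∑' m, κ n m * f.coord m + ∑' m, κ n m * g.coord m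
        rw [← (hsum f n).tsum_add (hsum g n)]
        refine tsum_congr fun m => ?_
        rw [← mul_add]
        rfl
      map_smul' := fun c f => by
        ext n
        change ∑' m, κ n m * (c • f : Wlp 1 1).coord m = c * ∑' m, κ n m * f.coord m
        rw [← tsum_mul_left]
        refine tsum_congr fun m => ?_
        rw [mul_left_comm]
        rfl } C (fun h => lp.norm_le_of_forall_le (by positivity) fun n => hle κ hκb h n)
  refine ⟨B, LinearMap.mkContinuous_norm_le _ hC _, fun h σ hσ => ?_⟩
  refine ⟨ofBounded hσ (fun n => B h n) (C * ‖h‖) (fun n => hle κ hκb h n), fun n => rfl, ?_⟩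
  have hT : ∀ i n, T i (inclOneScalar h) n = ∑' m, kernel (T i) n m * h.coord m := fun i n =>
    (hasSum_kernel (T i) (inclOneScalar h) n).tsum_eq.symm
  refine tendsto_weighted_of_dominated hσ (K := C * ‖h‖ + C * ‖h‖) (fun n => ?_) ?_
  · change Tendsto (fun i => T i (inclOneScalar h) n) l (𝓝 (∑' m, κ n m * h.coord m))
    simp only [hT]
    refine tendsto_tsum_of_dominated_convergence
      (bound := fun m => C * (weight 1 m * ‖h.coord m‖))
      ((hasSum_norm_one h).summable.mul_left C) (fun m => (hκ n m).mul_const _) ?_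
    filter_upwards [hb] with i hi m
    exact hdom _ hi h n m
  · filter_upwards [hb] with i hi n
    refine (norm_sub_le _ _).trans (add_le_add ?_ (hle κ hκb h n))
    change ‖T i (inclOneScalar h) n‖ ≤ _
    rw [hT]
    exact hle _ hi h n

theorem summable_hilbertSchmidt {σ : ℝ} (hσ : 1 / 2 < σ) (K : ℝ) :
    Summable fun x : ℤ × ℤ => weight (-σ) x.1 ^ 2 * weight (-σ) x.2 ^ 2 * K :=
  ((summable_weight_sq hσ).mul_of_nonneg (summable_weight_sq hσ) (fun _ => sq_nonneg _)
    (fun _ => sq_nonneg _)).mul_right K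

/-- The right-hand side is the squared Hilbert–Schmidt norm of the weighted operator; the estimate
is Cauchy–Schwarz in each row. -/
theorem norm_weighted_sq_le {σ : ℝ} (hσ : 1 / 2 < σ) (T : Op) :
    ‖(inclS 2 (neg_nonpos.mpr (by linarith : 0 ≤ σ))).comp
        (T.comp (inclW 2 (by linarith : 0 ≤ σ)))‖ ^ 2 ≤
      ∑' x : ℤ × ℤ, weight (-σ) x.1 ^ 2 * weight (-σ) x.2 ^ 2 * ‖kernel T x.1 x.2‖ ^ 2 := by
  have hσ0 : 0 ≤ σ := by linarith
  set S := ∑' x : ℤ × ℤ, weight (-σ) x.1 ^ 2 * weight (-σ) x.2 ^ 2 * ‖kernel T x.1 x.2‖ ^ 2 with hS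
  have hsum : Summable fun x : ℤ × ℤ =>
      weight (-σ) x.1 ^ 2 * weight (-σ) x.2 ^ 2 * ‖kernel T x.1 x.2‖ ^ 2 := by
    refine Summable.of_nonneg_of_le (fun x => by positivity) (fun x => ?_)
      (summable_hilbertSchmidt hσ (‖T‖ ^ 2))
    gcongr
    exact norm_kernel_le _ _ _
  have hS0 : 0 ≤ S := tsum_nonneg fun x => by positivity
  have hrow : ∀ n, Summable fun m => (weight (-σ) m * ‖kernel T n m‖) ^ 2 := fun n => by
    refine Summable.of_nonneg_of_le (fun x => by positivity) (fun x => ?_)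
      ((summable_weight_sq hσ).mul_right (‖T‖ ^ 2))
    rw [mul_pow]
    gcongr
    exact norm_kernel_le _ _ _
  have hSrow : S = ∑' n, weight (-σ) n ^ 2 * ∑' m, (weight (-σ) m * ‖kernel T n m‖) ^ 2 := by
    rw [hS, hsum.tsum_prod]
    refine tsum_congr fun n => ?_
    rw [← tsum_mul_left]
    exact tsum_congr fun m => by ring
  have hsumrow : Summable fun n =>
      weight (-σ) n ^ 2 * ∑' m, (weight (-σ) m * ‖kernel T n m‖) ^ 2 := by
    refine hsum.prod.congr fun n => ?_
    rw [← tsum_mul_left]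
    exact tsum_congr fun m => by ring
  rw [← Real.le_sqrt (norm_nonneg _) hS0]
  refine ContinuousLinearMap.opNorm_le_bound _ (Real.sqrt_nonneg _) fun h => ?_
  set y := ((inclS 2 (neg_nonpos.mpr hσ0)).comp (T.comp (inclW 2 hσ0))) h with hy
  rw [← sq_le_sq₀ (norm_nonneg _) (by positivity), mul_pow, Real.sq_sqrt hS0]
  have hh := hasSum_norm_sq h
  simp only [norm_coord] at hh
  have hpt : ∀ n, ‖y.coord n‖ ^ 2 ≤
      (∑' m, (weight (-σ) m * ‖kernel T n m‖) ^ 2) * ‖h‖ ^ 2 := fun n => by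
    have hcs := summable_mul_and_sq_tsum_le
      (fun m => mul_nonneg (weight_pos (-σ) m).le (norm_nonneg (kernel T n m)))
      (fun m => mul_nonneg (weight_pos σ m).le (norm_nonneg (h.coord m))) (hrow n) hh.summable
    rw [hh.tsum_eq] at hcs
    have hT : y.coord n = ∑' m, kernel T n m * h.coord m :=
      (hasSum_kernel T (inclW 2 hσ0 h) n).tsum_eq.symm
    have hterm : ∀ m, ‖kernel T n m * h.coord m‖ =
        weight (-σ) m * ‖kernel T n m‖ * (weight σ m * ‖h.coord m‖) := fun m => by
      rw [norm_mul]
      linear_combination -(‖kernel T n m‖ * ‖h.coord m‖) * weight_neg_mul_weight σ m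
    refine le_trans ?_ hcs.2
    gcongr
    rw [hT]
    exact tsum_of_norm_bounded hcs.1.hasSum fun m => (hterm m).le
  rw [← (hasSum_norm_sq y).tsum_eq, hSrow, ← tsum_mul_right]
  refine (hasSum_norm_sq y).summable.tsum_le_tsum (fun n => ?_) (hsumrow.mul_right _)
  rw [norm_coord, mul_pow, mul_assoc]
  gcongr
  exact hpt n

instance (s : ℝ) (n : ℤ) : CompleteSpace (Fiber s n) :=
  haveI : FiniteDimensional ℂ (Fiber s n) := (Fiber.val s n).symm.finiteDimensional
  FiniteDimensional.complete ℂ _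

/-- Dominated convergence over ℤ × ℤ makes the operators Cauchy in the weighted Hilbert–Schmidt
norm, hence in the operator norm, and the target is complete. -/
theorem exists_weighted_limit {ι : Type*} {l : Filter ι} [l.NeBot] {T : ι → Op}
    {κ : ℤ → ℤ → ℂ} {C : ℝ} (hb : ∀ᶠ i in l, ∀ n m, ‖kernel (T i) n m‖ ≤ C)
    (hκ : ∀ n m, Tendsto (fun i => kernel (T i) n m) l (𝓝 (κ n m))) {σ : ℝ} (hσ : 1 / 2 < σ) :
    ∃ S : Wlp 2 σ →L[ℂ] Wlp 2 (-σ),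
      Tendsto (fun i => (inclS 2 (neg_nonpos.mpr (by linarith : 0 ≤ σ))).comp
        ((T i).comp (inclW 2 (by linarith : 0 ≤ σ)))) l (𝓝 S) := by
  refine cauchy_map_iff_exists_tendsto.mp ?_
  rw [cauchy_map_iff', uniformity_eq_comap_nhds_zero, tendsto_comap_iff,
    tendsto_zero_iff_norm_tendsto_zero]
  have h0 : Tendsto (fun x : ι × ι => ∑' y : ℤ × ℤ, weight (-σ) y.1 ^ 2 * weight (-σ) y.2 ^ 2 *
      ‖kernel (T x.2 - T x.1) y.1 y.2‖ ^ 2) (l ×ˢ l) (𝓝 0) := by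
    have e : (0 : ℝ) = ∑' y : ℤ × ℤ, weight (-σ) y.1 ^ 2 * weight (-σ) y.2 ^ 2 *
      ‖κ y.1 y.2 - κ y.1 y.2‖ ^ 2 := by simp
    rw [e]
    refine tendsto_tsum_of_dominated_convergence (bound := fun y =>
      weight (-σ) y.1 ^ 2 * weight (-σ) y.2 ^ 2 * (C + C) ^ 2) (summable_hilbertSchmidt hσ _) ?_ ?_
    · intro y
      exact ((((hκ y.1 y.2).comp tendsto_snd).sub ((hκ y.1 y.2).comp tendsto_fst)).norm.pow
        2).const_mul _
    · filter_upwards [hb.prod_mk hb] with x hx y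
      rw [Real.norm_of_nonneg (by positivity)]
      gcongr
      exact (norm_sub_le _ _).trans (add_le_add (hx.2 _ _) (hx.1 _ _))
  have h1 := h0.sqrt
  rw [Real.sqrt_zero] at h1
  refine squeeze_zero (fun _ => norm_nonneg _) (fun x => ?_) h1
  refine Real.le_sqrt_of_sq_le ((le_of_eq ?_).trans (norm_weighted_sq_le hσ (T x.2 - T x.1)))
  simp only [Function.comp_apply]
  congr 2

end Limits

section BoundaryValues

variable {u v : ℤ}

/-! ### The resolvent outside the disk and the bands -/

/-- The root z is missing only if (1 - Ω)/ε lies in [-4, 0], which is the upper band; w is missing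
only on the lower band. -/
theorem isRegular_of_notMem_bands (huv : u ≤ v) (p : ℕ) {δ ε : ℝ} (hδ : 0 < δ) (hε : 0 < ε)
    (hεδ : ε ≤ (24 * coreBound p δ)⁻¹) {Ω : ℂ} (hΩ : δ ≤ ‖Ω‖)
    (hb : Ω ∉ Complex.ofReal '' bands ε) : IsRegular (opL (Finset.Icc u v) p ε) Ω := by
  have hε' : (ε : ℂ) ≠ 0 := by exact_mod_cast hε.ne'
  obtain ⟨z, hz0, hz1, hz⟩ := exists_root_norm_lt_one (l := (1 - Ω) / ε) fun x hx h => by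
    rw [div_eq_iff hε'] at h
    refine hb ⟨1 - x * ε, Or.inl ⟨?_, ?_⟩, ?_⟩
    · nlinarith [hx.1, hx.2]
    · nlinarith [hx.1, hx.2]
    · push_cast; linear_combination h
  obtain ⟨w, hw0, hw1, hw⟩ := exists_root_norm_lt_one (l := (1 + Ω) / ε) fun x hx h => by
    rw [div_eq_iff hε'] at h
    refine hb ⟨x * ε - 1, Or.inr ⟨?_, ?_⟩, ?_⟩
    · nlinarith [hx.1, hx.2]
    · nlinarith [hx.1, hx.2]
    · push_cast; linear_combination -h
  exact (opL_sub_mul_inverse huv p hε.ne' hz0 hw0 hz1 hw1 (by rw [hz]; field_simp)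
    (by rw [hw]; field_simp) (isUnit_coreOp p hδ hε.le hεδ hΩ hz1.le hw1.le).1).1

theorem coreP_mul_coreP : coreP u v * coreP u v = coreP u v := by
  rw [coreP, blk_mul, core_mul_core]; simp

theorem coreOp_mul_compl (huv : u ≤ v) (p : ℕ) (ε : ℝ) (Ω z w : ℂ) :
    coreOp u v p ε Ω z w * (1 - coreP u v) = 1 - coreP u v := by
  have hV := core_mul_core (u := u) (v := v)
  have hz := coreCorrection_mul_core huv z
  have hw := coreCorrection_mul_core huv w
  rw [coreOp, coreLimit, smul_blk, blk_add, coreP, one_eq_blk, blk_sub, blk_mul]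
  congr 1 <;>
  simp only [add_zero, smul_zero, add_mul, smul_mul_assoc, sub_mul, neg_mul,
    one_mul, mul_sub, mul_one, mul_zero, hV, hz, hw, smul_neg, sub_zero] <;>
  module

theorem compl_mul_coreOp (huv : u ≤ v) (p : ℕ) (ε : ℝ) (Ω z w : ℂ) :
    (1 - coreP u v) * coreOp u v p ε Ω z w = 1 - coreP u v := by
  have hV := core_mul_core (u := u) (v := v)
  have hz := core_mul_coreCorrection huv z
  have hw := core_mul_coreCorrection huv w
  rw [coreOp, coreLimit, smul_blk, blk_add, coreP, one_eq_blk, blk_sub, blk_mul]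
  congr 1 <;>
  simp only [zero_mul, add_zero, smul_zero, mul_add, mul_smul_comm, sub_mul, mul_neg,
    one_mul, mul_sub, mul_one, hV, hz, hw, smul_neg, sub_zero] <;>
  module

/-- The core operator is the identity outside [u, v], and so is its inverse. This separates the
explicit exterior part, which carries 1/ε, from a part compressed to [u, v]. -/
theorem inverse_coreOp_mul_outerScale (huv : u ≤ v) {p : ℕ} {ε : ℝ} {Ω z w : ℂ}
    (hN : IsUnit (coreOp u v p ε Ω z w)) (a b : ℂ) :
    Ring.inverse (coreOp u v p ε Ω z w) * outerScale u v a b =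
      blk (a • (1 - core u v)) 0 0 (b • (1 - core u v)) +
        coreP u v * Ring.inverse (coreOp u v p ε Ω z w) * coreP u v := by
  set G := coreOp u v p ε Ω z w
  set N := Ring.inverse G
  set P := coreP u v with hP
  have hV := core_mul_core (u := u) (v := v)
  have hl : N * G = 1 := Ring.inverse_mul_cancel _ hN
  have hr : G * N = 1 := Ring.mul_inverse_cancel _ hN
  have h1 : N * (1 - P) = 1 - P := by
    conv_lhs => rw [hP, ← coreOp_mul_compl huv p ε Ω z w, ← mul_assoc, hl, one_mul]
  have h2 : (1 - P) * N = 1 - P := by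
    conv_lhs => rw [hP, ← compl_mul_coreOp huv p ε Ω z w, mul_assoc, hr, mul_one]
  set X := blk (a • (1 - core u v)) 0 0 (b • (1 - core u v)) with hX
  have hPX : (1 - P) * X = X := by
    rw [hP, hX, coreP, one_eq_blk, blk_sub, blk_mul]
    congr 1 <;>
    simp only [zero_mul, mul_zero, mul_smul_comm, sub_mul, one_mul, mul_sub, mul_one, hV, sub_zero,
      add_zero, zero_add] <;>
    module
  have hPP : P * P = P := coreP_mul_coreP
  have hs : outerScale u v a b = X + P := by
    rw [outerScale, hX, hP, coreP, blk_add, add_zero]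
  have h3 : P * N * P = N * P := by
    have : (1 - P) * N * P = 0 := by rw [h2, sub_mul, one_mul, hPP, sub_self]
    rw [sub_mul, sub_mul, one_mul, sub_eq_zero] at this
    exact this.symm
  have h4 : N * X = X := by rw [← hPX, ← mul_assoc, h1]
  rw [hs, mul_add, h4, h3]

/-- The blocks of the resolvent. -/
theorem resolv_opL_eq_blk (huv : u ≤ v) {p : ℕ} {ε : ℝ} (hε : ε ≠ 0) {Ω z w : ℂ} (hz : z ≠ 0)
    (hw : w ≠ 0) (hz1 : ‖z‖ < 1) (hw1 : ‖w‖ < 1)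
    (hΩz : ε * (z + z⁻¹ - 2) = 1 - Ω) (hΩw : ε * (w + w⁻¹ - 2) = 1 + Ω)
    (hN : IsUnit (coreOp u v p ε Ω z w)) :
    let N := Ring.inverse (coreOp u v p ε Ω z w)
    let oz := Ring.inverse (1 - z • outward u v)
    let ow := Ring.inverse (1 - w • outward u v)
    let iz := Ring.inverse (1 - z • inward u v)
    let iw := Ring.inverse (1 - w • inward u v)
    let V := core u v
    resolv (opL (Finset.Icc u v) p ε) Ω =
      blk ((z / ε) • (oz * (1 - V) * iz) + oz * (V * ent11 N * V) * iz)
        (oz * (V * ent12 N * V) * iw) (ow * (V * ent21 N * V) * iz)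
        ((-(w / ε)) • (ow * (1 - V) * iw) + ow * (V * ent22 N * V) * iw) := by
  intro N oz ow iz iw V
  rw [(opL_sub_mul_inverse huv p hε hz hw hz1 hw1 hΩz hΩw hN).2,
    inverse_coreOp_mul_outerScale huv hN]
  change blk oz 0 0 ow * (_ + coreP u v * N * coreP u v) * blk iz 0 0 iw = _
  conv_lhs => rw [← blk_ent N]
  rw [coreP, blk_mul, blk_mul, blk_add, blk_mul, blk_mul]
  simp only [zero_mul, mul_zero, add_zero, zero_add, mul_add, add_mul, mul_smul_comm,
    smul_mul_assoc, smul_zero]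
  rfl

theorem ent_blk (A B C D : Op) : ent11 (blk A B C D) = A ∧ ent12 (blk A B C D) = B ∧
    ent21 (blk A B C D) = C ∧ ent22 (blk A B C D) = D := by
  refine ⟨?_, ?_, ?_, ?_⟩ <;> refine ContinuousLinearMap.ext fun f => ?_
  · change A f + B 0 = A f
    rw [map_zero, add_zero]
  · change A 0 + B f = B f
    rw [map_zero, zero_add]
  · change C f + D 0 = C f
    rw [map_zero, add_zero]
  · change C 0 + D f = D f
    rw [map_zero, zero_add]

/-! ### Convergence of the kernels at the bands -/

/-- The kernels of `T μ` converge as `μ ↓ 0`; they are bounded by `C (1 + m²)^(1/2)`, and they are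
bounded if `P` holds. -/
def KernelLimit (T : ℝ → Op) (C : ℝ) (P : Prop) : Prop :=
  ∃ κ : ℤ → ℤ → ℂ,
    (∀ n m, Tendsto (fun μ => kernel (T μ) n m) (𝓝[>] 0) (𝓝 (κ n m))) ∧
    (∀ᶠ μ in 𝓝[>] (0 : ℝ), ∀ n m, ‖kernel (T μ) n m‖ ≤ C * weight 1 m) ∧
    (P → ∃ K, ∀ᶠ μ in 𝓝[>] (0 : ℝ), ∀ n m, ‖kernel (T μ) n m‖ ≤ K)

theorem KernelLimit.add {T S : ℝ → Op} {C D : ℝ} {P : Prop} (hT : KernelLimit T C P)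
    (hS : KernelLimit S D P) : KernelLimit (fun μ => T μ + S μ) (C + D) P := by
  obtain ⟨κ, h1, h2, h3⟩ := hT
  obtain ⟨κ', h1', h2', h3'⟩ := hS
  refine ⟨fun n m => κ n m + κ' n m, fun n m => (h1 n m).add (h1' n m), ?_, fun hP => ?_⟩
  · filter_upwards [h2, h2'] with μ hμ hμ' n m
    rw [add_mul]
    exact (norm_add_le _ _).trans (add_le_add (hμ n m) (hμ' n m))
  · obtain ⟨K, hK⟩ := h3 hP
    obtain ⟨K', hK'⟩ := h3' hP
    refine ⟨K + K', ?_⟩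
    filter_upwards [hK, hK'] with μ hμ hμ' n m
    exact (norm_add_le _ _).trans (add_le_add (hμ n m) (hμ' n m))

theorem KernelLimit.mono {T : ℝ → Op} {C D : ℝ} {P : Prop} (hT : KernelLimit T C P)
    (h : C ≤ D) : KernelLimit T D P := by
  obtain ⟨κ, h1, h2, h3⟩ := hT
  refine ⟨κ, h1, ?_, h3⟩
  filter_upwards [h2] with μ hμ n m
  exact (hμ n m).trans (mul_le_mul_of_nonneg_right h (weight_pos 1 m).le)

theorem KernelLimit.congr {T S : ℝ → Op} {C : ℝ} {P : Prop} (hT : KernelLimit T C P)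
    (h : T =ᶠ[𝓝[>] 0] S) : KernelLimit S C P := by
  obtain ⟨κ, h1, h2, h3⟩ := hT
  refine ⟨κ, fun n m => (h1 n m).congr' (h.mono fun μ hμ => by rw [hμ]), ?_, fun hP => ?_⟩
  · filter_upwards [h2, h] with μ hμ hμ' n m
    rw [← hμ']; exact hμ n m
  · obtain ⟨K, hK⟩ := h3 hP
    refine ⟨K, ?_⟩
    filter_upwards [hK, h] with μ hμ hμ' n m
    rw [← hμ']; exact hμ n m

/-- Powers of z and w are at most 1 in modulus, so the entries inherit the bound of B without any
loss, at the band edges as well. -/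
theorem kernelLimit_core (huv : u ≤ v) {z w : ℝ → ℂ} {z₀ w₀ : ℂ}
    (hz : Tendsto z (𝓝[>] 0) (𝓝 z₀)) (hw : Tendsto w (𝓝[>] 0) (𝓝 w₀))
    (hz1 : ∀ μ, 0 < μ → ‖z μ‖ < 1) (hw1 : ∀ μ, 0 < μ → ‖w μ‖ < 1)
    {B : ℝ → Op} {B₀ : Op} {b : ℝ} (hB : Tendsto B (𝓝[>] 0) (𝓝 B₀)) (hb0 : 0 ≤ b)
    (hb : ∀ μ, 0 < μ → ‖B μ‖ ≤ b) (P : Prop) :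
    KernelLimit (fun μ => Ring.inverse (1 - z μ • outward u v) * (core u v * B μ * core u v) *
      Ring.inverse (1 - w μ • inward u v)) b P := by
  have key : ∀ᶠ μ in 𝓝[>] (0 : ℝ), ∀ n m,
      ‖kernel (Ring.inverse (1 - z μ • outward u v) * (core u v * B μ * core u v) *
        Ring.inverse (1 - w μ • inward u v)) n m‖ ≤ b := by
    filter_upwards [self_mem_nhdsWithin] with μ hμ n m
    rw [kernel_factored_core huv (hz1 μ hμ) (hw1 μ hμ), norm_mul, norm_mul, norm_pow, norm_pow]
    have h1 := pow_le_one₀ (norm_nonneg (z μ)) (hz1 μ hμ).le (n := depth u v n)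
    have h2 := pow_le_one₀ (norm_nonneg (w μ)) (hw1 μ hμ).le (n := depth u v m)
    have h3 := (norm_kernel_le (B μ) (foot u v n) (foot u v m)).trans (hb μ hμ)
    refine (mul_le_of_le_one_left (by positivity) h1).trans ?_
    exact (mul_le_of_le_one_left (by positivity) h2).trans h3
  refine ⟨fun n m => z₀ ^ depth u v n * (w₀ ^ depth u v m * kernel B₀ (foot u v n) (foot u v m)),
    fun n m => ?_, ?_, fun _ => ⟨b, key⟩⟩
  · have h : Tendsto (fun μ => z μ ^ depth u v n *
        (w μ ^ depth u v m * kernel (B μ) (foot u v n) (foot u v m))) (𝓝[>] 0)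
        (𝓝 (z₀ ^ depth u v n * (w₀ ^ depth u v m * kernel B₀ (foot u v n) (foot u v m)))) :=
      (hz.pow _).mul ((hw.pow _).mul (((continuous_kernel _ _).tendsto B₀).comp hB))
    refine h.congr' ?_
    filter_upwards [self_mem_nhdsWithin] with μ hμ
    rw [kernel_factored_core huv (hz1 μ hμ) (hw1 μ hμ)]
  · filter_upwards [key] with μ hμ n m
    exact (hμ n m).trans (le_mul_of_one_le_right hb0 (one_le_weight zero_le_one m))

theorem depth_le_weight (n : ℤ) : (depth u v n : ℝ) ≤ 2 * (1 + |(u : ℝ)| + |(v : ℝ)|) * weight 1 n := by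
  have h1 : (depth u v n : ℤ) ≤ 2 * |n| + |u| + |v| := by
    unfold depth
    rcases abs_cases n with h | h <;> rcases abs_cases u with h' | h' <;>
      rcases abs_cases v with h'' | h'' <;> omega
  have h2 : (depth u v n : ℝ) ≤ 2 * |(n : ℝ)| + |(u : ℝ)| + |(v : ℝ)| := by exact_mod_cast h1
  have h3 : |(n : ℝ)| ≤ weight 1 n := by
    rw [weight, ← Real.sqrt_eq_rpow]
    exact Real.abs_le_sqrt (by linarith)
  have h4 := one_le_weight zero_le_one n
  nlinarith [abs_nonneg (u : ℝ), abs_nonneg (v : ℝ)]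

/-- The bound by depth holds always; if z₀² ≠ 1, then |z² - 1| is eventually at least half its limit
and the geometric bound is uniform. -/
theorem kernelLimit_outer (huv : u ≤ v) {z : ℝ → ℂ} {z₀ : ℂ}
    (hz : Tendsto z (𝓝[>] 0) (𝓝 z₀)) (hz1 : ∀ μ, 0 < μ → ‖z μ‖ < 1)
    {P : Prop} (hP : P → z₀ ^ 2 ≠ 1) {c : ℂ} {b : ℝ} (hc : ‖c‖ ≤ b) :
    KernelLimit (fun μ => (c * z μ) • (Ring.inverse (1 - z μ • outward u v) * (1 - core u v) *
      Ring.inverse (1 - z μ • inward u v))) (b * (2 * (1 + |(u : ℝ)| + |(v : ℝ)|))) P := by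
  have hk : ∀ μ, 0 < μ → ∀ n m, kernel ((c * z μ) • (Ring.inverse (1 - z μ • outward u v) *
      (1 - core u v) * Ring.inverse (1 - z μ • inward u v))) n m =
      (c * z μ) * green u v (z μ) n m := fun μ hμ n m => by
    rw [← kernel_factored_outer huv (hz1 μ hμ)]; rfl
  have hcz : ∀ μ, 0 < μ → ‖c * z μ‖ ≤ b := fun μ hμ => by
    rw [norm_mul]
    exact (mul_le_of_le_one_right (norm_nonneg _) (hz1 μ hμ).le).trans hc
  have hb : 0 ≤ b := (norm_nonneg c).trans hc
  refine ⟨fun n m => (c * z₀) * green u v z₀ n m, fun n m => ?_, ?_, fun hPt => ?_⟩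
  · have h : Tendsto (fun μ => (c * z μ) * green u v (z μ) n m) (𝓝[>] 0)
        (𝓝 ((c * z₀) * green u v z₀ n m)) :=
      (hz.const_mul c).mul (((continuous_green n m).tendsto z₀).comp hz)
    refine h.congr' ?_
    filter_upwards [self_mem_nhdsWithin] with μ hμ
    rw [hk μ hμ]
  · filter_upwards [self_mem_nhdsWithin] with μ hμ n m
    rw [hk μ hμ, norm_mul, mul_assoc]
    exact mul_le_mul (hcz μ hμ)
      ((norm_green_le_depth huv (hz1 μ hμ).le n m).trans (depth_le_weight m)) (norm_nonneg _) hb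
  · have h0 : 0 < ‖z₀ ^ 2 - 1‖ := norm_pos_iff.mpr (sub_ne_zero.mpr (hP hPt))
    have h1 : ∀ᶠ μ in 𝓝[>] (0 : ℝ), ‖z₀ ^ 2 - 1‖ / 2 < ‖z μ ^ 2 - 1‖ :=
      ((hz.pow 2).sub_const 1).norm.eventually_const_lt (by linarith)
    refine ⟨b * (2 / (‖z₀ ^ 2 - 1‖ / 2)), ?_⟩
    filter_upwards [self_mem_nhdsWithin, h1] with μ hμ hμ' n m
    rw [hk μ hμ, norm_mul]
    have hne : z μ ^ 2 ≠ 1 := fun h => by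
      rw [h, sub_self, norm_zero] at hμ'; linarith
    refine mul_le_mul (hcz μ hμ) ((norm_green_le huv (hz1 μ hμ).le hne n m).trans ?_)
      (norm_nonneg _) hb
    gcongr

/-- The roots `z` that belong to the approximations of a real number `l ≥ -4`. -/
theorem exists_root_family {l τ ε : ℝ} (hl : -4 ≤ l) (hτ : |τ| = 1) (hε : 0 < ε) :
    ∃ (z : ℝ → ℂ) (z₀ : ℂ), Tendsto z (𝓝[>] 0) (𝓝 z₀) ∧ ‖z₀‖ ≤ 1 ∧
      (l ≠ 0 → l ≠ -4 → z₀ ^ 2 ≠ 1) ∧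
      ∀ μ : ℝ, 0 < μ → z μ ≠ 0 ∧ ‖z μ‖ < 1 ∧
        ε * (z μ + (z μ)⁻¹ - 2) = ε * l - Complex.I * (τ * μ) := by
  have hε' : (ε : ℂ) ≠ 0 := by exact_mod_cast hε.ne'
  have hex : ∀ μ : ℝ, ∃ z : ℂ, 0 < μ → z ≠ 0 ∧ ‖z‖ < 1 ∧
      z + z⁻¹ - 2 = l - Complex.I * (τ * (μ / ε : ℝ)) := fun μ => by
    by_cases hμ : 0 < μ
    · obtain ⟨z, hz⟩ := exists_root_norm_lt_one (l := l - Complex.I * (τ * (μ / ε : ℝ)))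
        fun x _ h => by
          have := congrArg Complex.im h
          simp only [Complex.sub_im, Complex.ofReal_im, Complex.mul_im, Complex.I_re,
            Complex.I_im, Complex.mul_re, Complex.ofReal_re] at this
          have h2 : τ * (μ / ε) = 0 := by linarith
          rcases mul_eq_zero.mp h2 with h3 | h3
          · rw [h3, abs_zero] at hτ; exact zero_ne_one hτ
          · have : 0 < μ / ε := by positivity
            linarith
      exact ⟨z, fun _ => hz⟩
    -- A default value: only positive μ matter.
    · exact ⟨0, fun h => absurd h hμ⟩
  choose z hz using hex
  obtain ⟨z₀, h1, h2, h3⟩ := exists_boundary_root hl hτ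
  refine ⟨z, z₀, ?_, h1, h2, fun μ hμ => ⟨(hz μ hμ).1, (hz μ hμ).2.1, ?_⟩⟩
  · rw [tendsto_iff_norm_sub_tendsto_zero]
    have h4 : Tendsto (fun μ : ℝ => √(μ / ε)) (𝓝[>] 0) (𝓝 0) := by
      have : Tendsto (fun μ : ℝ => √(μ / ε)) (𝓝 0) (𝓝 (√(0 / ε))) :=
        (Real.continuous_sqrt.comp (continuous_id.div_const ε)).tendsto 0
      rw [zero_div, Real.sqrt_zero] at this
      exact this.mono_left nhdsWithin_le_nhds
    refine tendsto_of_tendsto_of_tendsto_of_le_of_le' tendsto_const_nhds h4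
      (Eventually.of_forall fun _ => norm_nonneg _) ?_
    filter_upwards [self_mem_nhdsWithin] with μ hμ
    obtain ⟨e1, e2, e3⟩ := hz μ hμ
    exact Real.le_sqrt_of_sq_le (h3 (μ / ε) (div_pos hμ hε) (z μ) e1 e2 e3)
  · rw [(hz μ hμ).2.2]
    push_cast
    field_simp

/-- The bound for the kernels of the boundary values. -/
def kernelBound (u v : ℤ) (p : ℕ) (δ : ℝ) : ℝ :=
  2 * (1 + |(u : ℝ)| + |(v : ℝ)|) + 2 * coreBound p δ

theorem kernelBound_pos (p : ℕ) {δ : ℝ} (hδ : 0 < δ) : 0 < kernelBound u v p δ := by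
  have := coreBound_pos p hδ
  unfold kernelBound; positivity

theorem continuous_blk : Continuous fun x : Op × Op × Op × Op => blk x.1 x.2.1 x.2.2.1 x.2.2.2 := by
  have : (fun x : Op × Op × Op × Op => blk x.1 x.2.1 x.2.2.1 x.2.2.2) = fun x =>
      (ContinuousLinearMap.inl ℂ (Slp 2) (Slp 2)).comp
        (x.1.comp (.fst ℂ _ _) + x.2.1.comp (.snd ℂ _ _)) +
      (ContinuousLinearMap.inr ℂ (Slp 2) (Slp 2)).comp
        (x.2.2.1.comp (.fst ℂ _ _) + x.2.2.2.comp (.snd ℂ _ _)) := by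
    funext x
    refine ContinuousLinearMap.ext fun h => ?_
    change _ = (x.1 h.1 + x.2.1 h.2, (0 : Slp 2)) + ((0 : Slp 2), x.2.2.1 h.1 + x.2.2.2 h.2)
    rw [Prod.mk_add_mk, add_zero, zero_add]
    rfl
  rw [this]
  fun_prop

theorem continuous_coreOp (p : ℕ) (ε : ℝ) :
    Continuous fun x : ℂ × ℂ × ℂ => coreOp u v p ε x.1 x.2.1 x.2.2 := by
  unfold coreOp coreLimit
  refine Continuous.fun_add ?_ (continuous_const.fun_smul ?_)
  · exact continuous_blk.comp (f := fun x : ℂ × ℂ × ℂ => (1 - core u v + (-p - x.1) • core u v,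
      -((p : ℂ) • core u v), (p : ℂ) • core u v, 1 - core u v + (p - x.1) • core u v))
      (by fun_prop)
  · unfold coreCorrection
    exact continuous_blk.comp (f := fun x : ℂ × ℂ × ℂ =>
      ((2 : ℂ) • core u v - x.2.1 • ends u v - coreHop u v, (0 : Op), (0 : Op),
        -((2 : ℂ) • core u v - x.2.2 • ends u v - coreHop u v))) (by fun_prop)

theorem tendsto_inverse_coreOp {ι : Type*} {l : Filter ι} {p : ℕ} {ε : ℝ} {Ω z w : ι → ℂ}
    {Ω₀ z₀ w₀ : ℂ} (hN : IsUnit (coreOp u v p ε Ω₀ z₀ w₀)) (hΩ : Tendsto Ω l (𝓝 Ω₀))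
    (hz : Tendsto z l (𝓝 z₀)) (hw : Tendsto w l (𝓝 w₀)) :
    Tendsto (fun i => Ring.inverse (coreOp u v p ε (Ω i) (z i) (w i))) l
      (𝓝 (Ring.inverse (coreOp u v p ε Ω₀ z₀ w₀))) := by
  obtain ⟨e, he⟩ := hN
  have hinv : ContinuousAt Ring.inverse (coreOp u v p ε Ω₀ z₀ w₀) := by
    rw [← he]; exact NormedRing.inverse_continuousAt e
  have h := ((continuous_coreOp (u := u) (v := v) p ε).tendsto (Ω₀, z₀, w₀)).comp
    (hΩ.prodMk_nhds (hz.prodMk_nhds hw))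
  exact hinv.tendsto.comp h

/-- On the bands |Ω| ≥ 1 ≥ δ, so the core operator is invertible at the limiting values of z and w
too, and its inverse converges in norm. The exterior part enters only the diagonal blocks. -/
theorem kernelLimit_resolv (huv : u ≤ v) (p : ℕ) {δ ε : ℝ} (hδ : 0 < δ) (hδ1 : δ ≤ 1)
    (hε : 0 < ε) (hε1 : ε ≤ 1) (hεδ : ε ≤ (24 * coreBound p δ)⁻¹) {Ω τ : ℝ} (hτ : |τ| = 1)
    (hΩ : Ω ∈ bands ε) {P : Prop}
    (hP : P → Ω ≠ 1 ∧ Ω ≠ 1 + 4 * ε ∧ Ω ≠ -1 ∧ Ω ≠ -1 - 4 * ε) :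
    let R := fun μ : ℝ => resolv (opL (Finset.Icc u v) p ε) (Ω + Complex.I * (τ * μ))
    KernelLimit (fun μ => ent11 (R μ)) (kernelBound u v p δ * ε⁻¹) P ∧
    KernelLimit (fun μ => ent12 (R μ)) (kernelBound u v p δ * ε⁻¹) P ∧
    KernelLimit (fun μ => ent21 (R μ)) (kernelBound u v p δ * ε⁻¹) P ∧
    KernelLimit (fun μ => ent22 (R μ)) (kernelBound u v p δ * ε⁻¹) P := by
  intro R
  have hbounds : -4 ≤ (1 - Ω) / ε ∧ -4 ≤ (1 + Ω) / ε ∧ 1 ≤ |Ω| := by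
    rw [le_div_iff₀ hε, le_div_iff₀ hε, le_abs]
    rcases hΩ with ⟨h1, h2⟩ | ⟨h1, h2⟩
    · exact ⟨by linarith, by linarith, Or.inl h1⟩
    · exact ⟨by linarith, by linarith, Or.inr (by linarith)⟩
  obtain ⟨hl1, hl2, hΩ1⟩ := hbounds
  have hεC : (ε : ℂ) ≠ 0 := by exact_mod_cast hε.ne'
  obtain ⟨z, z₀, hzt, hz01, hzP, hz⟩ := exists_root_family hl1 hτ hε
  -- The sign flips because w depends on 1 + Ω, whereas z depends on 1 - Ω.
  obtain ⟨w, w₀, hwt, hw01, hwP, hw⟩ := exists_root_family hl2 (τ := -τ) (by rwa [abs_neg]) hε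
  have hzP' : P → z₀ ^ 2 ≠ 1 := fun h => by
    obtain ⟨a1, a2, a3, a4⟩ := hP h
    refine hzP (fun h0 => ?_) (fun h0 => ?_)
    · rw [div_eq_iff hε.ne'] at h0; exact a1 (by linarith)
    · rw [div_eq_iff hε.ne'] at h0; exact a2 (by linarith)
  have hwP' : P → w₀ ^ 2 ≠ 1 := fun h => by
    obtain ⟨a1, a2, a3, a4⟩ := hP h
    refine hwP (fun h0 => ?_) (fun h0 => ?_)
    · rw [div_eq_iff hε.ne'] at h0; exact a3 (by linarith)
    · rw [div_eq_iff hε.ne'] at h0; exact a4 (by linarith)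
  have hΩμ : ∀ μ : ℝ, δ ≤ ‖(Ω + Complex.I * (τ * μ) : ℂ)‖ := fun μ => by
    have h1 := Complex.abs_re_le_norm (Ω + Complex.I * (τ * μ) : ℂ)
    have h2 : (Ω + Complex.I * (τ * μ) : ℂ).re = Ω := by simp
    rw [h2] at h1
    linarith
  have hunit : ∀ μ : ℝ, 0 < μ → _ := fun μ hμ =>
    isUnit_coreOp (u := u) (v := v) p hδ hε.le hεδ (hΩμ μ) (hz μ hμ).2.1.le (hw μ hμ).2.1.le
  have hunit0 := isUnit_coreOp (u := u) (v := v) p hδ hε.le hεδ (hΩμ 0) hz01 hw01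
  set N : ℝ → PairOp := fun μ =>
    Ring.inverse (coreOp u v p ε (Ω + Complex.I * (τ * μ)) (z μ) (w μ)) with hN
  have hNt : Tendsto N (𝓝[>] 0)
      (𝓝 (Ring.inverse (coreOp u v p ε (Ω + Complex.I * (τ * (0 : ℝ))) z₀ w₀))) := by
    have hΩt : Tendsto (fun μ : ℝ => (Ω + Complex.I * (τ * μ) : ℂ)) (𝓝[>] 0)
        (𝓝 (Ω + Complex.I * (τ * (0 : ℝ)))) :=
      ((by fun_prop : Continuous fun μ : ℝ => (Ω + Complex.I * (τ * μ) : ℂ)).tendsto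
        0).mono_left nhdsWithin_le_nhds
    exact tendsto_inverse_coreOp hunit0.1 hΩt hzt hwt
  have hNb : ∀ μ, 0 < μ → ‖N μ‖ ≤ 2 * coreBound p δ := fun μ hμ => (hunit μ hμ).2
  have hb0 : 0 ≤ 2 * coreBound p δ := by linarith [coreBound_pos p hδ]
  have hR : ∀ μ : ℝ, 0 < μ → _ := fun μ hμ =>
    resolv_opL_eq_blk huv (p := p) (ε := ε) (Ω := Ω + Complex.I * (τ * μ)) hε.ne' (hz μ hμ).1
      (hw μ hμ).1 (hz μ hμ).2.1 (hw μ hμ).2.1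
      (by rw [(hz μ hμ).2.2]; push_cast; field_simp; ring)
      (by rw [(hw μ hμ).2.2]; push_cast; field_simp; ring) (hunit μ hμ).1
  have hz1 : ∀ μ, 0 < μ → ‖z μ‖ < 1 := fun μ hμ => (hz μ hμ).2.1
  have hw1 : ∀ μ, 0 < μ → ‖w μ‖ < 1 := fun μ hμ => (hw μ hμ).2.1
  have hεinv : 1 ≤ ε⁻¹ := (one_le_inv₀ hε).mpr hε1
  have hcε : ‖(ε : ℂ)⁻¹‖ ≤ ε⁻¹ := by rw [norm_inv, Complex.norm_real, Real.norm_of_nonneg hε.le]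
  have hcε' : ‖-(ε : ℂ)⁻¹‖ ≤ ε⁻¹ := by rw [norm_neg]; exact hcε
  have hle1 : 2 * coreBound p δ ≤ kernelBound u v p δ * ε⁻¹ := by
    refine le_trans ?_ (le_mul_of_one_le_right (kernelBound_pos p hδ).le hεinv)
    unfold kernelBound
    linarith [abs_nonneg (u : ℝ), abs_nonneg (v : ℝ)]
  have hle2 : ε⁻¹ * (2 * (1 + |(u : ℝ)| + |(v : ℝ)|)) + 2 * coreBound p δ ≤
      kernelBound u v p δ * ε⁻¹ := by
    unfold kernelBound
    nlinarith
  obtain ⟨c11, c12, c21, c22⟩ := continuous_ent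
  have hev : ∀ {T : ℝ → Op} {S : ℝ → Op}, (∀ μ, 0 < μ → T μ = S μ) → T =ᶠ[𝓝[>] 0] S :=
    fun h => by filter_upwards [self_mem_nhdsWithin] with μ hμ using h μ hμ
  refine ⟨?_, ?_, ?_, ?_⟩
  · refine (((kernelLimit_outer huv hzt hz1 hzP' hcε).add (kernelLimit_core huv hzt hzt hz1 hz1
      ((c11.tendsto _).comp hNt) hb0 (fun μ hμ => (norm_ent_le _).1.trans (hNb μ hμ)) P)).mono
      hle2).congr (hev fun μ hμ => ?_)
    simp only [R]
    rw [hR μ hμ, (ent_blk _ _ _ _).1, inv_mul_eq_div]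
    rfl
  · refine ((kernelLimit_core huv hzt hwt hz1 hw1
      ((c12.tendsto _).comp hNt) hb0 (fun μ hμ => (norm_ent_le _).2.1.trans (hNb μ hμ)) P).mono
      hle1).congr (hev fun μ hμ => ?_)
    simp only [R]
    rw [hR μ hμ, (ent_blk _ _ _ _).2.1]
    rfl
  · refine ((kernelLimit_core huv hwt hzt hw1 hz1
      ((c21.tendsto _).comp hNt) hb0 (fun μ hμ => (norm_ent_le _).2.2.1.trans (hNb μ hμ)) P).mono
      hle1).congr (hev fun μ hμ => ?_)
    simp only [R]
    rw [hR μ hμ, (ent_blk _ _ _ _).2.2.1]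
    rfl
  · refine (((kernelLimit_outer huv hwt hw1 hwP' hcε').add (kernelLimit_core huv hwt hwt hw1 hw1
      ((c22.tendsto _).comp hNt) hb0 (fun μ hμ => (norm_ent_le _).2.2.2.trans (hNb μ hμ)) P)).mono
      hle2).congr (hev fun μ hμ => ?_)
    simp only [R]
    rw [hR μ hμ, (ent_blk _ _ _ _).2.2.2, neg_mul, inv_mul_eq_div]
    rfl

/-! ### The boundary values of the resolvent -/

theorem exists_isBoundaryValue {L : PairOp} {τ Ω C : ℝ} (hC : 0 ≤ C) {P : Prop}
    (h11 : KernelLimit (fun μ : ℝ => ent11 (resolv L (Ω + Complex.I * (τ * μ)))) C P)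
    (h12 : KernelLimit (fun μ : ℝ => ent12 (resolv L (Ω + Complex.I * (τ * μ)))) C P)
    (h21 : KernelLimit (fun μ : ℝ => ent21 (resolv L (Ω + Complex.I * (τ * μ)))) C P)
    (h22 : KernelLimit (fun μ : ℝ => ent22 (resolv L (Ω + Complex.I * (τ * μ)))) C P) :
    ∃ B : PairW 1 1 →L[ℂ] Pair ∞, IsBoundaryValue L τ Ω B ∧ ‖B‖ ≤ 2 * C := by
  obtain ⟨_, k11, b11, -⟩ := h11
  obtain ⟨_, k12, b12, -⟩ := h12
  obtain ⟨_, k21, b21, -⟩ := h21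
  obtain ⟨_, k22, b22, -⟩ := h22
  obtain ⟨B11, n11, B11h⟩ := exists_boundaryValue hC b11 k11
  obtain ⟨B12, n12, B12h⟩ := exists_boundaryValue hC b12 k12
  obtain ⟨B21, n21, B21h⟩ := exists_boundaryValue hC b21 k21
  obtain ⟨B22, n22, B22h⟩ := exists_boundaryValue hC b22 k22
  refine ⟨(B11.coprod B12).prod (B21.coprod B22), fun h σ hσ => ?_, ?_⟩
  · obtain ⟨u11, c11, t11⟩ := B11h h.1 σ hσ
    obtain ⟨u12, c12, t12⟩ := B12h h.2 σ hσ
    obtain ⟨u21, c21, t21⟩ := B21h h.1 σ hσ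
    obtain ⟨u22, c22, t22⟩ := B22h h.2 σ hσ
    refine ⟨(u11 + u12, u21 + u22), fun n => ⟨?_, ?_⟩, ?_⟩
    · change u11.coord n + u12.coord n = B11 h.1 n + B12 h.2 n
      rw [c11, c12]
    · change u21.coord n + u22.coord n = B21 h.1 n + B22 h.2 n
      rw [c21, c22]
    · refine ((t11.add t12).prodMk_nhds (t21.add t22)).congr fun μ => ?_
      conv_rhs => rw [← blk_ent (resolv L (Ω + Complex.I * (τ * μ)))]
      rw [← map_add, ← map_add]
      rfl
  · refine ContinuousLinearMap.opNorm_le_bound _ (by positivity) fun h => ?_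
    have key : ∀ S T : Wlp 1 1 →L[ℂ] Slp ∞, ‖S‖ ≤ C → ‖T‖ ≤ C → ‖S h.1 + T h.2‖ ≤ 2 * C * ‖h‖ :=
      fun S T hS hT => by
        calc ‖S h.1 + T h.2‖ ≤ C * ‖h.1‖ + C * ‖h.2‖ :=
              (norm_add_le _ _).trans (add_le_add (S.le_of_opNorm_le hS _) (T.le_of_opNorm_le hT _))
          _ ≤ C * ‖h‖ + C * ‖h‖ := by
              gcongr
              · exact norm_fst_le h
              · exact norm_snd_le h
          _ = _ := by ring
    exact max_le (key B11 B12 n11 n12) (key B21 B22 n21 n22)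

theorem hasWeightedLimit_of_kernelLimit {L : PairOp} {τ Ω C : ℝ} {P : Prop} (hP : P)
    (h11 : KernelLimit (fun μ : ℝ => ent11 (resolv L (Ω + Complex.I * (τ * μ)))) C P)
    (h12 : KernelLimit (fun μ : ℝ => ent12 (resolv L (Ω + Complex.I * (τ * μ)))) C P)
    (h21 : KernelLimit (fun μ : ℝ => ent21 (resolv L (Ω + Complex.I * (τ * μ)))) C P)
    (h22 : KernelLimit (fun μ : ℝ => ent22 (resolv L (Ω + Complex.I * (τ * μ)))) C P) :
    HasWeightedLimit L τ Ω := by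
  intro σ hσ
  obtain ⟨_, k11, -, b11⟩ := h11
  obtain ⟨_, k12, -, b12⟩ := h12
  obtain ⟨_, k21, -, b21⟩ := h21
  obtain ⟨_, k22, -, b22⟩ := h22
  obtain ⟨S11, t11⟩ := exists_weighted_limit (b11 hP).choose_spec k11 hσ
  obtain ⟨S12, t12⟩ := exists_weighted_limit (b12 hP).choose_spec k12 hσ
  obtain ⟨S21, t21⟩ := exists_weighted_limit (b21 hP).choose_spec k21 hσ
  obtain ⟨S22, t22⟩ := exists_weighted_limit (b22 hP).choose_spec k22 hσ
  let Φ : (Wlp 2 σ →L[ℂ] Wlp 2 (-σ)) × (Wlp 2 σ →L[ℂ] Wlp 2 (-σ)) ×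
      (Wlp 2 σ →L[ℂ] Wlp 2 (-σ)) × (Wlp 2 σ →L[ℂ] Wlp 2 (-σ)) → (PairW 2 σ →L[ℂ] PairW 2 (-σ)) :=
    fun x =>
      (ContinuousLinearMap.inl ℂ (Wlp 2 (-σ)) (Wlp 2 (-σ))).comp
        (x.1.comp (.fst ℂ _ _) + x.2.1.comp (.snd ℂ _ _)) +
      (ContinuousLinearMap.inr ℂ (Wlp 2 (-σ)) (Wlp 2 (-σ))).comp
        (x.2.2.1.comp (.fst ℂ _ _) + x.2.2.2.comp (.snd ℂ _ _))
  have hΦ : Continuous Φ := by fun_prop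
  refine ⟨Φ (S11, S12, S21, S22), ((hΦ.tendsto _).comp
    (t11.prodMk_nhds (t12.prodMk_nhds (t21.prodMk_nhds t22)))).congr fun μ => ?_⟩
  refine ContinuousLinearMap.ext fun h => ?_
  conv_rhs => rw [← blk_ent (resolv L (Ω + Complex.I * (τ * μ)))]
  simp only [Function.comp_apply, Φ]
  refine Prod.ext ?_ ?_
  · change (_ + _ : Wlp 2 (-σ)) + 0 = inclS 2 (neg_nonpos.mpr (by linarith : 0 ≤ σ)) (_ + _)
    rw [map_add, add_zero]
    rfl
  · change 0 + (_ + _ : Wlp 2 (-σ)) = inclS 2 (neg_nonpos.mpr (by linarith : 0 ≤ σ)) (_ + _)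
    rw [map_add, zero_add]
    rfl

theorem ne_of_mem_interior_bands {ε Ω : ℝ} (hε : 0 < ε) (hε1 : ε ≤ 1 / 4)
    (hΩ : Ω ∈ interior (bands ε)) :
    Ω ≠ 1 ∧ Ω ≠ 1 + 4 * ε ∧ Ω ≠ -1 ∧ Ω ≠ -1 - 4 * ε := by
  obtain ⟨r, hr, hball⟩ := Metric.mem_nhds_iff.mp (mem_interior_iff_mem_nhds.mp hΩ)
  have key : ∀ s : ℝ, |s| < r → Ω + s ∈ bands ε := fun s hs =>
    hball (by rwa [Metric.mem_ball, Real.dist_eq, add_sub_cancel_left])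
  -- The cap 1/2 keeps a step from one band from reaching the other one.
  set t := min (r / 2) (1 / 2) with ht
  have ht0 : 0 < t := by positivity
  have htr : t < r := (min_le_left _ _).trans_lt (by linarith)
  have ht1 : t ≤ 1 / 2 := min_le_right _ _
  have h1 := key t (by rwa [abs_of_pos ht0])
  have h2 := key (-t) (by rwa [abs_neg, abs_of_pos ht0])
  simp only [bands, Set.mem_union, Set.mem_Icc] at h1 h2
  refine ⟨?_, ?_, ?_, ?_⟩ <;> intro h <;> subst h
  · rcases h2 with h2 | h2 <;> linarith [h2.1, h2.2]
  · rcases h1 with h1 | h1 <;> linarith [h1.1, h1.2]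
  · rcases h1 with h1 | h1 <;> linarith [h1.1, h1.2]
  · rcases h2 with h2 | h2 <;> linarith [h2.1, h2.2]

theorem boundary_values_opL (huv : u ≤ v) (p : ℕ) {δ ε : ℝ} (hδ : 0 < δ) (hδ1 : δ ≤ 1)
    (hε : 0 < ε) (hε1 : ε ≤ 1 / 4) (hεδ : ε ≤ (24 * coreBound p δ)⁻¹) {Ω τ : ℝ} (hτ : |τ| = 1)
    (hΩ : Ω ∈ bands ε) :
    (∃ B : PairW 1 1 →L[ℂ] Pair ∞, IsBoundaryValue (opL (Finset.Icc u v) p ε) τ Ω B ∧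
      ‖B‖ ≤ 2 * kernelBound u v p δ * ε⁻¹) ∧
    (Ω ∈ interior (bands ε) → HasWeightedLimit (opL (Finset.Icc u v) p ε) τ Ω) := by
  obtain ⟨h11, h12, h21, h22⟩ := kernelLimit_resolv huv p hδ hδ1 hε (by linarith) hεδ hτ hΩ
    (P := Ω ∈ interior (bands ε)) (ne_of_mem_interior_bands hε hε1)
  have hC : 0 ≤ kernelBound u v p δ * ε⁻¹ :=
    mul_nonneg (kernelBound_pos p hδ).le (inv_nonneg.mpr hε.le)
  refine ⟨?_, fun hP => hasWeightedLimit_of_kernelLimit hP h11 h12 h21 h22⟩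
  obtain ⟨B, h1, h2⟩ := exists_isBoundaryValue hC h11 h12 h21 h22
  exact ⟨B, h1, by rwa [mul_assoc]⟩

end BoundaryValues

section InvariantSubspace

/-! ### Poles of the resolvent and finite-dimensional invariant subspaces -/

open Polynomial in
/-- The quotient `(χ(A) - χ(x)) / (A - x)`. -/
def divDiff {R : Type*} [Ring R] [Algebra ℂ R] (χ : ℂ[X]) (A : R) (x : ℂ) : R :=
  ∑ k ∈ Finset.range (χ.natDegree + 1),
    χ.coeff k • ∑ i ∈ Finset.range k, A ^ i * (algebraMap ℂ R x) ^ (k - 1 - i)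

-- Multiplying out gives A^k - x^k for each monomial. The truncated exponent k - 1 - i is harmless,
-- since i < k in the sum. Combined with Cayley–Hamilton, this yields a polynomial formula for the
-- adjugate of A - x.
open Polynomial in
theorem sub_mul_divDiff {R : Type*} [Ring R] [Algebra ℂ R] (χ : ℂ[X]) (A : R) (x : ℂ) :
    (A - x • 1) * divDiff χ A x = aeval A χ - χ.eval x • 1 := by
  have h : ∀ k, (A - x • 1) * ∑ i ∈ Finset.range k, A ^ i * (algebraMap ℂ R x) ^ (k - 1 - i) =
      A ^ k - x ^ k • 1 := fun k => by
    rw [← Algebra.algebraMap_eq_smul_one, ← Algebra.algebraMap_eq_smul_one, map_pow]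
    exact (Algebra.commute_algebraMap_right x A).mul_geom_sum₂ k
  rw [divDiff, Finset.mul_sum, aeval_eq_sum_range, eval_eq_sum_range, Finset.sum_smul,
    ← Finset.sum_sub_distrib]
  refine Finset.sum_congr rfl fun k _ => ?_
  rw [mul_smul_comm, h, smul_sub, smul_smul]

open Polynomial in
theorem divDiff_commute {R : Type*} [Ring R] [Algebra ℂ R] (χ : ℂ[X]) {A P : R}
    (h : Commute P A) (x : ℂ) : Commute P (divDiff χ A x) := by
  refine Commute.sum_right _ _ _ fun k _ => Commute.smul_right (Commute.sum_right _ _ _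
    fun i _ => (h.pow_right i).mul_right ?_) _
  exact (Algebra.commute_algebraMap_right x P).pow_right _

open Polynomial in
theorem differentiable_divDiff (χ : ℂ[X]) (A : PairOp) : Differentiable ℂ (divDiff χ A) := by
  have h : divDiff χ A = fun x => ∑ k ∈ Finset.range (χ.natDegree + 1),
      χ.coeff k • ∑ i ∈ Finset.range k, x ^ (k - 1 - i) • A ^ i := by
    funext x
    refine Finset.sum_congr rfl fun k _ => ?_
    congr 1
    refine Finset.sum_congr rfl fun i _ => ?_
    rw [← map_pow, Algebra.algebraMap_eq_smul_one, mul_smul_comm, mul_one]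
  rw [h]
  fun_prop

theorem finiteDimensional_of_le {G W : Submodule ℂ (Pair 2)} (hW : FiniteDimensional ℂ W)
    (h : G ≤ W) : FiniteDimensional ℂ G :=
  Module.Finite.of_injective (Submodule.inclusion h) (Submodule.inclusion_injective h)

theorem finrank_comap_subtype {K E : Type*} [Field K] [AddCommGroup E] [Module K E]
    {G W : Submodule K E} (h : G ≤ W) :
    Module.finrank K (G.comap W.subtype) = Module.finrank K G :=
  (Submodule.comapSubtypeEquivOfLe h).finrank_eq

variable {L P : PairOp}

theorem resolv_of_mul_eq_one {Ω : ℂ} {T : PairOp}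
    (h1 : (L - Ω • ContinuousLinearMap.id ℂ (Pair 2)) * T = 1)
    (h2 : T * (L - Ω • ContinuousLinearMap.id ℂ (Pair 2)) = 1) :
    IsRegular L Ω ∧ resolv L Ω = T :=
  ⟨⟨⟨_, T, h1, h2⟩, rfl⟩, Ring.inverse_unit (⟨_, T, h1, h2⟩ : PairOpˣ)⟩

/-- If the order is nonnegative, the resolvent has a limit, and the limit of the identities for the
inverse shows that it inverts L - Ω₀. -/
theorem isRegular_or_isPole {Ω₀ : ℂ} (hreg : ∀ᶠ Ω in 𝓝[≠] Ω₀, IsRegular L Ω)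
    (hmer : MeromorphicAt (resolv L) Ω₀) : IsRegular L Ω₀ ∨ IsPole L Ω₀ := by
  rcases lt_or_ge (meromorphicOrderAt (resolv L) Ω₀) 0 with h | h
  · exact Or.inr ⟨hreg, hmer, h⟩
  left
  obtain ⟨T, hT⟩ := tendsto_nhds_of_meromorphicOrderAt_nonneg hmer h
  have hX : Tendsto (fun Ω : ℂ => L - Ω • ContinuousLinearMap.id ℂ (Pair 2)) (𝓝[≠] Ω₀)
      (𝓝 (L - Ω₀ • ContinuousLinearMap.id ℂ (Pair 2))) :=
    ((by fun_prop : Continuous fun Ω : ℂ =>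
      L - Ω • ContinuousLinearMap.id ℂ (Pair 2)).tendsto Ω₀).mono_left nhdsWithin_le_nhds
  refine (resolv_of_mul_eq_one (T := T) ?_ ?_).1
  · refine tendsto_nhds_unique (hX.mul hT) (tendsto_const_nhds.congr' ?_)
    filter_upwards [hreg] with Ω hΩ using (Ring.mul_inverse_cancel _ hΩ).symm
  · refine tendsto_nhds_unique (hT.mul hX) (tendsto_const_nhds.congr' ?_)
    filter_upwards [hreg] with Ω hΩ using (Ring.inverse_mul_cancel _ hΩ).symm

theorem not_isRegular_of_isPole {Ω₀ : ℂ} (h : IsPole L Ω₀) : ¬IsRegular L Ω₀ := by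
  rintro ⟨e, he⟩
  have hc : ContinuousAt (resolv L) Ω₀ := by
    have h1 : ContinuousAt Ring.inverse (L - Ω₀ • ContinuousLinearMap.id ℂ (Pair 2)) := by
      rw [← he]; exact NormedRing.inverse_continuousAt e
    exact h1.comp (f := fun Ω : ℂ => L - Ω • ContinuousLinearMap.id ℂ (Pair 2))
      (by fun_prop : Continuous fun Ω : ℂ =>
        L - Ω • ContinuousLinearMap.id ℂ (Pair 2)).continuousAt
  have h2 := (tendsto_nhds_iff_meromorphicOrderAt_nonneg h.2.1).mp
    ⟨_, hc.tendsto.mono_left nhdsWithin_le_nhds⟩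
  exact absurd h.2.2 (not_lt.mpr h2)

/-- The block LU decomposition of an operator that leaves the range of P invariant; it separates the
complementary block from the block on the range. -/
theorem upper_triangular_factorization {R : Type*} [Ring R] {X P : R} (hP : P * P = P)
    (hinv : (1 - P) * X * P = 0) :
    X = (P + (1 - P) * X * (1 - P)) * (1 + P * X * (1 - P)) * ((1 - P) + P * X * P) := by
  set Q := 1 - P with hQ
  have hPQ : P * Q = 0 := by rw [hQ, mul_sub, mul_one, hP, sub_self]
  have hQP : Q * P = 0 := by rw [hQ, sub_mul, one_mul, hP, sub_self]
  have hQQ : Q * Q = Q := by rw [hQ, mul_sub, mul_one, ← hQ, hQP, sub_zero]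
  have hX : X = P * X * P + P * X * Q + Q * X * Q := by
    calc X = (P + Q) * X * (P + Q) := by rw [hQ]; simp
      _ = P * X * P + P * X * Q + Q * X * P + Q * X * Q := by noncomm_ring
      _ = _ := by rw [hinv, add_zero]
  have e1 : ∀ Y, P * (P * Y) = P * Y := fun Y => by rw [← mul_assoc, hP]
  have e3 : ∀ Y, Q * (P * Y) = 0 := fun Y => by rw [← mul_assoc, hQP, zero_mul]
  simp only [mul_assoc] at hX
  simp only [mul_add, add_mul, mul_one, mul_assoc, e1, e3, hPQ, hQQ, mul_zero, add_zero, zero_add]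
  conv_lhs => rw [hX]
  abel

open Polynomial in
theorem aeval_apply_of_mem {W : Submodule ℂ (Pair 2)} {A : PairOp}
    {f : Module.End ℂ W} (h : ∀ w : W, A w = f w) (χ : ℂ[X]) (w : W) :
    aeval A χ (w : Pair 2) = (aeval f χ w : W) := by
  have hpow : ∀ n (w : W), (A ^ n) (w : Pair 2) = ((f ^ n) w : W) := fun n => by
    induction n with
    | zero => intro w; rfl
    | succ n ih =>
      intro w
      rw [pow_succ, pow_succ]
      change (A ^ n) (A w) = _
      rw [h, ih]
      rfl
  induction χ using Polynomial.induction_on' with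
  | add p q hp hq =>
    rw [map_add, map_add]
    change aeval A p (w : Pair 2) + aeval A q (w : Pair 2) = _
    rw [hp, hq]
    rfl
  | monomial n c =>
    rw [aeval_monomial, aeval_monomial, ← Algebra.smul_def, ← Algebra.smul_def]
    change c • (A ^ n) (w : Pair 2) = _
    rw [hpow]
    rfl

/-- Let χ be the characteristic polynomial of L on the range W of P. In D the complementary block is
invertible, so the triangular factorization leaves 1/χ(Ω) as the only source of singularities. At a
root of χ an eigenvector in W obstructs regularity. The invertibility of the block on W outside D
puts all roots in D, and the multiplicities add up to deg χ = dim W. -/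
theorem hasExactlyPolesIn_of_invariant {D : Set ℂ} (hD : IsOpen D) (hP : P * P = P)
    (hfin : FiniteDimensional ℂ P.range)
    (hinv : (1 - P) * L * P = 0)
    (hb : ∀ Ω ∈ D, IsUnit (P + (1 - P) * (L - Ω • 1) * (1 - P)))
    (ha : ∀ Ω ∉ D, IsUnit ((1 - P) + P * (L - Ω • 1) * P)) :
    HasExactlyPolesIn L D (Module.finrank ℂ P.range) := by
  set W : Submodule ℂ (Pair 2) := P.range with hW
  have hPQ : P * (1 - P) = 0 := by rw [mul_sub, mul_one, hP, sub_self]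
  have hQP : (1 - P) * P = 0 := by rw [sub_mul, one_mul, hP, sub_self]
  have hQQ : (1 - P) * (1 - P) = 1 - P := by rw [mul_sub, mul_one, hQP, sub_zero]
  have hPw : ∀ w ∈ W, P w = w := by
    rintro _ ⟨x, rfl⟩
    exact DFunLike.congr_fun hP x
  have hLW : ∀ x ∈ W, (L : Pair 2 →ₗ[ℂ] Pair 2) x ∈ W := by
    intro x hx
    refine ⟨L x, ?_⟩
    have h1 := DFunLike.congr_fun hinv x
    have h2 : L (P x) - P (L (P x)) = 0 := h1
    rw [hPw x hx, sub_eq_zero] at h2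
    exact h2.symm
  set f : Module.End ℂ W := (L : Pair 2 →ₗ[ℂ] Pair 2).restrict hLW with hf
  set χ := f.charpoly with hχ
  have hχ0 : χ ≠ 0 := f.charpoly_monic.ne_zero
  set A : PairOp := P * L * P with hA
  have hAw : ∀ w : W, A w = f w := fun w => by
    change P (L (P w)) = L w
    rw [hPw w w.2]
    exact hPw _ (hLW w w.2)
  -- Cayley–Hamilton on W; the operator A itself acts on an infinite-dimensional space.
  have hχP : Polynomial.aeval A χ * P = 0 := by
    refine ContinuousLinearMap.ext fun x => ?_
    change Polynomial.aeval A χ (P x) = 0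
    have := aeval_apply_of_mem hAw χ ⟨P x, x, rfl⟩
    rw [LinearMap.aeval_self_charpoly] at this
    exact this
  have hcomm : Commute P A := by
    change P * (P * L * P) = P * L * P * P
    rw [mul_assoc _ P P, hP, ← mul_assoc, ← mul_assoc, hP]
  have hinvX : ∀ Ω : ℂ, (1 - P) * (L - Ω • 1) * P = 0 := fun Ω => by
    rw [mul_sub, sub_mul, hinv, mul_smul_comm, mul_one, smul_mul_assoc, hQP, smul_zero, sub_zero]
  have hfac := fun Ω : ℂ => upper_triangular_factorization hP (hinvX Ω)
  have hPXQ : ∀ Ω : ℂ, P * (L - Ω • 1) * (1 - P) = P * L * (1 - P) := fun Ω => by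
    rw [mul_sub P L, sub_mul (P * L), mul_smul_comm, mul_one, smul_mul_assoc, hPQ, smul_zero, sub_zero]
  have hPXP : ∀ Ω : ℂ, P * (L - Ω • 1) * P = (A - Ω • 1) * P := fun Ω => by
    rw [mul_sub, sub_mul, sub_mul, mul_smul_comm, mul_one, hA, mul_assoc _ P P, hP,
      smul_mul_assoc, smul_mul_assoc, one_mul, hP]
  have hC2 : P * L * (1 - P) * (P * L * (1 - P)) = 0 := by
    rw [mul_assoc, ← mul_assoc (1 - P), ← mul_assoc (1 - P), hQP, zero_mul, zero_mul, mul_zero]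
  set C : PairOp := P * L * (1 - P) with hC
  have hC1 : (1 + C) * (1 - C) = 1 := by
    rw [mul_sub, mul_one, add_mul, one_mul, hC2, add_zero, add_sub_cancel_right]
  have hC1' : (1 - C) * (1 + C) = 1 := by
    rw [mul_add, mul_one, sub_mul, one_mul, hC2, sub_zero, sub_add_cancel]
  have hq := fun Ω => divDiff_commute χ hcomm Ω
  have hqP : ∀ Ω, (A - Ω • 1) * (divDiff χ A Ω * P) = -(χ.eval Ω • P) := fun Ω => by
    rw [← mul_assoc, sub_mul_divDiff, sub_mul, hχP, zero_sub, smul_mul_assoc, one_mul]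
  have hqP' : ∀ Ω, (divDiff χ A Ω * P) * ((A - Ω • 1) * P) = -(χ.eval Ω • P) := fun Ω => by
    have hc1 : Commute A (divDiff χ A Ω) := divDiff_commute χ (Commute.refl A) Ω
    have hc2 : Commute (A - Ω • 1) (divDiff χ A Ω) :=
      hc1.sub_left ((Commute.one_left _).smul_left Ω)
    have hc3 : Commute P (A - Ω • 1) :=
      hcomm.sub_right ((Commute.one_right _).smul_right Ω)
    rw [← hc3.eq, mul_assoc, ← mul_assoc P P, hP, hc3.eq, ← mul_assoc, ← hc2.eq, mul_assoc, hqP]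
  have hainv : ∀ Ω, χ.eval Ω ≠ 0 →
      ((1 - P) + (A - Ω • 1) * P) * ((1 - P) - (χ.eval Ω)⁻¹ • (divDiff χ A Ω * P)) = 1 ∧
      ((1 - P) - (χ.eval Ω)⁻¹ • (divDiff χ A Ω * P)) * ((1 - P) + (A - Ω • 1) * P) = 1 :=
    fun Ω hΩ => by
    have h1 : (1 - P) * (divDiff χ A Ω * P) = 0 := by
      rw [← (hq Ω).eq, ← mul_assoc, hQP, zero_mul]
    have h2 : (A - Ω • 1) * P * (divDiff χ A Ω * P) = -(χ.eval Ω • P) := by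
      rw [mul_assoc, ← mul_assoc P, (hq Ω).eq, mul_assoc _ P P, hP, hqP]
    have h3 : (1 - P) * ((A - Ω • 1) * P) = 0 := by
      rw [← hPXP, ← mul_assoc, ← mul_assoc, hQP, zero_mul, zero_mul]
    have h4 := hqP' Ω
    generalize hQd : 1 - P = Q at h1 h3 hQQ hPQ ⊢
    constructor
    · rw [add_mul, mul_sub, mul_sub, hQQ, mul_smul_comm, mul_smul_comm, h1, h2, smul_zero,
        mul_assoc _ P, hPQ, mul_zero, smul_neg, smul_smul, inv_mul_cancel₀ hΩ, one_smul, ← hQd]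
      abel
    · rw [sub_mul, mul_add, mul_add, hQQ, smul_mul_assoc, smul_mul_assoc, h4, h3,
        mul_assoc _ P, hPQ, mul_zero, smul_zero, smul_neg, smul_smul, inv_mul_cancel₀ hΩ, one_smul,
        ← hQd]
      abel
  have hres : ∀ Ω ∈ D, χ.eval Ω ≠ 0 → IsRegular L Ω ∧ resolv L Ω =
      ((1 - P) - (χ.eval Ω)⁻¹ • (divDiff χ A Ω * P)) * (1 - C) *
        Ring.inverse (P + (1 - P) * (L - Ω • 1) * (1 - P)) := fun Ω hΩ hχΩ => by
    obtain ⟨a1, a2⟩ := hainv Ω hχΩ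
    have b1 := Ring.mul_inverse_cancel _ (hb Ω hΩ)
    have b2 := Ring.inverse_mul_cancel _ (hb Ω hΩ)
    set b := P + (1 - P) * (L - Ω • 1) * (1 - P)
    set a := (1 - P) + (A - Ω • 1) * P
    set a' := (1 - P) - (χ.eval Ω)⁻¹ • (divDiff χ A Ω * P)
    have hX : L - Ω • 1 = b * (1 + C) * a := by
      conv_lhs => rw [hfac Ω]
      rw [hPXQ, hPXP]
    refine resolv_of_mul_eq_one ?_ ?_
    · change (L - Ω • 1) * _ = 1
      rw [hX]
      calc b * (1 + C) * a * (a' * (1 - C) * Ring.inverse b)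
          = b * ((1 + C) * (a * a') * (1 - C)) * Ring.inverse b := by simp only [mul_assoc]
        _ = 1 := by rw [a1, mul_one, hC1, mul_one, b1]
    · change _ * (L - Ω • 1) = 1
      rw [hX]
      calc a' * (1 - C) * Ring.inverse b * (b * (1 + C) * a)
          = a' * ((1 - C) * (Ring.inverse b * b) * (1 + C)) * a := by simp only [mul_assoc]
        _ = 1 := by rw [b2, mul_one, hC1', mul_one, a2]
  have hroot : ∀ Ω, χ.eval Ω = 0 → ∃ w : Pair 2, w ≠ 0 ∧ w ∈ W ∧ L w = Ω • w := fun Ω hΩ => by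
    obtain ⟨w, hw⟩ :=
      ((Module.End.hasEigenvalue_iff_isRoot_charpoly f Ω).mpr hΩ).exists_hasEigenvector
    refine ⟨w, fun h => hw.2 (Subtype.ext h), w.2, ?_⟩
    exact congrArg Subtype.val hw.apply_eq_smul
  have hrootD : ∀ Ω, χ.eval Ω = 0 → Ω ∈ D := fun Ω hΩ => by
    by_contra hnot
    obtain ⟨w, hw0, hwW, hw⟩ := hroot Ω hΩ
    have h1 : ((1 - P) + P * (L - Ω • 1) * P) w = 0 := by
      change (w - P w) + P (L (P w) - Ω • P w) = 0
      rw [hPw w hwW, hw, sub_self, sub_self, map_zero, add_zero]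
    have h2 := DFunLike.congr_fun (Ring.inverse_mul_cancel _ (ha Ω hnot)) w
    have h3 : Ring.inverse ((1 - P) + P * (L - Ω • 1) * P) (((1 - P) + P * (L - Ω • 1) * P) w) = w :=
      h2
    rw [h1, map_zero] at h3
    exact hw0 h3.symm
  have hrootreg : ∀ Ω, χ.eval Ω = 0 → ¬IsRegular L Ω := fun Ω hΩ hreg => by
    obtain ⟨w, hw0, -, hw⟩ := hroot Ω hΩ
    have h1 : (L - Ω • ContinuousLinearMap.id ℂ (Pair 2)) w = 0 := by
      change L w - Ω • w = 0
      rw [hw, sub_self]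
    have h3 : Ring.inverse (L - Ω • ContinuousLinearMap.id ℂ (Pair 2))
        ((L - Ω • ContinuousLinearMap.id ℂ (Pair 2)) w) = w :=
      DFunLike.congr_fun (Ring.inverse_mul_cancel _ hreg) w
    rw [h1, map_zero] at h3
    exact hw0 h3.symm
  have hev : ∀ Ω₀ ∈ D, ∀ᶠ Ω in 𝓝[≠] Ω₀, Ω ∈ D ∧ χ.eval Ω ≠ 0 := fun Ω₀ hΩ₀ => by
    have h1 : ∀ᶠ Ω in 𝓝[≠] Ω₀, Ω ∈ D := nhdsWithin_le_nhds (hD.mem_nhds hΩ₀)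
    have h2 : ∀ᶠ Ω in 𝓝[≠] Ω₀, Ω ∉ ((χ.roots.toFinset.erase Ω₀ : Finset ℂ) : Set ℂ) :=
      nhdsWithin_le_nhds ((Finset.finite_toSet _).isClosed.isOpen_compl.mem_nhds (by simp))
    filter_upwards [h1, h2, self_mem_nhdsWithin] with Ω a1 a2 a3
    refine ⟨a1, fun h => a2 ?_⟩
    rw [Finset.mem_coe, Finset.mem_erase, Multiset.mem_toFinset, Polynomial.mem_roots hχ0]
    exact ⟨a3, h⟩
  have hmer : ∀ Ω₀ ∈ D, MeromorphicAt (resolv L) Ω₀ := fun Ω₀ hΩ₀ => by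
    have hbA : AnalyticAt ℂ (fun Ω : ℂ =>
        Ring.inverse (P + (1 - P) * (L - Ω • 1) * (1 - P))) Ω₀ := by
      obtain ⟨e, he⟩ := hb Ω₀ hΩ₀
      have h1 : AnalyticAt ℂ Ring.inverse (P + (1 - P) * (L - Ω₀ • 1) * (1 - P)) := by
        rw [← he]; exact analyticAt_inverse e
      exact h1.fun_comp (f := fun Ω : ℂ => P + (1 - P) * (L - Ω • 1) * (1 - P))
        ((by fun_prop : Differentiable ℂ
          fun Ω : ℂ => P + (1 - P) * (L - Ω • 1) * (1 - P)).analyticAt Ω₀)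
    have hqA : AnalyticAt ℂ (divDiff χ A) Ω₀ := (differentiable_divDiff χ A).analyticAt Ω₀
    have hχA : AnalyticAt ℂ (fun Ω => χ.eval Ω) Ω₀ :=
      (χ.differentiable).analyticAt Ω₀
    have h1 : MeromorphicAt (fun Ω => (1 - P) * (1 - C) *
        Ring.inverse (P + (1 - P) * (L - Ω • 1) * (1 - P))) Ω₀ :=
      (analyticAt_const.mul hbA).meromorphicAt
    have h2 : MeromorphicAt (fun Ω => divDiff χ A Ω * P * (1 - C) *
        Ring.inverse (P + (1 - P) * (L - Ω • 1) * (1 - P))) Ω₀ :=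
      (((hqA.mul analyticAt_const).mul analyticAt_const).mul hbA).meromorphicAt
    refine (h1.sub (hχA.meromorphicAt.inv.smul h2)).congr ?_
    filter_upwards [hev Ω₀ hΩ₀] with Ω hΩ
    rw [(hres Ω hΩ.1 hΩ.2).2, sub_mul (1 - P), sub_mul ((1 - P) * (1 - C)), smul_mul_assoc, smul_mul_assoc]
    rfl
  have hdich : ∀ Ω ∈ D, IsRegular L Ω ∨ IsPole L Ω := fun Ω hΩ =>
    isRegular_or_isPole ((hev Ω hΩ).mono fun x hx => (hres x hx.1 hx.2).1) (hmer Ω hΩ)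
  -- Modulo W, the operator L - Ω acts as the complementary block, which is invertible; a
  -- generalized eigenvector thus vanishes modulo W.
  have hgen : ∀ Ω ∈ D, genEigenspace L Ω ≤ W := fun Ω hΩ x hx => by
    obtain ⟨k, hk⟩ := (Module.End.mem_maxGenEigenspace _ _ _).mp hx
    have hk' : ((L - Ω • 1) ^ k) x = 0 := by
      rw [← hk]
      change ((((L - Ω • 1) ^ k : PairOp) : Pair 2 →ₗ[ℂ] Pair 2)) x = _
      rw [ContinuousLinearMap.toLinearMap_pow]
      rfl
    set b := P + (1 - P) * (L - Ω • 1) * (1 - P) with hbdef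
    have hsemi : SemiconjBy (1 - P) (L - Ω • 1) b := by
      change (1 - P) * (L - Ω • 1) = b * (1 - P)
      have := hinvX Ω
      rw [hbdef, add_mul, hPQ, zero_add, mul_assoc _ (1 - P), hQQ, mul_sub _ 1 P, mul_one, this,
        sub_zero]
    have h1 := DFunLike.congr_fun (hsemi.pow_right k).eq x
    have h2 : (b ^ k) ((1 - P) x) = 0 := by
      have h3 : (1 - P) (((L - Ω • 1) ^ k) x) = (b ^ k) ((1 - P) x) := h1
      rw [← h3, hk', map_zero]
    have h4 : Ring.inverse (b ^ k) ((b ^ k) ((1 - P) x)) = (1 - P) x :=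
      DFunLike.congr_fun (Ring.inverse_mul_cancel _ ((hb Ω hΩ).pow k)) _
    rw [h2, map_zero] at h4
    have h5 : x - P x = 0 := h4.symm
    exact ⟨x, (sub_eq_zero.mp h5).symm⟩
  have hrank : ∀ Ω ∈ D, Module.finrank ℂ (genEigenspace L Ω) = χ.rootMultiplicity Ω := fun Ω hΩ => by
    have h1 : f.maxGenEigenspace Ω = (genEigenspace L Ω).comap W.subtype :=
      Module.End.genEigenspace_restrict _ W ⊤ Ω hLW
    have h2 := LinearMap.finrank_maxGenEigenspace_eq f Ω
    rw [h1] at h2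
    exact (finrank_comap_subtype (hgen Ω hΩ)).symm.trans h2
  refine ⟨hdich, χ.roots.toFinset, ?_, fun Ω hΩ => ?_, ?_⟩
  · ext Ω
    rw [Finset.mem_coe, Multiset.mem_toFinset, Polynomial.mem_roots hχ0]
    constructor
    · intro h
      exact ⟨hrootD Ω h, (hdich Ω (hrootD Ω h)).resolve_left (hrootreg Ω h)⟩
    · rintro ⟨h1, h2⟩
      by_contra h
      exact not_isRegular_of_isPole h2 (hres Ω h1 h).1
  · rw [Multiset.mem_toFinset, Polynomial.mem_roots hχ0] at hΩ
    exact finiteDimensional_of_le hfin (hgen Ω (hrootD Ω hΩ))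
  · have h1 : ∀ Ω ∈ χ.roots.toFinset, Module.finrank ℂ (genEigenspace L Ω) =
        χ.roots.count Ω := fun Ω hΩ => by
      rw [Multiset.mem_toFinset, Polynomial.mem_roots hχ0] at hΩ
      rw [hrank Ω (hrootD Ω hΩ), Polynomial.count_roots]
    rw [Finset.sum_congr rfl h1, Multiset.toFinset_sum_count_eq, IsAlgClosed.card_roots_eq_natDegree,
      hχ, LinearMap.charpoly_natDegree]

end InvariantSubspace

section Riccati

/-! ### Perturbation of an invariant subspace -/

/-- For Y mapping the range of P to its complement, L₀² Y = Y and Y L₀² = 0. The mixed terms L₀ Y L₀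
cancel, so the commutator of L₀ with L₀ Y + Y L₀ is Y. -/
theorem commutator_sylvester {R : Type*} [Ring R] {P L₀ Y : R} (hcomm : P * L₀ = L₀ * P)
    (hK : L₀ * P * (L₀ * P) = 0) (hJ : L₀ * (1 - P) * (L₀ * (1 - P)) = 1 - P)
    (h1 : P * Y = 0) (h2 : Y * P = Y) :
    L₀ * (L₀ * Y + Y * L₀ * P) - (L₀ * Y + Y * L₀ * P) * L₀ = Y := by
  have e1 : Y * L₀ * P = Y * L₀ := by rw [mul_assoc, ← hcomm, ← mul_assoc, h2]
  have e2 : Y * L₀ * L₀ = 0 := by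
    calc Y * L₀ * L₀ = Y * L₀ * P * L₀ := by rw [e1]
      _ = Y * (L₀ * P * (L₀ * P)) := by
        rw [mul_assoc (Y * L₀) P L₀, hcomm, ← mul_assoc, ← mul_assoc Y, ← mul_assoc Y L₀ P, e1,
          ← mul_assoc]
      _ = 0 := by rw [hK, mul_zero]
  have e3 : L₀ * (L₀ * Y) = Y := by
    have h3 : (1 - P) * Y = Y := by rw [sub_mul, one_mul, h1, sub_zero]
    have h4 : (1 - P) * (L₀ * Y) = L₀ * Y := by
      rw [sub_mul, one_mul, ← mul_assoc, hcomm, mul_assoc, h1, mul_zero, sub_zero]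
    have : L₀ * (1 - P) * (L₀ * (1 - P)) * Y = (1 - P) * Y := by rw [hJ]
    rwa [mul_assoc, mul_assoc L₀ (1 - P) Y, h3, mul_assoc, h4] at this
  rw [e1, mul_add, add_mul, e3, e2, add_zero, mul_assoc L₀ Y L₀, add_sub_cancel_right]

variable {R : Type*} [NormedRing R] [NormedAlgebra ℂ R] [CompleteSpace R]

/-- Near 0 the map Φ is Lipschitz and bounded, so ε Φ is a contraction of a small closed ball into
itself. -/
theorem exists_small_fixedPoint {Φ : R → R} (hΦ : ContDiff ℝ 1 Φ) {r : ℝ} (hr : 0 < r) :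
    ∃ ε₁ > (0 : ℝ), ∀ ε : ℝ, 0 < ε → ε < ε₁ → ∃ X, ‖X‖ < r ∧ X = ε • Φ X := by
  obtain ⟨K, t, ht, hK⟩ := (hΦ.contDiffAt (x := (0 : R))).exists_lipschitzOnWith
  obtain ⟨s, hs, hst⟩ := Metric.mem_nhds_iff.mp ht
  set q := min (s / 2) (r / 2) with hq
  have hq0 : 0 < q := by positivity
  have hqs : Metric.closedBall (0 : R) q ⊆ t := fun x hx => hst (by
    rw [Metric.mem_ball]
    rw [Metric.mem_closedBall] at hx
    have := min_le_left (s / 2) (r / 2)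
    linarith)
  have hqr : q < r := by
    have := min_le_right (s / 2) (r / 2)
    linarith
  have hK' := hK.mono hqs
  have h0 : (0 : R) ∈ Metric.closedBall (0 : R) q := Metric.mem_closedBall_self hq0.le
  have hbd : ∀ x ∈ Metric.closedBall (0 : R) q, ‖Φ x‖ ≤ ‖Φ 0‖ + K * q := fun x hx => by
    have h1 := hK'.dist_le_mul x hx 0 h0
    rw [dist_eq_norm, dist_eq_norm, sub_zero] at h1
    rw [mem_closedBall_zero_iff] at hx
    calc ‖Φ x‖ = ‖Φ 0 + (Φ x - Φ 0)‖ := by rw [add_sub_cancel]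
      _ ≤ ‖Φ 0‖ + K * ‖x‖ := (norm_add_le _ _).trans (by gcongr)
      _ ≤ ‖Φ 0‖ + K * q := by gcongr
  refine ⟨min (q / (‖Φ 0‖ + K * q + 1)) (1 / (2 * (K + 1))), by positivity, fun ε hε hε1 => ?_⟩
  have hε2 : ε * (‖Φ 0‖ + K * q) ≤ q := by
    have h1 := hε1.le.trans (min_le_left _ _)
    rw [le_div_iff₀ (by positivity)] at h1
    linarith
  have hε3 : ε * K < 1 := by
    have h1 := hε1.le.trans (min_le_right _ _)
    rw [le_div_iff₀ (by positivity)] at h1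
    nlinarith [K.coe_nonneg]
  have hmaps : Set.MapsTo (fun x => ε • Φ x) (Metric.closedBall (0 : R) q)
      (Metric.closedBall (0 : R) q) := fun x hx => by
    rw [mem_closedBall_zero_iff]
    refine (norm_smul_le ε (Φ x)).trans ?_
    rw [Real.norm_of_nonneg hε.le]
    exact (mul_le_mul_of_nonneg_left (hbd x hx) hε.le).trans hε2
  have hcontr : ContractingWith (⟨ε, hε.le⟩ * K) (hmaps.restrict _ _ _) := by
    refine ⟨by exact_mod_cast hε3, ?_⟩
    refine LipschitzWith.of_dist_le_mul fun x y => ?_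
    have h1 := hK'.dist_le_mul x x.2 y y.2
    change dist (ε • Φ x) (ε • Φ y) ≤ ε * K * dist (x : R) y
    rw [dist_smul₀, Real.norm_of_nonneg hε.le, mul_assoc]
    gcongr
  obtain ⟨X, hX, hfix, -⟩ := hcontr.exists_fixedPoint' Metric.isClosed_closedBall.isComplete
    hmaps h0 (edist_ne_top _ _)
  rw [mem_closedBall_zero_iff] at hX
  exact ⟨X, hX.trans_lt hqr, hfix.symm⟩

/-- The new invariant subspace is the graph of X from the range of P to its complement. Invariance
is the Riccati equation L₀ X - X L₀ = -ε F(X), and inverting the commutator by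
`commutator_sylvester` turns it into a fixed-point problem. Since P X = 0 and X P = X, one has X² =
0, so 1 + X is inverted by 1 - X. -/
theorem exists_invariant_graph {P L₀ : R} (L₁ : R) (hP : P * P = P) (hcomm : P * L₀ = L₀ * P)
    (hK : L₀ * P * (L₀ * P) = 0) (hJ : L₀ * (1 - P) * (L₀ * (1 - P)) = 1 - P)
    {r : ℝ} (hr : 0 < r) :
    ∃ ε₁ > (0 : ℝ), ∀ ε : ℝ, 0 < ε → ε < ε₁ → ∃ X : R, ‖X‖ < r ∧ X * X = 0 ∧
      (1 - P) * ((1 - X) * (L₀ + (ε : ℂ) • L₁) * (1 + X)) * P = 0 := by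
  have hPQ : P * (1 - P) = 0 := by rw [mul_sub, mul_one, hP, sub_self]
  let F : R → R := fun X => (1 - P) * ((1 - X) * L₁ * (1 + X)) * P
  let Φ : R → R := fun X => -(L₀ * F X + F X * L₀ * P)
  have hΦ : ContDiff ℝ 1 Φ := by
    simp only [Φ, F]
    fun_prop
  obtain ⟨ε₁, hε₁, h⟩ := exists_small_fixedPoint hΦ hr
  refine ⟨ε₁, hε₁, fun ε hε hεlt => ?_⟩
  obtain ⟨X, hXr, hX⟩ := h ε hε hεlt
  have hX' : X = (ε : ℂ) • Φ X := hX.trans (Complex.coe_smul ε (Φ X)).symm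
  have hF1 : P * F X = 0 := by
    change P * ((1 - P) * _ * P) = 0
    rw [← mul_assoc, ← mul_assoc, hPQ, zero_mul, zero_mul]
  have hF2 : F X * P = F X := by
    change (1 - P) * _ * P * P = _
    rw [mul_assoc _ P P, hP]
  have hΦ1 : P * Φ X = 0 := by
    change P * -(L₀ * F X + F X * L₀ * P) = 0
    rw [mul_neg, mul_add, ← mul_assoc, hcomm, mul_assoc L₀, hF1, ← mul_assoc, ← mul_assoc, hF1]
    simp
  have hΦ2 : Φ X * P = Φ X := by
    change -(L₀ * F X + F X * L₀ * P) * P = -(L₀ * F X + F X * L₀ * P)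
    rw [neg_mul, add_mul, mul_assoc L₀, hF2, mul_assoc _ P P, hP]
  have hX1 : P * X = 0 := by rw [hX', mul_smul_comm, hΦ1, smul_zero]
  have hX2 : X * P = X := by
    conv_lhs => rw [hX', smul_mul_assoc, hΦ2, ← hX']
  have hXX : X * X = 0 := by
    calc X * X = X * P * X := by rw [hX2]
      _ = 0 := by rw [mul_assoc, hX1, mul_zero]
  refine ⟨X, hXr, hXX, ?_⟩
  have hS := commutator_sylvester hcomm hK hJ hF1 hF2
  have hcX : L₀ * X - X * L₀ = -((ε : ℂ) • F X) := by
    have h1 : L₀ * X - X * L₀ = (ε : ℂ) • (L₀ * Φ X - Φ X * L₀) := by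
      conv_lhs => rw [hX', mul_smul_comm, smul_mul_assoc, ← smul_sub]
    have h2 : L₀ * Φ X - Φ X * L₀ = -F X := by
      change L₀ * -(L₀ * F X + F X * L₀ * P) - -(L₀ * F X + F X * L₀ * P) * L₀ = _
      rw [mul_neg, neg_mul, ← neg_sub', hS]
    rw [h1, h2, smul_neg]
  have hXL : X * L₀ * P = X * L₀ := by rw [mul_assoc, ← hcomm, ← mul_assoc, hX2]
  have hXLX : X * L₀ * X = 0 := by rw [← hXL, mul_assoc, hX1, mul_zero]
  have hQX : (1 - P) * X = X := by rw [sub_mul, one_mul, hX1, sub_zero]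
  have hQL : (1 - P) * L₀ = L₀ * (1 - P) := by rw [sub_mul, mul_sub, one_mul, mul_one, hcomm]
  have hQP : (1 - P) * P = 0 := by rw [sub_mul, one_mul, hP, sub_self]
  have hL0 : (1 - P) * ((1 - X) * L₀ * (1 + X)) * P = L₀ * X - X * L₀ := by
    have h1 : (1 - X) * L₀ * (1 + X) = L₀ + L₀ * X - X * L₀ - X * L₀ * X := by noncomm_ring
    rw [h1, hXLX, sub_zero, mul_sub, mul_add, ← mul_assoc, ← mul_assoc, hQX, hQL,
      mul_assoc L₀ _ X, hQX, sub_mul, add_mul, mul_assoc L₀ _ P, hQP, mul_zero, zero_add,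
      mul_assoc L₀ X P, hX2, hXL]
  have h3 : (1 - P) * ((1 - X) * (L₀ + (ε : ℂ) • L₁) * (1 + X)) * P =
      (1 - P) * ((1 - X) * L₀ * (1 + X)) * P + (ε : ℂ) • F X := by
    change _ = _ + (ε : ℂ) • ((1 - P) * ((1 - X) * L₁ * (1 + X)) * P)
    rw [mul_add (1 - X), add_mul, mul_add (1 - P), add_mul, mul_smul_comm, smul_mul_assoc,
      mul_smul_comm, smul_mul_assoc]
  rw [h3, hL0, hcX, neg_add_cancel]

end Riccati

section PolesNearZero

/-! ### The poles near the origin -/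

variable {u v : ℤ}

theorem opL_eq_add_smul (p : ℕ) (ε : ℝ) : opL (Finset.Icc u v) p ε =
    opL (Finset.Icc u v) p 0 + (ε : ℂ) • blk (-laplacian) 0 0 laplacian := by
  rw [opL_eq_blk, opL_eq_blk, smul_blk, blk_add, diagonalBlock, diagonalBlock]
  simp only [Complex.ofReal_zero, zero_smul, smul_zero]
  congr 1 <;> module

theorem opL_zero_eq_blk (p : ℕ) : opL (Finset.Icc u v) p 0 =
    blk (1 - (1 + p : ℂ) • core u v) (-((p : ℂ) • core u v)) ((p : ℂ) • core u v)
      (-(1 - (1 + p : ℂ) • core u v)) := by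
  have h : diagonalBlock (Finset.Icc u v) p 0 = 1 - (1 + p : ℂ) • core u v := by
    rw [diagonalBlock, core_eq_potential, Complex.ofReal_zero, zero_smul, neg_zero, zero_add]
    rfl
  rw [opL_eq_blk, h, core_eq_potential]

theorem coreP_commute_opL_zero (p : ℕ) :
    coreP u v * opL (Finset.Icc u v) p 0 = opL (Finset.Icc u v) p 0 * coreP u v := by
  have hV := core_mul_core (u := u) (v := v)
  rw [opL_zero_eq_blk, coreP, blk_mul, blk_mul]
  congr 1 <;>
  simp only [zero_mul, mul_zero, add_zero, zero_add, mul_sub, sub_mul, mul_smul_comm,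
    smul_mul_assoc, mul_one, one_mul, mul_neg, neg_mul, smul_zero, sub_zero, neg_zero, hV]

theorem opL_zero_mul_coreP (p : ℕ) : opL (Finset.Icc u v) p 0 * coreP u v =
    blk (-((p : ℂ) • core u v)) (-((p : ℂ) • core u v)) ((p : ℂ) • core u v)
      ((p : ℂ) • core u v) := by
  have hV := core_mul_core (u := u) (v := v)
  rw [opL_zero_eq_blk, coreP, blk_mul]
  congr 1 <;>
  simp only [mul_zero, add_zero, zero_add, sub_mul,
    smul_mul_assoc, one_mul, neg_mul, hV] <;> module

theorem opL_zero_coreP_sq (p : ℕ) : opL (Finset.Icc u v) p 0 * coreP u v *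
    (opL (Finset.Icc u v) p 0 * coreP u v) = 0 := by
  have hV := core_mul_core (u := u) (v := v)
  have h0 : (0 : PairOp) = blk 0 0 0 0 := by
    have := smul_blk 0 1 0 0 1
    simpa using this
  rw [opL_zero_mul_coreP, blk_mul, h0]
  congr 1 <;>
  simp only [mul_smul_comm, smul_mul_assoc, mul_neg, neg_mul, hV] <;> module

theorem opL_zero_mul_compl (p : ℕ) : opL (Finset.Icc u v) p 0 * (1 - coreP u v) =
    blk (1 - core u v) 0 0 (-(1 - core u v)) := by
  rw [mul_sub, mul_one, opL_zero_mul_coreP, opL_zero_eq_blk, blk_sub]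
  congr 1 <;> module

theorem one_sub_coreP : 1 - coreP u v = blk (1 - core u v) 0 0 (1 - core u v) := by
  rw [coreP, one_eq_blk, blk_sub, sub_zero]

theorem compl_core_mul_self : (1 - core u v) * (1 - core u v) = 1 - core u v := by
  rw [mul_sub, mul_one, sub_mul, one_mul, core_mul_core, sub_self, sub_zero]

theorem opL_zero_compl_sq (p : ℕ) : opL (Finset.Icc u v) p 0 * (1 - coreP u v) *
    (opL (Finset.Icc u v) p 0 * (1 - coreP u v)) = 1 - coreP u v := by
  rw [opL_zero_mul_compl, one_sub_coreP, blk_mul]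
  simp only [mul_zero, zero_mul, add_zero, zero_add, neg_mul, mul_neg, neg_neg,
    neg_zero, compl_core_mul_self]

theorem coreLimit_eq (p : ℕ) (Ω : ℂ) : coreLimit u v p Ω =
    (1 - coreP u v) + coreP u v * (opL (Finset.Icc u v) p 0 - Ω • 1) * coreP u v := by
  rw [mul_sub, sub_mul, mul_smul_comm, mul_one, smul_mul_assoc, coreP_mul_coreP,
    coreP_commute_opL_zero, mul_assoc, coreP_mul_coreP, opL_zero_mul_coreP, one_sub_coreP,
    coreP, smul_blk, blk_sub, blk_add, coreLimit]
  congr 1 <;> module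

/-- The inclusion of the pairs of sequences supported in `[u, v]`. -/
def coreIncl (u v : ℤ) : (Finset.Icc u v → ℂ) × (Finset.Icc u v → ℂ) →ₗ[ℂ] Pair 2 :=
  (Fintype.linearCombination ℂ fun m : Finset.Icc u v => basisVec m).prodMap
    (Fintype.linearCombination ℂ fun m : Finset.Icc u v => basisVec m)

theorem linearCombination_basisVec_apply (a : Finset.Icc u v → ℂ) (n : ℤ) :
    Fintype.linearCombination ℂ (fun m : Finset.Icc u v => basisVec m) a n =
      if h : n ∈ Finset.Icc u v then a ⟨n, h⟩ else 0 := by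
  rw [Fintype.linearCombination_apply, lp.coeFn_sum, Finset.sum_apply]
  have h1 : ∀ m : Finset.Icc u v, (a m • basisVec m : Slp 2) n = if n = m then a m else 0 :=
    fun m => by
      change a m * basisVec m n = _
      rw [basisVec_apply, mul_ite, mul_one, mul_zero]
  simp only [h1]
  split_ifs with h
  · rw [Finset.sum_eq_single ⟨n, h⟩]
    · simp
    · intro m _ hm
      rw [if_neg]
      rintro rfl
      exact hm rfl
    · intro h'; exact absurd (Finset.mem_univ _) h'
  · refine Finset.sum_eq_zero fun m _ => if_neg ?_
    rintro rfl
    exact h m.2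

theorem coreIncl_injective : Function.Injective (coreIncl u v) := by
  have h : Function.Injective
      (Fintype.linearCombination ℂ fun m : Finset.Icc u v => basisVec m) := fun a b hab => by
    funext m
    have h1 := linearCombination_basisVec_apply a m
    have h2 := linearCombination_basisVec_apply b m
    rw [dif_pos m.2] at h1 h2
    rw [← h1, ← h2, hab]
  exact Function.Injective.prodMap h h

theorem core_linearCombination (a : Finset.Icc u v → ℂ) :
    core u v (Fintype.linearCombination ℂ (fun m : Finset.Icc u v => basisVec m) a) =
      Fintype.linearCombination ℂ (fun m : Finset.Icc u v => basisVec m) a := by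
  ext n
  rw [core_apply, linearCombination_basisVec_apply]
  by_cases h : n ∈ Finset.Icc u v
  · rw [if_pos (Finset.mem_Icc.mp h)]
  · rw [if_neg (fun h' => h (Finset.mem_Icc.mpr h')), dif_neg h]

theorem core_eq_linearCombination (f : Slp 2) :
    core u v f = Fintype.linearCombination ℂ (fun m : Finset.Icc u v => basisVec m)
      (fun m => f m) := by
  ext n
  rw [core_apply, linearCombination_basisVec_apply]
  by_cases h : n ∈ Finset.Icc u v
  · rw [if_pos (Finset.mem_Icc.mp h), dif_pos h]
  · rw [if_neg (fun h' => h (Finset.mem_Icc.mpr h')), dif_neg h]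

theorem coreP_apply (h : Pair 2) : coreP u v h = (core u v h.1, core u v h.2) := by
  rw [coreP, blk_apply]
  refine Prod.ext ?_ ?_
  · change core u v h.1 + 0 = _
    rw [add_zero]
  · change 0 + core u v h.2 = _
    rw [zero_add]

/-- The range is parametrized by finitely many coordinates, from which its dimension can be read
off. -/
theorem range_conj_coreP {T S : PairOp} (hST : S * T = 1) :
    (T * coreP u v * S).range = LinearMap.range ((T : Pair 2 →ₗ[ℂ] Pair 2) ∘ₗ coreIncl u v) := by
  ext y
  constructor
  · rintro ⟨x, rfl⟩
    refine ⟨(fun m => (S x).1 m, fun m => (S x).2 m), ?_⟩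
    change T (coreIncl u v _) = T (coreP u v (S x))
    rw [coreP_apply, core_eq_linearCombination, core_eq_linearCombination]
    rfl
  · rintro ⟨a, rfl⟩
    refine ⟨T (coreIncl u v a), ?_⟩
    change T (coreP u v (S (T (coreIncl u v a)))) = T (coreIncl u v a)
    have h1 : S (T (coreIncl u v a)) = coreIncl u v a := DFunLike.congr_fun hST _
    rw [h1, coreP_apply]
    congr 1
    exact Prod.ext (core_linearCombination a.1) (core_linearCombination a.2)

theorem finrank_range_conj_coreP {T S : PairOp} (hST : S * T = 1) :
    FiniteDimensional ℂ (T * coreP u v * S).range ∧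
      Module.finrank ℂ (T * coreP u v * S).range = 2 * (Finset.Icc u v).card := by
  have hinj : Function.Injective ((T : Pair 2 →ₗ[ℂ] Pair 2) ∘ₗ coreIncl u v) := by
    have hT : Function.LeftInverse S T := fun x => DFunLike.congr_fun hST x
    intro a b hab
    exact coreIncl_injective (hT.injective hab)
  rw [range_conj_coreP hST]
  refine ⟨inferInstance, ?_⟩
  rw [LinearMap.finrank_range_of_inj hinj, Module.finrank_prod, Module.finrank_fintype_fun_eq_card,
    Fintype.card_coe, two_mul]

-- Conjugation by 1 + X turns L into an operator M that is close to L₀ and leaves the range of P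
-- invariant. The hypotheses of `hasExactlyPolesIn_of_invariant` are checked for M and then
-- transported back.
set_option maxHeartbeats 1000000 in
theorem exists_hasExactlyPolesIn (u v : ℤ) (p : ℕ) :
    ∃ δ₀ > (0 : ℝ), ∀ δ, 0 < δ → δ ≤ δ₀ → ∃ ε₁ > (0 : ℝ), ∀ ε, 0 < ε → ε < ε₁ →
      HasExactlyPolesIn (opL (Finset.Icc u v) p ε) (Metric.ball 0 δ)
        (2 * (Finset.Icc u v).card) := by
  set P := coreP u v with hPdef
  set L₀ := opL (Finset.Icc u v) p 0 with hL₀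
  set L₁ := blk (-laplacian) 0 0 laplacian with hL₁
  have hP : P * P = P := coreP_mul_coreP
  have hcomm : P * L₀ = L₀ * P := coreP_commute_opL_zero p
  have hPQ : P * (1 - P) = 0 := by rw [mul_sub, mul_one, hP, sub_self]
  have hQP : (1 - P) * P = 0 := by rw [sub_mul, one_mul, hP, sub_self]
  have hQQ : (1 - P) * (1 - P) = 1 - P := by rw [mul_sub, mul_one, hQP, sub_zero]
  have hQL : (1 - P) * L₀ = L₀ * (1 - P) := by rw [sub_mul, mul_sub, one_mul, mul_one, hcomm]
  -- The complementary block at ε = 0 and Ω = 0; it is its own inverse.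
  set b₀ := P + L₀ * (1 - P) with hb₀
  have hb₀sq : b₀ * b₀ = 1 := by
    have h1 : P * (L₀ * (1 - P)) = 0 := by rw [← mul_assoc, hcomm, mul_assoc, hPQ, mul_zero]
    have h2 : L₀ * (1 - P) * P = 0 := by rw [mul_assoc, hQP, mul_zero]
    rw [hb₀, add_mul, mul_add, mul_add, hP, h1, h2, opL_zero_compl_sq, add_zero, zero_add,
      add_sub_cancel]
  set C := ‖b₀‖ + 1 with hC
  have hC0 : 0 < C := by positivity
  set q := ‖1 - P‖ + 1 with hq
  have hq0 : 0 < q := by positivity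
  have hQq : ‖1 - P‖ ≤ q := by rw [hq]; linarith
  set π := ‖P‖ + 1 with hπ
  have hπ0 : 0 < π := by positivity
  have hPπ : ‖P‖ ≤ π := by rw [hπ]; linarith
  -- Half of the admissible perturbation 1/(2C) of b₀ is reserved for the term with Ω, the other
  -- half for M - L₀.
  refine ⟨(4 * C * q)⁻¹, by positivity, fun δ hδ hδ0 => ?_⟩
  have hB := coreBound_pos p hδ
  set ρ := min (4 * C * q ^ 2)⁻¹ (2 * coreBound p δ * π ^ 2)⁻¹ with hρ
  have hρ0 : 0 < ρ := by positivity
  have hcont : Continuous fun x : ℝ × PairOp =>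
      (1 - x.2) * (L₀ + (x.1 : ℂ) • L₁) * (1 + x.2) := by fun_prop
  obtain ⟨s, hs, hsρ⟩ := Metric.continuousAt_iff.mp (hcont.continuousAt (x := (0, 0))) ρ hρ0
  obtain ⟨ε₁, hε₁, hgraph⟩ := exists_invariant_graph L₁ hP hcomm (opL_zero_coreP_sq p)
    (opL_zero_compl_sq p) hs
  refine ⟨min ε₁ s, lt_min hε₁ hs, fun ε hε hεlt => ?_⟩
  obtain ⟨X, hXs, hXX, hX⟩ := hgraph ε hε (hεlt.trans_le (min_le_left _ _))
  set M := (1 - X) * (L₀ + (ε : ℂ) • L₁) * (1 + X) with hM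
  have hML : ‖M - L₀‖ ≤ ρ := by
    have h1 := hsρ (x := (ε, X)) (by
      rw [Prod.dist_eq, dist_zero_right, dist_zero_right, Real.norm_of_nonneg hε.le]
      exact max_lt (hεlt.trans_le (min_le_right _ _)) hXs)
    rw [dist_eq_norm] at h1
    simp only [Complex.ofReal_zero, zero_smul, add_zero, sub_zero, one_mul, mul_one] at h1
    exact h1.le
  have hT1 : (1 + X) * (1 - X) = 1 := by
    rw [mul_sub, mul_one, add_mul, one_mul, hXX, add_zero, add_sub_cancel_right]
  have hT2 : (1 - X) * (1 + X) = 1 := by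
    rw [mul_add, mul_one, sub_mul, one_mul, hXX, sub_zero, sub_add_cancel]
  have hLM : opL (Finset.Icc u v) p ε = (1 + X) * M * (1 - X) := by
    rw [opL_eq_add_smul, hM]
    calc L₀ + (ε : ℂ) • L₁ = 1 * (L₀ + (ε : ℂ) • L₁) * 1 := by rw [one_mul, mul_one]
      _ = (1 + X) * (1 - X) * (L₀ + (ε : ℂ) • L₁) * ((1 + X) * (1 - X)) := by rw [hT1]
      _ = _ := by simp only [mul_assoc]
  have hconj : ∀ A B : PairOp, (1 + X) * A * (1 - X) * ((1 + X) * B * (1 - X)) =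
      (1 + X) * (A * B) * (1 - X) := fun A B => by
    calc (1 + X) * A * (1 - X) * ((1 + X) * B * (1 - X))
        = (1 + X) * A * ((1 - X) * (1 + X)) * B * (1 - X) := by simp only [mul_assoc]
      _ = _ := by rw [hT2, mul_one, mul_assoc (1 + X) A B]
  have hconj1 : ∀ A : PairOp, 1 - (1 + X) * A * (1 - X) = (1 + X) * (1 - A) * (1 - X) := fun A => by
    rw [mul_sub (1 + X) 1 A, mul_one, sub_mul (1 + X), hT1]
  have hconjΩ : ∀ Ω : ℂ, opL (Finset.Icc u v) p ε - Ω • 1 = (1 + X) * (M - Ω • 1) * (1 - X) :=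
    fun Ω => by
      rw [hLM, mul_sub (1 + X) M, mul_smul_comm, mul_one, sub_mul ((1 + X) * M), smul_mul_assoc,
        hT1]
  have hunit : ∀ A : PairOp, IsUnit A → IsUnit ((1 + X) * A * (1 - X)) := fun A hA => by
    have h1 : IsUnit (1 + X) := ⟨⟨_, _, hT1, hT2⟩, rfl⟩
    have h2 : IsUnit (1 - X) := ⟨⟨_, _, hT2, hT1⟩, rfl⟩
    exact (h1.mul hA).mul h2
  have hbM : ∀ Ω ∈ Metric.ball (0 : ℂ) δ, IsUnit (P + (1 - P) * (M - Ω • 1) * (1 - P)) :=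
    fun Ω hΩ => by
    have h1 : P + (1 - P) * (M - Ω • 1) * (1 - P) =
        b₀ + ((1 - P) * (M - L₀) * (1 - P) - Ω • (1 - P)) := by
      have h2 : L₀ * (1 - P) = (1 - P) * L₀ * (1 - P) := by rw [hQL, mul_assoc, hQQ]
      rw [hb₀, h2, mul_sub (1 - P) M L₀, sub_mul ((1 - P) * M), mul_sub (1 - P) M,
        sub_mul ((1 - P) * M), mul_smul_comm, mul_one, smul_mul_assoc, hQQ]
      abel
    rw [h1]
    refine (isUnit_add_of_norm_le hb₀sq hb₀sq hC0 (by rw [hC]; linarith) ?_).1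
    have h3 : ‖(1 - P) * (M - L₀) * (1 - P)‖ ≤ q * (4 * C * q ^ 2)⁻¹ * q := by
      refine (norm_mul_le _ _).trans (mul_le_mul ((norm_mul_le _ _).trans
        (mul_le_mul hQq (hML.trans (min_le_left _ _)) (norm_nonneg _) hq0.le)) hQq
        (norm_nonneg _) (by positivity))
    have h4 : ‖Ω • (1 - P)‖ ≤ (4 * C * q)⁻¹ * q := by
      refine (norm_smul_le Ω (1 - P)).trans (mul_le_mul ?_ hQq (norm_nonneg _) (by positivity))
      rw [mem_ball_zero_iff] at hΩ
      exact hΩ.le.trans hδ0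
    calc _ ≤ q * (4 * C * q ^ 2)⁻¹ * q + (4 * C * q)⁻¹ * q :=
          (norm_sub_le _ _).trans (add_le_add h3 h4)
      _ = (2 * C)⁻¹ := by field_simp; norm_num
  have haM : ∀ Ω ∉ Metric.ball (0 : ℂ) δ, IsUnit ((1 - P) + P * (M - Ω • 1) * P) :=
    fun Ω hΩ => by
    have hΩ' : δ ≤ ‖Ω‖ := by rwa [mem_ball_zero_iff, not_lt] at hΩ
    have hΩ0 : Ω ≠ 0 := norm_pos_iff.mp (hδ.trans_le hΩ')
    have h1 : (1 - P) + P * (M - Ω • 1) * P = coreLimit u v p Ω + P * (M - L₀) * P := by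
      rw [coreLimit_eq, ← hPdef, ← hL₀]
      rw [mul_sub P M L₀, sub_mul (P * M), mul_sub P M, mul_sub P L₀, sub_mul (P * M),
        sub_mul (P * L₀)]
      abel
    rw [h1]
    refine (isUnit_add_of_norm_le (coreLimit_mul_inv p hΩ0) (inv_mul_coreLimit p hΩ0) hB
      (norm_coreLimitInv_le p hδ hΩ') ?_).1
    calc ‖P * (M - L₀) * P‖ ≤ π * (2 * coreBound p δ * π ^ 2)⁻¹ * π :=
          (norm_mul_le _ _).trans (mul_le_mul ((norm_mul_le _ _).trans
            (mul_le_mul hPπ (hML.trans (min_le_right _ _)) (norm_nonneg _) hπ0.le)) hPπ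
            (norm_nonneg _) (by positivity))
      _ = (2 * coreBound p δ)⁻¹ := by field_simp
  obtain ⟨hfin, hrank⟩ := finrank_range_conj_coreP (u := u) (v := v) hT2
  rw [← hrank]
  refine hasExactlyPolesIn_of_invariant Metric.isOpen_ball ?_ hfin ?_ (fun Ω hΩ => ?_)
    fun Ω hΩ => ?_
  · rw [hconj, coreP_mul_coreP]
  · rw [hLM, hconj1, hconj, hconj, ← hPdef, hX, mul_zero, zero_mul]
  · rw [hconj1, hconjΩ, hconj, hconj, ← add_mul, ← mul_add]
    exact hunit _ (hbM Ω hΩ)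
  · rw [hconj1, hconjΩ, hconj, hconj, ← add_mul, ← mul_add]
    exact hunit _ (haM Ω hΩ)

end PolesNearZero

end DNLS

end

/-! ### Choice of the constants and conclusion -/

theorem theorem1 (p : ℕ) (hp : 1 ≤ p) (Uplus Uminus : Finset ℤ) (hdisj : Disjoint Uplus Uminus)
    (hne : (Uplus ∪ Uminus).Nonempty)
    (hconn : ((Uplus ∪ Uminus : Finset ℤ) : Set ℤ).OrdConnected) :
    ∀ η > (0 : ℝ), ∃ ε₀ δ : ℝ, (0 < ε₀ ∧ ε₀ < η) ∧ (0 < δ ∧ δ < η) ∧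
      (∀ ε : ℝ, 0 < ε → ε < ε₀ →
        (∀ Ω : ℂ, Ω ∉ Metric.ball (0 : ℂ) δ ∪ Complex.ofReal '' DNLS.bands ε →
          DNLS.IsRegular (DNLS.opL (Uplus ∪ Uminus) p ε) Ω) ∧
        DNLS.HasExactlyPolesIn (DNLS.opL (Uplus ∪ Uminus) p ε) (Metric.ball (0 : ℂ) δ)
          (2 * (Uplus.card + Uminus.card))) ∧
      ∃ C : ℝ, 0 < C ∧ ∀ ε : ℝ, 0 < ε → ε < ε₀ → ∀ Ω ∈ DNLS.bands ε,
        (∃ Rplus Rminus : DNLS.PairW 1 1 →L[ℂ] DNLS.Pair ∞,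
          DNLS.IsBoundaryValue (DNLS.opL (Uplus ∪ Uminus) p ε) 1 Ω Rplus ∧
          DNLS.IsBoundaryValue (DNLS.opL (Uplus ∪ Uminus) p ε) (-1) Ω Rminus ∧
          ‖Rplus‖ ≤ C * ε⁻¹ ∧ ‖Rminus‖ ≤ C * ε⁻¹) ∧
        (Ω ∈ interior (DNLS.bands ε) →
          DNLS.HasWeightedLimit (DNLS.opL (Uplus ∪ Uminus) p ε) 1 Ω ∧
          DNLS.HasWeightedLimit (DNLS.opL (Uplus ∪ Uminus) p ε) (-1) Ω) := by
  intro η hη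
  obtain ⟨u, v, huv, hU⟩ : ∃ u v : ℤ, u ≤ v ∧ Uplus ∪ Uminus = Finset.Icc u v := by
    refine ⟨(Uplus ∪ Uminus).min' hne, (Uplus ∪ Uminus).max' hne, Finset.min'_le_max' _ hne, ?_⟩
    ext n
    rw [Finset.mem_Icc]
    refine ⟨fun h => ⟨Finset.min'_le _ n h, Finset.le_max' _ n h⟩, fun h => ?_⟩
    exact hconn.out (Finset.mem_coe.mpr (Finset.min'_mem _ hne))
      (Finset.mem_coe.mpr (Finset.max'_mem _ hne)) h
  have hcard : Uplus.card + Uminus.card = (Finset.Icc u v).card := by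
    rw [← hU, Finset.card_union_of_disjoint hdisj]
  rw [hcard, hU]
  obtain ⟨δ₀, hδ₀, hpoles⟩ := DNLS.exists_hasExactlyPolesIn u v p
  -- The bound δ ≤ 1 makes |Ω| ≥ δ on the bands. The threshold ε₀ is chosen after δ, because
  -- `coreBound` depends on δ.
  set δ := min δ₀ (min 1 (η / 2)) with hδdef
  have hδ : 0 < δ := by positivity
  have hδ1 : δ ≤ 1 := (min_le_right _ _).trans (min_le_left _ _)
  have hδη : δ < η := ((min_le_right _ _).trans (min_le_right _ _)).trans_lt (by linarith)
  obtain ⟨ε₁, hε₁, hε₁poles⟩ := hpoles δ hδ (min_le_left _ _)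
  have hB := DNLS.coreBound_pos p hδ
  set ε₀ := min (min ε₁ (η / 2)) (min (1 / 4) (24 * DNLS.coreBound p δ)⁻¹) with hε₀def
  have hε₀ : 0 < ε₀ := by positivity
  have hε₀1 : ε₀ ≤ ε₁ := (min_le_left _ _).trans (min_le_left _ _)
  have hε₀η : ε₀ < η := ((min_le_left _ _).trans (min_le_right _ _)).trans_lt (by linarith)
  have hε₀4 : ε₀ ≤ 1 / 4 := (min_le_right _ _).trans (min_le_left _ _)
  have hε₀B : ε₀ ≤ (24 * DNLS.coreBound p δ)⁻¹ := (min_le_right _ _).trans (min_le_right _ _)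
  refine ⟨ε₀, δ, ⟨hε₀, hε₀η⟩, ⟨hδ, hδη⟩, fun ε hε hεlt => ⟨fun Ω hΩ => ?_, ?_⟩,
    2 * DNLS.kernelBound u v p δ, mul_pos two_pos (DNLS.kernelBound_pos p hδ),
    fun ε hε hεlt Ω hΩ => ?_⟩
  · rw [Set.mem_union, not_or, mem_ball_zero_iff, not_lt] at hΩ
    exact DNLS.isRegular_of_notMem_bands huv p hδ hε (hεlt.le.trans hε₀B) hΩ.1 hΩ.2
  · exact hε₁poles ε hε (hεlt.trans_le hε₀1)
  · obtain ⟨⟨B₁, hB₁, hn₁⟩, hw₁⟩ := DNLS.boundary_values_opL huv p hδ hδ1 hε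
      (hεlt.le.trans hε₀4) (hεlt.le.trans hε₀B) (τ := 1) (by simp) hΩ
    obtain ⟨⟨B₂, hB₂, hn₂⟩, hw₂⟩ := DNLS.boundary_values_opL huv p hδ hδ1 hε
      (hεlt.le.trans hε₀4) (hεlt.le.trans hε₀B) (τ := -1) (by simp) hΩ
    exact ⟨⟨B₁, B₂, hB₁, hB₂, hn₁, hn₂⟩, fun h => ⟨hw₁ h, hw₂ h⟩⟩
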